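/- Let $T>0$ and $J=(0,T)$. For $r\in(1,\infty)$ and complex Banach spaces $D\hookrightarrow X$ (continuously embedded), let $W^{1,r}_0(J;X)$ be the space of all $w\in L^r(J;X)$ whose distributional derivative $w'$ lies in $L^r(J;X)$ and whose continuous representative on $[0,T]$ satisfies $w(0)=0$, and let $$\mathrm{MR}^r_0(J;D,X):=L^r(J;D)\cap W^{1,r}_0(J;X),\qquad \|u\|_{\mathrm{MR}^r_0(J;D,X)}=\|u\|_{L^r(J;D)}+\|u'\|_{L^r(J;X)} .$$ If $D$ is dense in $X$, an operator $\mathcal A\in\mathcal L(D;X)$ is said to satisfy maximal parabolic regularity on $X$ if it is closed as an operator in $X$ with domain $D$ and there is an $s\in(1,\infty)$ such that for every $f\in L^s(J;X)$ there is a unique $u\in \mathrm{MR}^s_0(J;D,X)$ with $u'(t)+\mathcal A u(t)=f(t)$ for almost all $t\in J$. Let $X,Y,D,E$ be complex Banach spaces with continuous embeddings $X\hookrightarrow Y$, $D\hookrightarrow X$ and $E\hookrightarrow Y$, such that $D$ is dense in $X$ and $E$ is dense in $Y$. Assume that $(D,X)$ and $(E,Y)$ form a pair of common maximal parabolic regularity,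 i.e. there is an operator $\mathcal B\in\mathcal L(E;Y)$ such that $D=\{x\in E\cap X:\mathcal Bx\in X\}$, $\mathcal B$ satisfies maximal parabolic regularity on $Y$, $\mathcal B|_D\in\mathcal L(D;X)$, and $\mathcal B|_D$ satisfies maximal parabolic regularity on $X$. Let $r_0,r_1\in(1,\infty)$ and $\theta\in(0,1)$, and let $r$ be given by $\frac1r=\frac{1-\theta}{r_0}+\frac{\theta}{r_1}$. Then $\bigl(\mathrm{MR}^{r_0}_0(J;D,X),\mathrm{MR}^{r_1}_0(J;E,Y)\bigr)$ is an interpolation couple (both spaces embed continuously in $L^1(J;Y)$), and $$\bigl[\mathrm{MR}^{r_0}_0(J;D,X),\,\mathrm{MR}^{r_1}_0(J;E,Y)\bigr]_\theta=\mathrm{MR}^{r}_0\bigl(J;[D,E]_\theta,[X,Y]_\theta\bigr)$$ as subspaces of $L^1(J;Y)$, with equivalent norms, where $[\cdot,\cdot]_\theta$ denotes complex interpolation. -/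

import Mathlib

open MeasureTheory Set Filter Topology
open scoped ENNReal ContDiff BoundedContinuousFunction ZeroAtInfty

noncomputable section

namespace MaxReg

/-! ### Complex interpolation of a couple

A couple is given by two normed spaces `A₀`, `A₁` with continuous linear maps `i₀`, `i₁` into a common
normed space `V` (injective, for a genuine interpolation couple). -/

section Interpolation

variable {A₀ A₁ V : Type*}
  [NormedAddCommGroup A₀] [NormedSpace ℂ A₀]
  [NormedAddCommGroup A₁] [NormedSpace ℂ A₁]
  [NormedAddCommGroup V] [NormedSpace ℂ V]

/-- `(A₀, A₁)` is an interpolation couple: both spaces are continuously embedded in `V`. -/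
def IsCouple (i₀ : A₀ →L[ℂ] V) (i₁ : A₁ →L[ℂ] V) : Prop :=
  Function.Injective i₀ ∧ Function.Injective i₁

/-- The map `(a, b) ↦ i₀ a + i₁ b`, on `A₀ × A₁` with the norm `‖a‖ + ‖b‖`. -/
def addMap (i₀ : A₀ →L[ℂ] V) (i₁ : A₁ →L[ℂ] V) : WithLp 1 (A₀ × A₁) →L[ℂ] V :=
  i₀ ∘L WithLp.fstL 1 ℂ A₀ A₁ + i₁ ∘L WithLp.sndL 1 ℂ A₀ A₁

/-- The pairs `(a, b)` with `i₀ a + i₁ b = 0`. -/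
def addKer (i₀ : A₀ →L[ℂ] V) (i₁ : A₁ →L[ℂ] V) : Submodule ℂ (WithLp 1 (A₀ × A₁)) :=
  (addMap i₀ i₁).ker

instance (i₀ : A₀ →L[ℂ] V) (i₁ : A₁ →L[ℂ] V) :
    IsClosed (addKer i₀ i₁ : Set (WithLp 1 (A₀ × A₁))) :=
  (addMap i₀ i₁).isClosed_ker

/-- The sum `A₀ + A₁`, realized as a quotient of `A₀ × A₁`. The quotient norm is
`‖x‖ = inf {‖a‖ + ‖b‖ : x = a + b}`. -/
def SumSpace (i₀ : A₀ →L[ℂ] V) (i₁ : A₁ →L[ℂ] V) : Type _ :=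
  WithLp 1 (A₀ × A₁) ⧸ addKer i₀ i₁

instance (i₀ : A₀ →L[ℂ] V) (i₁ : A₁ →L[ℂ] V) : NormedAddCommGroup (SumSpace i₀ i₁) :=
  inferInstanceAs (NormedAddCommGroup (WithLp 1 (A₀ × A₁) ⧸ addKer i₀ i₁))

instance (i₀ : A₀ →L[ℂ] V) (i₁ : A₁ →L[ℂ] V) : NormedSpace ℂ (SumSpace i₀ i₁) :=
  inferInstanceAs (NormedSpace ℂ (WithLp 1 (A₀ × A₁) ⧸ addKer i₀ i₁))

instance [CompleteSpace A₀] [CompleteSpace A₁] (i₀ : A₀ →L[ℂ] V) (i₁ : A₁ →L[ℂ] V) :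
    CompleteSpace (SumSpace i₀ i₁) :=
  inferInstanceAs (CompleteSpace (WithLp 1 (A₀ × A₁) ⧸ addKer i₀ i₁))

/-- The quotient map `(a, b) ↦ a + b`. -/
def sumMk (i₀ : A₀ →L[ℂ] V) (i₁ : A₁ →L[ℂ] V) : WithLp 1 (A₀ × A₁) →L[ℂ] SumSpace i₀ i₁ :=
  (addKer i₀ i₁).mkQL

/-- The embedding of `A₀` in `A₀ + A₁`. -/
def sumInl (i₀ : A₀ →L[ℂ] V) (i₁ : A₁ →L[ℂ] V) : A₀ →L[ℂ] SumSpace i₀ i₁ :=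
  sumMk i₀ i₁ ∘L (WithLp.prodContinuousLinearEquiv 1 ℂ A₀ A₁).symm.toContinuousLinearMap ∘L
    ContinuousLinearMap.inl ℂ A₀ A₁

/-- The embedding of `A₁` in `A₀ + A₁`. -/
def sumInr (i₀ : A₀ →L[ℂ] V) (i₁ : A₁ →L[ℂ] V) : A₁ →L[ℂ] SumSpace i₀ i₁ :=
  sumMk i₀ i₁ ∘L (WithLp.prodContinuousLinearEquiv 1 ℂ A₀ A₁).symm.toContinuousLinearMap ∘L
    ContinuousLinearMap.inr ℂ A₀ A₁

/-- The embedding of `A₀ + A₁` in `V`. -/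
def sumToAmbient (i₀ : A₀ →L[ℂ] V) (i₁ : A₁ →L[ℂ] V) : SumSpace i₀ i₁ →L[ℂ] V where
  toLinearMap := (addKer i₀ i₁).liftQ (addMap i₀ i₁).toLinearMap le_rfl
  cont := (addMap i₀ i₁).continuous.quotient_lift _

/-- The closed strip `0 ≤ Re z ≤ 1`. -/
abbrev ClosedStrip : Set ℂ := Complex.HadamardThreeLines.verticalClosedStrip 0 1

/-- The open strip `0 < Re z < 1`. -/
abbrev OpenStrip : Set ℂ := Complex.HadamardThreeLines.verticalStrip 0 1

/-- The boundary point `i t`. -/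
def leftPt (t : ℝ) : ClosedStrip :=
  ⟨t * Complex.I, by simp [Complex.HadamardThreeLines.verticalClosedStrip]⟩

/-- The boundary point `1 + i t`. -/
def rightPt (t : ℝ) : ClosedStrip :=
  ⟨1 + t * Complex.I, by simp [Complex.HadamardThreeLines.verticalClosedStrip]⟩

/-- The point `θ` of the strip. -/
def midPt (θ : Ioo (0 : ℝ) 1) : ClosedStrip :=
  ⟨((θ : ℝ) : ℂ), by
    simpa [Complex.HadamardThreeLines.verticalClosedStrip] using ⟨θ.2.1.le, θ.2.2.le⟩⟩

/-- The Calderón space `F(A₀, A₁)`: bounded continuous functions `f` from the closed strip to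
`A₀ + A₁`, holomorphic in the open strip, for which `t ↦ f(it)` and `t ↦ f(1 + it)` are
continuous into `A₀` and `A₁` respectively and vanish at infinity. An element is stored as `f`
together with its two boundary functions. The norm is
`max (sup ‖f(z)‖, sup ‖f(it)‖_{A₀}, sup ‖f(1 + it)‖_{A₁})`, in which the first entry may be left out
(see `calderon_norm_eq`). -/
def CalderonSpace (i₀ : A₀ →L[ℂ] V) (i₁ : A₁ →L[ℂ] V) :
    Submodule ℂ ((ClosedStrip →ᵇ SumSpace i₀ i₁) × C₀(ℝ, A₀) × C₀(ℝ, A₁)) where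
  carrier := {F |
    DifferentiableOn ℂ (Function.extend Subtype.val F.1 0) OpenStrip ∧
    (∀ t : ℝ, F.1 (leftPt t) = sumInl i₀ i₁ (F.2.1 t)) ∧
    (∀ t : ℝ, F.1 (rightPt t) = sumInr i₀ i₁ (F.2.2 t))}
  add_mem' := by
    rintro F G ⟨hF, hF0, hF1⟩ ⟨hG, hG0, hG1⟩
    refine ⟨?_, fun t => ?_, fun t => ?_⟩
    · have h := hF.add hG
      rw [← Function.extend_add, add_zero] at h
      exact h
    · simp [hF0 t, hG0 t, map_add]
    · simp [hF1 t, hG1 t, map_add]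
  zero_mem' := by
    refine ⟨?_, fun t => ?_, fun t => ?_⟩
    · have h : Function.extend Subtype.val (0 : ClosedStrip → SumSpace i₀ i₁) 0 = 0 :=
        Function.extend_zero _
      change DifferentiableOn ℂ
        (Function.extend Subtype.val (0 : ClosedStrip → SumSpace i₀ i₁) 0) OpenStrip
      rw [h]
      exact differentiableOn_const 0
    · simp
    · simp
  smul_mem' := by
    rintro c F ⟨hF, hF0, hF1⟩
    refine ⟨?_, fun t => ?_, fun t => ?_⟩
    · have h := hF.const_smul c
      rw [← Function.extend_smul, smul_zero] at h
      exact h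
    · simp [hF0 t, map_smul]
    · simp [hF1 t, map_smul]

/-- Evaluation of the elements of the Calderón space at a point of the strip. -/
def evalAt (i₀ : A₀ →L[ℂ] V) (i₁ : A₁ →L[ℂ] V) (z : ClosedStrip) :
    CalderonSpace i₀ i₁ →L[ℂ] SumSpace i₀ i₁ :=
  (BoundedContinuousFunction.evalCLM ℂ z ∘L ContinuousLinearMap.fst ℂ _ _) ∘L
    (CalderonSpace i₀ i₁).subtypeL

/-- The functions in the Calderón space that vanish at `θ`. -/
def evalKer (i₀ : A₀ →L[ℂ] V) (i₁ : A₁ →L[ℂ] V) (θ : Ioo (0 : ℝ) 1) :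
    Submodule ℂ (CalderonSpace i₀ i₁) :=
  (evalAt i₀ i₁ (midPt θ)).ker

instance (i₀ : A₀ →L[ℂ] V) (i₁ : A₁ →L[ℂ] V) (θ : Ioo (0 : ℝ) 1) :
    IsClosed (evalKer i₀ i₁ θ : Set (CalderonSpace i₀ i₁)) :=
  (evalAt i₀ i₁ (midPt θ)).isClosed_ker

/-- The complex interpolation space `[A₀, A₁]_θ = {f(θ) : f ∈ F(A₀, A₁)}` with the norm
`‖x‖ = inf {‖f‖ : f(θ) = x}`, realized as a quotient of `F(A₀, A₁)`. -/
def Interp (i₀ : A₀ →L[ℂ] V) (i₁ : A₁ →L[ℂ] V) (θ : Ioo (0 : ℝ) 1) : Type _ :=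
  CalderonSpace i₀ i₁ ⧸ evalKer i₀ i₁ θ

instance (i₀ : A₀ →L[ℂ] V) (i₁ : A₁ →L[ℂ] V) (θ : Ioo (0 : ℝ) 1) :
    NormedAddCommGroup (Interp i₀ i₁ θ) :=
  inferInstanceAs (NormedAddCommGroup (CalderonSpace i₀ i₁ ⧸ evalKer i₀ i₁ θ))

instance (i₀ : A₀ →L[ℂ] V) (i₁ : A₁ →L[ℂ] V) (θ : Ioo (0 : ℝ) 1) :
    NormedSpace ℂ (Interp i₀ i₁ θ) :=
  inferInstanceAs (NormedSpace ℂ (CalderonSpace i₀ i₁ ⧸ evalKer i₀ i₁ θ))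

/-- The embedding `f(θ) ↦ f(θ)` of `[A₀, A₁]_θ` in `A₀ + A₁`. -/
def interpToSum (i₀ : A₀ →L[ℂ] V) (i₁ : A₁ →L[ℂ] V) (θ : Ioo (0 : ℝ) 1) :
    Interp i₀ i₁ θ →L[ℂ] SumSpace i₀ i₁ where
  toLinearMap := (evalKer i₀ i₁ θ).liftQ (evalAt i₀ i₁ (midPt θ)).toLinearMap le_rfl
  cont := (evalAt i₀ i₁ (midPt θ)).continuous.quotient_lift _

/-- The embedding of `[A₀, A₁]_θ` in `V`. -/
def interpToAmbient (i₀ : A₀ →L[ℂ] V) (i₁ : A₁ →L[ℂ] V) (θ : Ioo (0 : ℝ) 1) :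
    Interp i₀ i₁ θ →L[ℂ] V :=
  sumToAmbient i₀ i₁ ∘L interpToSum i₀ i₁ θ

theorem norm_sumInl_le (i₀ : A₀ →L[ℂ] V) (i₁ : A₁ →L[ℂ] V) (a : A₀) : ‖sumInl i₀ i₁ a‖ ≤ ‖a‖ := by
  refine (Submodule.Quotient.norm_mk_le (S := addKer i₀ i₁) (WithLp.toLp 1 (a, (0 : A₁)))).trans ?_
  simp

theorem norm_sumInr_le (i₀ : A₀ →L[ℂ] V) (i₁ : A₁ →L[ℂ] V) (b : A₁) : ‖sumInr i₀ i₁ b‖ ≤ ‖b‖ := by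
  refine (Submodule.Quotient.norm_mk_le (S := addKer i₀ i₁) (WithLp.toLp 1 ((0 : A₀), b))).trans ?_
  simp

theorem extend_coe {E : Type*} [Zero E] (f : ClosedStrip → E) (z : ClosedStrip) :
    Function.extend Subtype.val f 0 (z : ℂ) = f z :=
  Subtype.val_injective.extend_apply f 0 z

theorem openStrip_subset : OpenStrip ⊆ ClosedStrip := fun _ hz => ⟨hz.1.le, hz.2.le⟩

theorem isOpen_openStrip : IsOpen OpenStrip := isOpen_Ioo.preimage Complex.continuous_re

theorem closure_openStrip : closure OpenStrip = ClosedStrip := by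
  change closure (Complex.re ⁻¹' Ioo 0 1) = Complex.re ⁻¹' Icc 0 1
  rw [Complex.closure_preimage_re, closure_Ioo zero_ne_one]

/-- The norm of the Calderón space is the usual one,
`max (sup ‖f(it)‖_{A₀}, sup ‖f(1 + it)‖_{A₁})`. -/
theorem calderon_norm_eq (i₀ : A₀ →L[ℂ] V) (i₁ : A₁ →L[ℂ] V) (F : CalderonSpace i₀ i₁) :
    ‖F‖ = max ‖F.1.2.1‖ ‖F.1.2.2‖ := by
  obtain ⟨⟨f, g, h⟩, hf, hg, hh⟩ := F
  change max ‖f‖ (max ‖g‖ ‖h‖) = max ‖g‖ ‖h‖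
  simp only at hf hg hh
  refine max_eq_right ?_
  set M := max ‖g‖ ‖h‖ with hM
  have hM0 : 0 ≤ M := (norm_nonneg g).trans (le_max_left _ _)
  refine (BoundedContinuousFunction.norm_le hM0).2 fun z => ?_
  set e := Function.extend Subtype.val f 0 with he
  have hez : ∀ w : ClosedStrip, e w = f w := fun w => extend_coe f w
  have hd : DiffContOnCl ℂ e OpenStrip := by
    refine ⟨hf, ?_⟩
    rw [closure_openStrip, continuousOn_iff_continuous_domRestrict]
    exact f.continuous.congr fun w => (hez w).symm
  have hb : BddAbove (norm ∘ e '' ClosedStrip) := by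
    refine ⟨‖f‖, ?_⟩
    rintro _ ⟨w, hw, rfl⟩
    have := f.norm_coe_le_norm ⟨w, hw⟩
    rwa [← hez] at this
  have h0 : ∀ w ∈ Complex.re ⁻¹' {(0 : ℝ)}, ‖e w‖ ≤ M := by
    intro w hw
    have hw' : w = (leftPt w.im : ℂ) := by
      apply Complex.ext <;> simp_all [leftPt]
    rw [hw', hez, hg]
    exact (norm_sumInl_le _ _ _).trans
      ((g.toBCF.norm_coe_le_norm _).trans (le_max_left _ _))
  have h1 : ∀ w ∈ Complex.re ⁻¹' {(1 : ℝ)}, ‖e w‖ ≤ M := by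
    intro w hw
    have hw' : w = (rightPt w.im : ℂ) := by
      apply Complex.ext <;> simp_all [rightPt]
    rw [hw', hez, hh]
    exact (norm_sumInr_le _ _ _).trans
      ((h.toBCF.norm_coe_le_norm _).trans (le_max_right _ _))
  have := Complex.HadamardThreeLines.norm_le_interp_of_mem_verticalClosedStrip'
    zero_lt_one z.2 hd hb h0 h1
  rw [hez, ← Real.rpow_add' hM0 (by simp)] at this
  simpa using this

theorem isClosed_calderonSpace [CompleteSpace A₀] [CompleteSpace A₁]
    (i₀ : A₀ →L[ℂ] V) (i₁ : A₁ →L[ℂ] V) :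
    IsClosed (CalderonSpace i₀ i₁ :
      Set ((ClosedStrip →ᵇ SumSpace i₀ i₁) × C₀(ℝ, A₀) × C₀(ℝ, A₁))) := by
  refine IsSeqClosed.isClosed fun F G hF hlim => ?_
  have h1 : Tendsto (fun n => (F n).1) atTop (𝓝 G.1) := (continuous_fst.tendsto G).comp hlim
  have h2 : Tendsto (fun n => (F n).2.1) atTop (𝓝 G.2.1) :=
    (continuous_snd.fst.tendsto G).comp hlim
  have h3 : Tendsto (fun n => (F n).2.2) atTop (𝓝 G.2.2) :=
    (continuous_snd.snd.tendsto G).comp hlim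
  have e1 : ∀ z, Tendsto (fun n => (F n).1 z) atTop (𝓝 (G.1 z)) := fun z =>
    ((BoundedContinuousFunction.evalCLM ℂ z).continuous.tendsto _).comp h1
  have e2 : ∀ t, Tendsto (fun n => (F n).2.1 t) atTop (𝓝 (G.2.1 t)) := fun t =>
    (((BoundedContinuousFunction.evalCLM ℂ t).continuous.comp
      ZeroAtInftyContinuousMap.isometry_toBCF.continuous).tendsto _).comp h2
  have e3 : ∀ t, Tendsto (fun n => (F n).2.2 t) atTop (𝓝 (G.2.2 t)) := fun t =>
    (((BoundedContinuousFunction.evalCLM ℂ t).continuous.comp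
      ZeroAtInftyContinuousMap.isometry_toBCF.continuous).tendsto _).comp h3
  refine ⟨?_, fun t => ?_, fun t => ?_⟩
  · have hu := BoundedContinuousFunction.tendsto_iff_tendstoUniformly.1 h1
    have hu' : TendstoUniformlyOn (fun n => Function.extend Subtype.val (F n).1 0)
        (Function.extend Subtype.val G.1 0) atTop OpenStrip := by
      intro U hU
      filter_upwards [hu U hU] with n hn z hz
      have := hn ⟨z, openStrip_subset hz⟩
      rwa [← extend_coe G.1, ← extend_coe (F n).1] at this
    exact hu'.tendstoLocallyUniformlyOn.differentiableOn
      (Eventually.of_forall fun n => (hF n).1) isOpen_openStrip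
  · refine tendsto_nhds_unique (e1 _) ?_
    simp_rw [fun n => (hF n).2.1 t]
    exact ((sumInl i₀ i₁).continuous.tendsto _).comp (e2 t)
  · refine tendsto_nhds_unique (e1 _) ?_
    simp_rw [fun n => (hF n).2.2 t]
    exact ((sumInr i₀ i₁).continuous.tendsto _).comp (e3 t)

instance [CompleteSpace A₀] [CompleteSpace A₁] (i₀ : A₀ →L[ℂ] V) (i₁ : A₁ →L[ℂ] V) :
    CompleteSpace (CalderonSpace i₀ i₁) :=
  (isClosed_calderonSpace i₀ i₁).completeSpace_coe

/-- The complex interpolation space of two Banach spaces is a Banach space. -/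
instance [CompleteSpace A₀] [CompleteSpace A₁]
    (i₀ : A₀ →L[ℂ] V) (i₁ : A₁ →L[ℂ] V) (θ : Ioo (0 : ℝ) 1) : CompleteSpace (Interp i₀ i₁ θ) :=
  inferInstanceAs (CompleteSpace (CalderonSpace i₀ i₁ ⧸ evalKer i₀ i₁ θ))

/-- Two spaces that are continuously embedded in `V` are the same subspace of `V`, with equivalent
norms. -/
def SameSpace (i : A₀ →L[ℂ] V) (k : A₁ →L[ℂ] V) : Prop :=
  Function.Injective i ∧ Function.Injective k ∧
    ∃ Φ : A₀ ≃L[ℂ] A₁, ∀ a, k (Φ a) = i a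

end Interpolation

/-! ### Maximal parabolic regularity -/

section MaximalRegularity

/-- The exponents in `(1, ∞)`. -/
abbrev Exponent : Type := Ioi (1 : ℝ)

instance (r : Exponent) : Fact (1 ≤ ENNReal.ofReal (r : ℝ)) :=
  ⟨ENNReal.one_le_ofReal.2 (le_of_lt r.2)⟩

/-- Lebesgue measure on `J = (0, T)`. -/
abbrev volJ (T : ℝ) : Measure ℝ := volume.restrict (Ioo 0 T)

/-- The Bochner space `L^r(J; Z)` with `J = (0, T)`. -/
abbrev LrJ (T : ℝ) (r : Exponent) (Z : Type*) [NormedAddCommGroup Z] : AddSubgroup (ℝ →ₘ[volJ T] Z) :=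
  Lp Z (ENNReal.ofReal (r : ℝ)) (volJ T)

variable {D X V : Type*}
  [NormedAddCommGroup D] [NormedSpace ℂ D]
  [NormedAddCommGroup X] [NormedSpace ℂ X]
  [NormedAddCommGroup V] [NormedSpace ℂ V]

/-- `v` is the derivative of `w` on `(0, T)` in the sense of `X`-valued distributions. -/
def IsWeakDeriv (T : ℝ) (w v : ℝ → X) : Prop :=
  ∀ φ : ℝ → ℝ, ContDiff ℝ ∞ φ → HasCompactSupport φ → tsupport φ ⊆ Ioo 0 T →
    ∫ t in Ioo 0 T, deriv φ t • w t = -∫ t in Ioo 0 T, φ t • v t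

/-- The continuous representative of `w` on `[0, T]` vanishes at `0`. -/
def VanishesAtZero (T : ℝ) (w : ℝ → X) : Prop :=
  ∃ c : ℝ → X, ContinuousOn c (Icc 0 T) ∧ c 0 = 0 ∧ c =ᵐ[volJ T] w

/-- `w ∈ W₀^{1,r}(J; X)` with `w' = v`. -/
def IsW0 (T : ℝ) {r : Exponent} (w v : LrJ T r X) : Prop :=
  IsWeakDeriv T w v ∧ VanishesAtZero T w

theorem LrJ.integrable {T : ℝ} {r : Exponent} {Z : Type*} [NormedAddCommGroup Z] (w : LrJ T r Z) : Integrable w (volJ T) :=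
  (Lp.memLp w).integrable Fact.out

theorem LrJ.integrable_smul {T : ℝ} {r : Exponent} (w : LrJ T r X) {φ : ℝ → ℝ}
    (hφ : Continuous φ) (hc : HasCompactSupport φ) :
    Integrable (fun t => φ t • w t) (volJ T) := by
  obtain ⟨C, hC⟩ := hφ.bounded_above_of_compact_support hc
  exact Integrable.bdd_smul (𝕜 := ℝ) (LrJ.integrable w) C hφ.aestronglyMeasurable (Eventually.of_forall hC)

theorem IsW0.zero (T : ℝ) {r : Exponent} : IsW0 T (0 : LrJ T r X) 0 := by
  have h0 : ((0 : LrJ T r X) : ℝ → X) =ᵐ[volJ T] 0 := Lp.coeFn_zero _ _ _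
  refine ⟨fun φ _ _ _ => ?_, 0, continuousOn_const, rfl, h0.symm⟩
  have h : ∀ ψ : ℝ → ℝ, ∫ t in Ioo 0 T, ψ t • (0 : LrJ T r X) t = 0 := by
    intro ψ
    rw [integral_eq_zero_of_ae]
    filter_upwards [h0] with t ht
    rw [ht, Pi.zero_apply, smul_zero]
  rw [h, h, neg_zero]

theorem IsW0.add {T : ℝ} {r : Exponent} {w v w' v' : LrJ T r X} (h : IsW0 T w v)
    (h' : IsW0 T w' v') : IsW0 T (w + w') (v + v') := by
  obtain ⟨hd, c, hc, hc0, hcw⟩ := h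
  obtain ⟨hd', c', hc', hc0', hcw'⟩ := h'
  refine ⟨fun φ hφ hs hJ => ?_, c + c', hc.add hc', by simp [hc0, hc0'], ?_⟩
  · have key : ∀ (ψ : ℝ → ℝ) (a b : LrJ T r X), Continuous ψ → HasCompactSupport ψ →
        ∫ t in Ioo 0 T, ψ t • (a + b : LrJ T r X) t =
          (∫ t in Ioo 0 T, ψ t • a t) + ∫ t in Ioo 0 T, ψ t • b t := by
      intro ψ a b hψ hψs
      rw [← integral_add (LrJ.integrable_smul a hψ hψs) (LrJ.integrable_smul b hψ hψs)]
      refine integral_congr_ae ?_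
      filter_upwards [Lp.coeFn_add a b] with t ht
      rw [ht, Pi.add_apply, smul_add]
    rw [key _ _ _ (hφ.continuous_deriv (by simp)) hs.deriv, key _ _ _ hφ.continuous hs,
      hd φ hφ hs hJ, hd' φ hφ hs hJ, neg_add]
  · filter_upwards [hcw, hcw', Lp.coeFn_add w w'] with t h1 h2 h3
    rw [h3, Pi.add_apply, Pi.add_apply, h1, h2]

theorem IsW0.smul {T : ℝ} {r : Exponent} {w v : LrJ T r X} (a : ℂ) (h : IsW0 T w v) :
    IsW0 T (a • w) (a • v) := by
  obtain ⟨hd, c, hc, hc0, hcw⟩ := h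
  refine ⟨fun φ hφ hs hJ => ?_, a • c, hc.const_smul a, by simp [hc0], ?_⟩
  · have key : ∀ (ψ : ℝ → ℝ) (b : LrJ T r X),
        ∫ t in Ioo 0 T, ψ t • (a • b : LrJ T r X) t = a • ∫ t in Ioo 0 T, ψ t • b t := by
      intro ψ b
      rw [← integral_smul]
      refine integral_congr_ae ?_
      filter_upwards [Lp.coeFn_smul a b] with t ht
      rw [ht, Pi.smul_apply, smul_comm]
    rw [key, key, hd φ hφ hs hJ, smul_neg]
  · filter_upwards [hcw, Lp.coeFn_smul a w] with t h1 h2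
    rw [h2, Pi.smul_apply, Pi.smul_apply, h1]

/-- The submodule of `L^r(J; D) × L^r(J; X)` that underlies `MRSpace`. -/
def mrSubmodule (T : ℝ) (r : Exponent) (iD : D →L[ℂ] V) (iX : X →L[ℂ] V) :
    Submodule ℂ (WithLp 1 (LrJ T r D × LrJ T r X)) where
  carrier := {p | ∃ w : LrJ T r X, iD.compLpL _ _ p.fst = iX.compLpL _ _ w ∧ IsW0 T w p.snd}
  add_mem' := by
    rintro p q ⟨w, hw, hp⟩ ⟨w', hw', hq⟩
    refine ⟨w + w', ?_, hp.add hq⟩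
    rw [WithLp.add_fst, map_add, map_add, hw, hw']
  zero_mem' := by
    refine ⟨0, ?_, IsW0.zero T⟩
    rw [WithLp.zero_fst, map_zero, map_zero]
  smul_mem' := by
    rintro c p ⟨w, hw, hp⟩
    refine ⟨c • w, ?_, hp.smul c⟩
    rw [WithLp.smul_fst, map_smul, map_smul, hw]

/-- The space `MR₀^r(J; D, X) = L^r(J; D) ∩ W₀^{1,r}(J; X)` for two spaces `D` and `X` that are
continuously embedded in `V` by `iD` and `iX`. Its elements are stored as pairs `(u, v)`, where
`u ∈ L^r(J; D)`, the function `u` is also an element `w` of `W₀^{1,r}(J; X)`, and `v = w'`. The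
norm is `‖u‖_{L^r(J; D)} + ‖u'‖_{L^r(J; X)}`. -/
def MRSpace (T : ℝ) (r : Exponent) (iD : D →L[ℂ] V) (iX : X →L[ℂ] V) : Type _ :=
  mrSubmodule T r iD iX

instance (T : ℝ) (r : Exponent) (iD : D →L[ℂ] V) (iX : X →L[ℂ] V) :
    NormedAddCommGroup (MRSpace T r iD iX) :=
  inferInstanceAs (NormedAddCommGroup (mrSubmodule T r iD iX))

instance (T : ℝ) (r : Exponent) (iD : D →L[ℂ] V) (iX : X →L[ℂ] V) :
    NormedSpace ℂ (MRSpace T r iD iX) :=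
  inferInstanceAs (NormedSpace ℂ (mrSubmodule T r iD iX))

/-- The map `u ↦ (u, u')`. -/
def MRSpace.toPair (T : ℝ) (r : Exponent) (iD : D →L[ℂ] V) (iX : X →L[ℂ] V) :
    MRSpace T r iD iX →L[ℂ] WithLp 1 (LrJ T r D × LrJ T r X) :=
  (mrSubmodule T r iD iX).subtypeL

/-- The function `u ∈ L^r(J; D)` that underlies an element of `MR₀^r(J; D, X)`. -/
def MRSpace.fn {T : ℝ} {r : Exponent} {iD : D →L[ℂ] V} {iX : X →L[ℂ] V}
    (u : MRSpace T r iD iX) : LrJ T r D :=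
  (MRSpace.toPair T r iD iX u).fst

/-- The derivative `u' ∈ L^r(J; X)` of an element of `MR₀^r(J; D, X)`. -/
def MRSpace.deriv {T : ℝ} {r : Exponent} {iD : D →L[ℂ] V} {iX : X →L[ℂ] V}
    (u : MRSpace T r iD iX) : LrJ T r X :=
  (MRSpace.toPair T r iD iX u).snd

/-- The inclusion of `L^r(J; W)` in `L^1(J; W)`. -/
def inclL1 (T : ℝ) (r : Exponent) (W : Type*) [NormedAddCommGroup W] [NormedSpace ℂ W] :
    LrJ T r W →L[ℂ] Lp W 1 (volJ T) :=
  LinearMap.mkContinuousOfExistsBound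
    { toFun := fun f => ((Lp.memLp f).mono_exponent (Fact.out : 1 ≤ ENNReal.ofReal (r : ℝ))).toLp f
      map_add' := fun f g => by
        refine Lp.ext ?_
        filter_upwards [MemLp.coeFn_toLp ((Lp.memLp (f + g)).mono_exponent
            (Fact.out : 1 ≤ ENNReal.ofReal (r : ℝ))),
          Lp.coeFn_add f g,
          MemLp.coeFn_toLp ((Lp.memLp f).mono_exponent (Fact.out : 1 ≤ ENNReal.ofReal (r : ℝ))),
          MemLp.coeFn_toLp ((Lp.memLp g).mono_exponent (Fact.out : 1 ≤ ENNReal.ofReal (r : ℝ))),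
          Lp.coeFn_add
            (((Lp.memLp f).mono_exponent (Fact.out : 1 ≤ ENNReal.ofReal (r : ℝ))).toLp f)
            (((Lp.memLp g).mono_exponent (Fact.out : 1 ≤ ENNReal.ofReal (r : ℝ))).toLp g)]
          with t h1 h2 h3 h4 h5
        rw [h1, h5, h2, Pi.add_apply, Pi.add_apply, h3, h4]
      map_smul' := fun c f => by
        refine Lp.ext ?_
        filter_upwards [MemLp.coeFn_toLp ((Lp.memLp (c • f)).mono_exponent
            (Fact.out : 1 ≤ ENNReal.ofReal (r : ℝ))),
          Lp.coeFn_smul c f,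
          MemLp.coeFn_toLp ((Lp.memLp f).mono_exponent (Fact.out : 1 ≤ ENNReal.ofReal (r : ℝ))),
          Lp.coeFn_smul c
            (((Lp.memLp f).mono_exponent (Fact.out : 1 ≤ ENNReal.ofReal (r : ℝ))).toLp f)]
          with t h1 h2 h3 h4
        rw [h1, RingHom.id_apply, h4, h2, Pi.smul_apply, Pi.smul_apply, h3] }
    (by
      set e : ℝ := 1 / (1 : ℝ≥0∞).toReal - 1 / (ENNReal.ofReal (r : ℝ)).toReal with he
      have he0 : 0 ≤ e := by
        rw [he, ENNReal.toReal_ofReal (by linarith [r.2.out])]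
        have : 1 / (r : ℝ) ≤ 1 := by
          rw [div_le_one (by linarith [r.2.out])]
          exact r.2.out.le
        simpa using this
      refine ⟨(volJ T univ ^ e).toReal, fun f => ?_⟩
      change ‖((Lp.memLp f).mono_exponent (Fact.out : 1 ≤ ENNReal.ofReal (r : ℝ))).toLp f‖ ≤ _
      rw [Lp.norm_toLp, Lp.norm_def, mul_comm, ← ENNReal.toReal_mul]
      exact ENNReal.toReal_mono
        (ENNReal.mul_ne_top (Lp.eLpNorm_ne_top f)
          (ENNReal.rpow_ne_top_of_nonneg he0 (measure_ne_top _ _)))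
        (eLpNorm_le_eLpNorm_mul_rpow_measure_univ Fact.out (Lp.aestronglyMeasurable f)))

theorem inclL1_coe (T : ℝ) (r : Exponent) (W : Type*) [NormedAddCommGroup W] [NormedSpace ℂ W]
    (f : LrJ T r W) : inclL1 T r W f =ᵐ[volJ T] f :=
  MemLp.coeFn_toLp ((Lp.memLp f).mono_exponent (Fact.out : 1 ≤ ENNReal.ofReal (r : ℝ)))

/-- The map `u ↦ k ∘ u` from `MR₀^r(J; D, X)` to `L^1(J; W)`. If `k` is an embedding of `D` in `W`,
this realizes `MR₀^r(J; D, X)` as a space of `W`-valued functions. -/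
def mrToL1 (T : ℝ) (r : Exponent) (iD : D →L[ℂ] V) (iX : X →L[ℂ] V)
    {W : Type*} [NormedAddCommGroup W] [NormedSpace ℂ W] (k : D →L[ℂ] W) :
    MRSpace T r iD iX →L[ℂ] Lp W 1 (volJ T) :=
  inclL1 T r W ∘L k.compLpL (ENNReal.ofReal (r : ℝ)) (volJ T) ∘L
    WithLp.fstL 1 ℂ (LrJ T r D) (LrJ T r X) ∘L MRSpace.toPair T r iD iX

/-- The space `MR₀^r(J; D, X)` for a continuous embedding `i` of `D` in `X`. -/
abbrev MR (T : ℝ) (r : Exponent) (i : D →L[ℂ] X) : Type _ :=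
  MRSpace T r i (ContinuousLinearMap.id ℂ X)

/-- The map `u ↦ k ∘ u` from `MR₀^r(J; D, X)` to `L^1(J; W)`, for an embedding `k` of `X` in `W`. -/
abbrev MR.toL1 (T : ℝ) (r : Exponent) (i : D →L[ℂ] X)
    {W : Type*} [NormedAddCommGroup W] [NormedSpace ℂ W] (k : X →L[ℂ] W) :
    MR T r i →L[ℂ] Lp W 1 (volJ T) :=
  mrToL1 T r i (ContinuousLinearMap.id ℂ X) (k ∘L i)

/-- The constant family `A : D → X`, where `D` is embedded in `X` by `i`, satisfies maximal
parabolic `L^r(J; X)`-regularity: for all `f ∈ L^r(J; X)` there is a unique `u ∈ MR₀^r(J; D, X)`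
with `u' + A u = f` almost everywhere on `J`. -/
def HasMaxRegExp (T : ℝ) (r : Exponent) (i A : D →L[ℂ] X) : Prop :=
  ∀ f : LrJ T r X, ∃! u : MR T r i,
    ∀ᵐ t ∂(volJ T), u.deriv t + A (u.fn t) = f t

/-- The operator `A : D → X` is closed as an operator in `X` and satisfies maximal parabolic
regularity on `X`, i.e. maximal parabolic `L^r(J; X)`-regularity for some `r ∈ (1, ∞)`. -/
def HasMaxReg (T : ℝ) (i A : D →L[ℂ] X) : Prop :=
  IsClosed (range fun d : D => (i d, A d)) ∧ ∃ r : Exponent, HasMaxRegExp T r i A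

/-- `(D, X)` and `(E, Y)` form a pair of common maximal parabolic regularity. The inclusions
`X ⊆ Y`, `D ⊆ X`, `E ⊆ Y` are given by the embeddings `iXY`, `iDX`, `iEY`. -/
structure IsCommonMaxRegPair {D X E Y : Type*}
    [NormedAddCommGroup D] [NormedSpace ℂ D] [NormedAddCommGroup X] [NormedSpace ℂ X]
    [NormedAddCommGroup E] [NormedSpace ℂ E] [NormedAddCommGroup Y] [NormedSpace ℂ Y]
    (T : ℝ) (iXY : X →L[ℂ] Y) (iDX : D →L[ℂ] X) (iEY : E →L[ℂ] Y) : Prop where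
  inj_XY : Function.Injective iXY
  inj_DX : Function.Injective iDX
  inj_EY : Function.Injective iEY
  dense_DX : DenseRange iDX
  dense_EY : DenseRange iEY
  /-- There is an operator `B ∈ L(E; Y)` with `D = {x ∈ E ∩ X : B x ∈ X}` whose restriction to `D`
  is a bounded operator `BD ∈ L(D; X)`, such that `B` and `BD` satisfy maximal parabolic regularity
  on `Y` and on `X`. -/
  exists_operator : ∃ (B : E →L[ℂ] Y) (BD : D →L[ℂ] X),
    range (iXY ∘L iDX) = {y | ∃ e : E, iEY e = y ∧ y ∈ range iXY ∧ B e ∈ range iXY} ∧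
    (∀ (d : D) (e : E), iEY e = iXY (iDX d) → iXY (BD d) = B e) ∧
    HasMaxReg T iEY B ∧ HasMaxReg T iDX BD

end MaximalRegularity

end MaxReg

end

/-! The inclusion from left to right needs no maximal regularity (`exists_interp_MR_to_MR`). The
maps `u ↦ u` and `u ↦ u'` send the two maximal regularity spaces into `L^{r₀}(J; D)`, `L^{r₁}(J; E)`
and into `L^{r₀}(J; X)`, `L^{r₁}(J; Y)`, compatibly inside `L¹(J; Y)`. Interpolating them and using
`[L^{r₀}(J; A₀), L^{r₁}(J; A₁)]_θ = L^r(J; [A₀, A₁]_θ)` puts `u` and `u'` into the right spaces. The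
relation `u = ∫₀ᵗ u'`, which encodes both the weak derivative and the zero initial value, survives
interpolation because the Volterra operator is bounded and injective on `L¹(J; Y)`.

For the other inclusion (`exists_MR_to_interp_MR`), let `B` be the common operator. The solution
operators of `u' + B u = f` on `L^{r₀}(J; X)` and on `L^{r₁}(J; Y)` are compatible
(`compatible_solution`), so they interpolate. Given `u` in the right-hand space, `f = u' + B u` lies
in `L^r(J; [X, Y]_θ)`, an interpolation space of Bochner spaces. The interpolated solution operator
maps `f` into the left-hand space, and the result is `u`, since integrable solutions of the equation
on `Y` are unique (`HasMaxRegExp.eq_zero`). Uniqueness is that cheap because integrating an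
integrable solution in time gives a solution in every `L^s`.

Two tools carry this. The first is the independence of maximal regularity from the exponent
(`HasMaxReg.hasMaxRegExp`), needed because the hypothesis provides one unspecified exponent `s` on
each space. It is proved without semigroups. Let `P` send `f` to `u'`. By uniqueness, `P` commutes
with right translations and is causal, so averaging over dyadic grids turns it into lower triangular
Toeplitz matrices with operator entries, bounded on `ℓ^s` uniformly in the grid. Commuting the
equation with multiplication by `t` expresses `P` applied to a constant as a twofold running mean of
a bounded function. Hence consecutive entries differ by `O(m⁻²)`
(`IsDerivOp.norm_gridEntry_sub_le`). This is a Calderón–Zygmund condition: a dyadic stopping time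
argument, Marcinkiewicz interpolation and duality give bounds on every `ℓ^r`
(`exists_toeplitzBound`), and refining the grid gives the bound of `P` on `L^r`. Closedness of the
operator then recovers the solution in `L^r(J; D)`.

The second tool is the interpolation of Bochner spaces (`exists_interp_to_Lr`,
`exists_Lr_to_interp`). One direction estimates `‖F(θ)‖` by a geometric mean of Gaussian averages of
the boundary norms (`norm_interpMk_le_boundary_means`) and applies this on each cell. The other
direction rescales an extension of the value on each cell by a complex power, so that the boundary
values have the right `L^{r₀}` and `L^{r₁}` norms.

In all these places one constructs a bounded map only approximately, on step functions, with a
remainder of at most half the norm; a geometric series removes the remainder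
(`exists_preimage_of_approx`). -/

noncomputable section

namespace MaxReg

/-! ### Primitives and the du Bois-Reymond lemma. -/

section
section Calculus

variable {X : Type*} [NormedAddCommGroup X] [NormedSpace ℝ X] [CompleteSpace X]

/-- Integration by parts for a primitive: `∫₀ᵗ φ' (∫₀ v) = φ(t) ∫₀ᵗ v - ∫₀ᵗ φ v`. -/
theorem integral_deriv_smul_primitive {φ φ' : ℝ → ℝ} (hφ : ∀ x, HasDerivAt φ (φ' x) x)
    (hφ' : Continuous φ') {v : ℝ → X} {t : ℝ} (ht : 0 ≤ t) (hv : IntervalIntegrable v volume 0 t) :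
    ∫ σ in (0)..t, φ' σ • ∫ τ in (0)..σ, v τ
      = φ t • (∫ τ in (0)..t, v τ) - ∫ τ in (0)..t, φ τ • v τ := by
  have hφc : Continuous φ := continuous_iff_continuousAt.2 fun x => (hφ x).continuousAt
  have hvI : IntegrableOn v (Ioc 0 t) := (intervalIntegrable_iff_integrableOn_Ioc_of_le ht).1 hv
  have hφI : IntegrableOn φ' (Ioc 0 t) :=
    (hφ'.integrableOn_Icc (a := 0) (b := t)).mono_set Ioc_subset_Icc_self
  -- The kernel is supported on the triangle `τ ≤ σ`. Integrating it in the two orders by Fubini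
  -- gives the two sides.
  set K : ℝ → ℝ → X := fun σ τ => (Ici τ).indicator φ' σ • v τ with hK
  have hprod : Integrable (Function.uncurry K)
      ((volume.restrict (Ioc 0 t)).prod (volume.restrict (Ioc 0 t))) := by
    have h1 : Integrable (fun p : ℝ × ℝ => φ' p.1 • v p.2)
        ((volume.restrict (Ioc 0 t)).prod (volume.restrict (Ioc 0 t))) :=
      Integrable.smul_prod hφI hvI
    have h2 : MeasurableSet {p : ℝ × ℝ | p.2 ≤ p.1} := measurableSet_le measurable_snd measurable_fst
    refine (h1.indicator h2).congr (Eventually.of_forall fun p => ?_)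
    by_cases hp : p.2 ≤ p.1
    · simp [Function.uncurry, hK, indicator, hp]
    · simp [Function.uncurry, hK, indicator, hp]
  have hl : ∫ σ in (0)..t, φ' σ • ∫ τ in (0)..σ, v τ = ∫ σ in Ioc 0 t, ∫ τ in Ioc 0 t, K σ τ := by
    rw [intervalIntegral.integral_of_le ht]
    refine setIntegral_congr_fun measurableSet_Ioc fun σ hσ => ?_
    have e1 : ∀ τ, K σ τ = φ' σ • (Iic σ).indicator v τ := by
      intro τ
      by_cases h : τ ≤ σ <;> simp [hK, indicator, h]
    simp only [e1]
    rw [integral_smul, setIntegral_indicator measurableSet_Iic, Ioc_inter_Iic, min_eq_right hσ.2,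
      intervalIntegral.integral_of_le hσ.1.le]
  have hr : ∫ τ in Ioc 0 t, ∫ σ in Ioc 0 t, K σ τ = ∫ τ in Ioc 0 t, (φ t - φ τ) • v τ := by
    refine setIntegral_congr_fun measurableSet_Ioc fun τ hτ => ?_
    simp only [hK]
    rw [integral_smul_const, ← integral_indicator measurableSet_Ioc, indicator_indicator,
      integral_indicator (measurableSet_Ioc.inter measurableSet_Ici)]
    have : Ioc 0 t ∩ Ici τ = Icc τ t := by
      ext x; simp only [mem_inter_iff, mem_Ioc, mem_Ici, mem_Icc]
      exact ⟨fun h => ⟨h.2, h.1.2⟩, fun h => ⟨⟨hτ.1.trans_le h.1, h.2⟩, h.1⟩⟩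
    rw [this, integral_Icc_eq_integral_Ioc, ← intervalIntegral.integral_of_le hτ.2,
      intervalIntegral.integral_eq_sub_of_hasDerivAt (fun x _ => hφ x)
        (hφ'.intervalIntegrable _ _)]
  rw [hl, integral_integral_swap hprod, hr, intervalIntegral.integral_of_le ht,
    intervalIntegral.integral_of_le ht]
  have h3 : IntegrableOn (fun τ => φ τ • v τ) (Ioc 0 t) := by
    have := hv.continuousOn_smul hφc.continuousOn
    exact (intervalIntegrable_iff_integrableOn_Ioc_of_le ht).1 this
  simp only [sub_smul]
  rw [integral_sub (f := fun τ => φ t • v τ) (hvI.smul (φ t)) h3, integral_smul]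

/-- A function on an interval whose weak derivative vanishes is constant. -/
theorem ae_eq_const_of_weakDeriv_zero {T : ℝ} (hT : 0 < T) {z : ℝ → X}
    (hz : IntegrableOn z (Ioo 0 T))
    (h : ∀ φ : ℝ → ℝ, ContDiff ℝ ∞ φ → HasCompactSupport φ → tsupport φ ⊆ Ioo 0 T →
      ∫ t in Ioo 0 T, deriv φ t • z t = 0) :
    ∃ c : X, z =ᵐ[volume.restrict (Ioo 0 T)] fun _ => c := by
  -- A bump of integral one supported in `[T/4, 3T/4]`. Its pairing with `z` is the constant sought,
  -- and multiples of it correct test functions to mean zero.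
  let B : ContDiffBump (T / 2 : ℝ) := ⟨T / 8, T / 4, by linarith, by linarith⟩
  set ρ : ℝ → ℝ := B.normed volume with hρ
  have hρs : ContDiff ℝ ∞ ρ := B.contDiff_normed
  have hρt : tsupport ρ ⊆ Icc (T / 4) (3 * T / 4) := by
    rw [hρ, B.tsupport_normed_eq, Real.closedBall_eq_Icc]
    apply Icc_subset_Icc <;> simp only [B] <;> linarith
  have hρ1 : ∫ x, ρ x = 1 := B.integral_normed
  have hsm : ∀ {g : ℝ → ℝ}, Continuous g → HasCompactSupport g →
      IntegrableOn (fun t => g t • z t) (Ioo 0 T) := by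
    intro g hg hc
    obtain ⟨C, hC⟩ := hg.bounded_above_of_compact_support hc
    exact Integrable.bdd_smul (𝕜 := ℝ) hz C hg.aestronglyMeasurable (Eventually.of_forall hC)
  have hρc : HasCompactSupport ρ := B.hasCompactSupport_normed
  set c : X := ∫ t in Ioo 0 T, ρ t • z t with hc
  refine ⟨c, ?_⟩
  have hzc : IntegrableOn (fun t => z t - c) (Ioo 0 T) :=
    hz.sub (integrableOn_const (by simp))
  have key := isOpen_Ioo.ae_eq_zero_of_integral_contDiff_smul_eq_zero
    (μ := volume) (U := Ioo (0 : ℝ) T) (f := fun t => (Ioo 0 T).indicator (fun t => z t - c) t)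
    ((hzc.integrable_indicator measurableSet_Ioo).integrableOn.locallyIntegrableOn) ?_
  · rw [EventuallyEq, ae_restrict_iff' measurableSet_Ioo]
    filter_upwards [key] with t ht h't
    have := ht h't
    rw [indicator_of_mem h't] at this
    exact sub_eq_zero.1 this
  intro g hg hgc hgt
  have e0 : ∀ t, g t • (Ioo 0 T).indicator (fun t => z t - c) t
      = (Ioo 0 T).indicator (fun t => g t • (z t - c)) t := by
    intro t
    by_cases h : t ∈ Ioo 0 T <;> simp [indicator, h]
  simp only [e0]
  rw [integral_indicator measurableSet_Ioo]
  simp only [smul_sub]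
  have hgI : IntegrableOn (fun t => g t • c) (Ioo 0 T) :=
    (hg.continuous.integrable_of_hasCompactSupport hgc).integrableOn.smul_const c
  rw [integral_sub (hsm hg.continuous hgc) hgI, integral_smul_const]
  have hgJ : ∫ t in Ioo 0 T, g t = ∫ t, g t :=
    setIntegral_eq_integral_of_forall_compl_eq_zero fun x hx =>
      image_eq_zero_of_notMem_tsupport fun hx' => hx (hgt hx')
  rw [hgJ]
  obtain ⟨a, b, ha, hb, hab⟩ : ∃ a b : ℝ, 0 < a ∧ b < T ∧ tsupport g ∪ tsupport ρ ⊆ Icc a b := by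
    rcases (tsupport g).eq_empty_or_nonempty with he | hne
    · exact ⟨T / 4, 3 * T / 4, by linarith, by linarith, by rw [he, empty_union]; exact hρt⟩
    · obtain ⟨p, hp, hpm⟩ := hgc.isCompact.exists_isMinOn hne continuousOn_id
      obtain ⟨q, hq, hqm⟩ := hgc.isCompact.exists_isMaxOn hne continuousOn_id
      refine ⟨min p (T / 4), max q (3 * T / 4), lt_min (hgt hp).1 (by linarith),
        max_lt (hgt hq).2 (by linarith), union_subset (fun x hx => ?_) fun x hx => ?_⟩
      · exact ⟨(min_le_left _ _).trans (hpm hx), (hqm hx).trans (le_max_left _ _)⟩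
      · exact ⟨(min_le_right _ _).trans (hρt hx).1, (hρt hx).2.trans (le_max_right _ _)⟩
  set G : ℝ := ∫ t, g t with hG
  -- The corrected function has mean zero, so its primitive again has compact support and is an
  -- admissible test function.
  set ψ : ℝ → ℝ := fun t => g t - G * ρ t with hψ
  have hψs : ContDiff ℝ ∞ ψ := hg.sub (contDiff_const.mul hρs)
  have hψ0 : ∀ t, t ∉ Icc a b → ψ t = 0 := by
    intro t ht
    have h1 : g t = 0 := image_eq_zero_of_notMem_tsupport fun h => ht (hab (Or.inl h))
    have h2 : ρ t = 0 := image_eq_zero_of_notMem_tsupport fun h => ht (hab (Or.inr h))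
    simp [hψ, h1, h2]
  have hψI : ∫ t, ψ t = 0 := by
    rw [hψ, integral_sub (hg.continuous.integrable_of_hasCompactSupport hgc)
      ((hρs.continuous.integrable_of_hasCompactSupport hρc).const_mul G),
      integral_const_mul, hρ1, mul_one, sub_self]
  set φ : ℝ → ℝ := fun t => ∫ τ in a..t, ψ τ with hφ
  have hφd : ∀ t, HasDerivAt φ (ψ t) t := fun t => hψs.continuous.integral_hasStrictDerivAt a t |>.hasDerivAt
  have hφd' : deriv φ = ψ := funext fun t => (hφd t).deriv
  have hφs : ContDiff ℝ ∞ φ := by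
    rw [contDiff_infty_iff_deriv, hφd']
    exact ⟨fun t => (hφd t).differentiableAt, hψs⟩
  have hφ0 : ∀ t, t ∉ Icc a b → φ t = 0 := by
    intro t ht
    rcases lt_or_ge t a with h | h
    · refine intervalIntegral.integral_zero_ae ?_
      filter_upwards [compl_mem_ae_iff.2 (measure_singleton a)] with x hx hx'
      refine hψ0 x fun hxx => ?_
      rw [uIoc_of_ge h.le] at hx'
      exact hx (le_antisymm hx'.2 hxx.1)
    · have hb' : b < t := by
        by_contra hcon
        exact ht ⟨h, not_lt.1 hcon⟩
      rw [← hψI, hφ]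
      simp only
      rw [intervalIntegral.integral_of_le h, ← integral_Icc_eq_integral_Ioc]
      exact setIntegral_eq_integral_of_forall_compl_eq_zero fun x hx =>
        hψ0 x fun hxx => hx ⟨hxx.1, hxx.2.trans hb'.le⟩
  have hφt : tsupport φ ⊆ Icc a b :=
    closure_minimal (fun x hx => by_contra fun hx' => hx (hφ0 x hx')) isClosed_Icc
  have := h φ hφs (HasCompactSupport.of_support_subset_isCompact isCompact_Icc
    (subset_closure.trans hφt)) (hφt.trans (Icc_subset_Ioo ha hb))
  rw [hφd'] at this
  simp only [hψ, sub_smul] at this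
  rw [integral_sub (hsm hg.continuous hgc)] at this
  · simp only [mul_smul] at this
    rw [integral_smul] at this
    exact this
  · simp only [mul_smul]
    exact (hsm hρs.continuous hρc).smul G

end Calculus

end

/-! ### The Volterra operator and the characterization of `W₀^{1,r}` by primitives. -/

section
section Primitive

variable {X : Type*} [NormedAddCommGroup X] [NormedSpace ℂ X]

theorem intervalIntegrable_of_integrable_volJ {X : Type*} [NormedAddCommGroup X]
    {T : ℝ} {v : ℝ → X} (hv : Integrable v (volJ T))
    {a b : ℝ} (ha : a ∈ Icc 0 T) (hb : b ∈ Icc 0 T) : IntervalIntegrable v volume a b := by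
  have h : IntegrableOn v (Icc 0 T) := (integrableOn_Icc_iff_integrableOn_Ioo).2 hv
  exact (h.mono_set (uIcc_subset_Icc ha hb)).intervalIntegrable

theorem continuousOn_primitive_volJ {T : ℝ} {v : ℝ → X} (hv : Integrable v (volJ T)) :
    ContinuousOn (fun t => ∫ s in (0)..t, v s) (Icc 0 T) := by
  have h : IntegrableOn v (Icc 0 T) := (integrableOn_Icc_iff_integrableOn_Ioo).2 hv
  exact (intervalIntegral.continuousOn_primitive_Icc h).congr fun t ht => by
    simp only [intervalIntegral.integral_of_le ht.1, integral_Icc_eq_integral_Ioc]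

theorem norm_primitive_le {T : ℝ} {v : ℝ → X} (hv : Integrable v (volJ T)) {t : ℝ}
    (ht : t ∈ Icc 0 T) : ‖∫ s in (0)..t, v s‖ ≤ ∫ s in Ioo 0 T, ‖v s‖ := by
  refine (intervalIntegral.norm_integral_le_integral_norm ht.1).trans ?_
  rw [intervalIntegral.integral_of_le ht.1, integral_Ioc_eq_integral_Ioo]
  exact setIntegral_mono_set hv.norm (Eventually.of_forall fun _ => norm_nonneg _)
    (Ioo_subset_Ioo_right ht.2).eventuallyLE

theorem primitive_congr {T : ℝ} {v v' : ℝ → X} (h : v =ᵐ[volJ T] v') {t : ℝ}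
    (ht : t ∈ Icc 0 T) : ∫ s in (0)..t, v s = ∫ s in (0)..t, v' s := by
  rw [intervalIntegral.integral_of_le ht.1, intervalIntegral.integral_of_le ht.1,
    integral_Ioc_eq_integral_Ioo, integral_Ioc_eq_integral_Ioo]
  exact integral_congr_ae (ae_restrict_of_ae_restrict_of_subset (Ioo_subset_Ioo_right ht.2) h)

theorem ae_volJ_mem (T : ℝ) : ∀ᵐ t ∂(volJ T), t ∈ Ioo 0 T := ae_restrict_mem measurableSet_Ioo

theorem integrable_primitive {T : ℝ} {v : ℝ → X} (hv : Integrable v (volJ T)) :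
    Integrable (fun t => ∫ s in (0)..t, v s) (volJ T) := by
  refine Integrable.of_bound (C := ∫ s in Ioo 0 T, ‖v s‖) ?_ ?_
  · exact ((continuousOn_primitive_volJ hv).mono Ioo_subset_Icc_self).aestronglyMeasurable
      measurableSet_Ioo
  · filter_upwards [ae_volJ_mem T] with t ht using norm_primitive_le hv (Ioo_subset_Icc_self ht)

/-- The Volterra operator `v ↦ (t ↦ ∫₀ᵗ v)` on `L¹(J; X)`. -/
def volterra (T : ℝ) (X : Type*) [NormedAddCommGroup X] [NormedSpace ℂ X] :
    Lp X 1 (volJ T) →L[ℂ] Lp X 1 (volJ T) :=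
  LinearMap.mkContinuous
    { toFun := fun v =>
        (memLp_one_iff_integrable.2 (integrable_primitive (L1.integrable_coeFn v))).toLp _
      map_add' := fun v w => by
        rw [← MemLp.toLp_add]
        refine MemLp.toLp_congr _ _ ?_
        filter_upwards [ae_volJ_mem T] with t ht
        have h := Ioo_subset_Icc_self ht
        have h0 : (0 : ℝ) ∈ Icc 0 T := ⟨le_rfl, (ht.1.trans ht.2).le⟩
        rw [primitive_congr (Lp.coeFn_add v w) h, Pi.add_apply]
        exact intervalIntegral.integral_add
          (intervalIntegrable_of_integrable_volJ (L1.integrable_coeFn v) h0 h)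
          (intervalIntegrable_of_integrable_volJ (L1.integrable_coeFn w) h0 h)
      map_smul' := fun c v => by
        rw [RingHom.id_apply, ← MemLp.toLp_const_smul]
        refine MemLp.toLp_congr _ _ ?_
        filter_upwards [ae_volJ_mem T] with t ht
        rw [primitive_congr (Lp.coeFn_smul c v) (Ioo_subset_Icc_self ht), Pi.smul_apply]
        exact intervalIntegral.integral_smul c _ }
    (volume.real (Ioo 0 T)) (fun v => by
      change ‖(memLp_one_iff_integrable.2
        (integrable_primitive (L1.integrable_coeFn v))).toLp _‖ ≤ _
      rw [L1.norm_eq_integral_norm v, mul_comm, L1.norm_eq_integral_norm]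
      have hi := integrable_primitive (L1.integrable_coeFn v)
      have e := integral_congr_ae ((MemLp.coeFn_toLp (memLp_one_iff_integrable.2 hi)).fun_comp norm)
      simp only [Function.comp_def] at e
      rw [e]
      refine (integral_mono_ae hi.norm (integrable_const (∫ s in Ioo 0 T, ‖v s‖)) ?_).trans ?_
      · filter_upwards [ae_volJ_mem T] with t ht
        exact norm_primitive_le (L1.integrable_coeFn v) (Ioo_subset_Icc_self ht)
      · simp [mul_comm])

theorem volterra_coe {T : ℝ} (v : Lp X 1 (volJ T)) :
    volterra T X v =ᵐ[volJ T] fun t => ∫ s in (0)..t, v s :=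
  MemLp.coeFn_toLp (memLp_one_iff_integrable.2 (integrable_primitive (L1.integrable_coeFn v)))

theorem integrable_smul_volJ {T : ℝ} {φ : ℝ → ℝ} {u : ℝ → X} (hu : Integrable u (volJ T))
    (hφ : Continuous φ) (hc : HasCompactSupport φ) :
    Integrable (fun t => φ t • u t) (volJ T) := by
  obtain ⟨C, hC⟩ := hφ.bounded_above_of_compact_support hc
  exact Integrable.bdd_smul (𝕜 := ℝ) hu C hφ.aestronglyMeasurable (Eventually.of_forall hC)

theorem isWeakDeriv_primitive [CompleteSpace X] {T : ℝ} (hT : 0 < T) {v : ℝ → X}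
    (hv : Integrable v (volJ T)) : IsWeakDeriv T (fun t => ∫ s in (0)..t, v s) v := by
  intro φ hφ hc ht
  have := integral_deriv_smul_primitive (φ := φ) (φ' := deriv φ)
    (fun x => (hφ.differentiable (by simp) x).hasDerivAt) (hφ.continuous_deriv (by simp))
    hT.le (intervalIntegrable_of_integrable_volJ hv ⟨le_rfl, hT.le⟩ ⟨hT.le, le_rfl⟩)
  have hφT : φ T = 0 := image_eq_zero_of_notMem_tsupport fun h => lt_irrefl _ (ht h).2
  rwa [hφT, zero_smul, zero_sub, intervalIntegral.integral_of_le hT.le,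
    intervalIntegral.integral_of_le hT.le, integral_Ioc_eq_integral_Ioo,
    integral_Ioc_eq_integral_Ioo] at this

/-- The weak derivative of `w - ∫₀ᵗ v` vanishes, so this function is constant, and the continuous
representative at `0` fixes the constant as zero. Conversely the primitive is itself the continuous
representative. -/
theorem isW0_iff [CompleteSpace X] {T : ℝ} (hT : 0 < T) {r : Exponent} (w v : LrJ T r X) :
    IsW0 T w v ↔ ∀ᵐ t ∂(volJ T), w t = ∫ s in (0)..t, v s := by
  have hv := LrJ.integrable v
  have hw := LrJ.integrable w
  have hprim := isWeakDeriv_primitive hT hv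
  constructor
  · rintro ⟨hd, c, hc, hc0, hcw⟩
    obtain ⟨k, hk⟩ := ae_eq_const_of_weakDeriv_zero hT (hw.sub (integrable_primitive hv)) (by
      intro φ hφ hcs ht
      have h1 := integrable_smul_volJ hw (hφ.continuous_deriv (by simp)) hcs.deriv
      have h2 := integrable_smul_volJ (integrable_primitive hv) (hφ.continuous_deriv (by simp)) hcs.deriv
      have := integral_sub h1 h2
      simp only [Pi.sub_apply, smul_sub]
      rw [this, hd φ hφ hcs ht, hprim φ hφ hcs ht, sub_self])
    have hcont : ContinuousOn (fun t => c t - ∫ s in (0)..t, v s) (Icc 0 T) :=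
      hc.sub (continuousOn_primitive_volJ hv)
    have heq : EqOn (fun t => c t - ∫ s in (0)..t, v s) (fun _ => k) (Ioo 0 T) := by
      refine MeasureTheory.Measure.eqOn_open_of_ae_eq (μ := volume) ?_ isOpen_Ioo
        (hcont.mono Ioo_subset_Icc_self) continuousOn_const
      filter_upwards [hk, hcw] with t h1 h2
      rw [h2]; exact h1
    have heq' : EqOn (fun t => c t - ∫ s in (0)..t, v s) (fun _ => k) (Icc 0 T) :=
      heq.of_subset_closure hcont continuousOn_const Ioo_subset_Icc_self
        (by rw [closure_Ioo hT.ne])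
    have hk0 : k = 0 := by
      have := heq' ⟨le_rfl, hT.le⟩
      simpa [hc0] using this.symm
    filter_upwards [hk] with t ht
    rw [hk0] at ht
    exact sub_eq_zero.1 ht
  · intro h
    refine ⟨fun φ hφ hc ht => ?_, fun t => ∫ s in (0)..t, v s, continuousOn_primitive_volJ hv,
      by simp, h.mono fun t ht => ht.symm⟩
    rw [← hprim φ hφ hc ht]
    exact integral_congr_ae (h.mono fun t ht => by simp only [ht])

/-- A function with vanishing primitive vanishes. -/
theorem ae_eq_zero_of_primitive [CompleteSpace X] {T : ℝ} (hT : 0 < T) {v : ℝ → X}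
    (hv : Integrable v (volJ T))
    (h : ∀ᵐ t ∂(volJ T), ∫ s in (0)..t, v s = 0) : v =ᵐ[volJ T] 0 := by
  have key := isOpen_Ioo.ae_eq_zero_of_integral_contDiff_smul_eq_zero
    (μ := volume) (U := Ioo (0 : ℝ) T) (f := (Ioo 0 T).indicator v)
    (((integrable_indicator_iff measurableSet_Ioo).2 hv).integrableOn.locallyIntegrableOn) ?_
  · rw [EventuallyEq, ae_restrict_iff' measurableSet_Ioo]
    filter_upwards [key] with t ht h't
    have := ht h't
    rwa [indicator_of_mem h't] at this
  intro g hg hgc hgt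
  have e0 : ∀ t, g t • (Ioo 0 T).indicator v t = (Ioo 0 T).indicator (fun t => g t • v t) t := by
    intro t
    by_cases h : t ∈ Ioo 0 T <;> simp [indicator, h]
  simp only [e0]
  -- Integration by parts trades the pairing of `g` with `v` for the pairing of the derivative of
  -- `g` with the primitive, which is zero.
  rw [integral_indicator measurableSet_Ioo, ← neg_eq_zero, ← isWeakDeriv_primitive hT hv g hg hgc hgt]
  refine integral_eq_zero_of_ae (h.mono fun t ht => ?_)
  simp only [ht, smul_zero, Pi.zero_apply]

end Primitive

end

/-! ### Maximal regularity spaces as kernels, and the parabolic operator. -/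

section
section MRBasic

variable {D X V : Type*}
  [NormedAddCommGroup D] [NormedSpace ℂ D]
  [NormedAddCommGroup X] [NormedSpace ℂ X]
  [NormedAddCommGroup V] [NormedSpace ℂ V]

theorem inclL1_injective (T : ℝ) (r : Exponent) : Function.Injective (inclL1 T r X) := by
  intro f g h
  refine Lp.ext ?_
  exact (inclL1_coe T r X f).symm.trans ((Lp.ext_iff.1 h).trans (inclL1_coe T r X g))

theorem compLpL_coe {T : ℝ} {p : ℝ≥0∞} [Fact (1 ≤ p)] (L : D →L[ℂ] X) (f : Lp D p (volJ T)) :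
    L.compLpL p (volJ T) f =ᵐ[volJ T] fun t => L (f t) :=
  L.coeFn_compLpL f

theorem compLpL_injective {T : ℝ} {p : ℝ≥0∞} [Fact (1 ≤ p)] {L : D →L[ℂ] X}
    (hL : Function.Injective L) : Function.Injective (L.compLpL p (volJ T)) := by
  intro f g h
  refine Lp.ext ?_
  filter_upwards [compLpL_coe L f, compLpL_coe L g, Lp.ext_iff.1 h] with t h1 h2 h3
  exact hL (by rw [← h1, ← h2, h3])

theorem inclL1_compLpL {T : ℝ} {r : Exponent} (L : D →L[ℂ] X) (f : LrJ T r D) :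
    inclL1 T r X (L.compLpL _ _ f) = L.compLpL 1 (volJ T) (inclL1 T r D f) := by
  refine Lp.ext ?_
  filter_upwards [inclL1_coe T r X (L.compLpL _ _ f), compLpL_coe L f, inclL1_coe T r D f,
    compLpL_coe L (inclL1 T r D f)] with t h1 h2 h3 h4
  rw [h1, h2, h4, h3]

theorem volterra_compLpL [CompleteSpace D] [CompleteSpace X] {T : ℝ} (L : D →L[ℂ] X)
    (f : Lp D 1 (volJ T)) :
    volterra T X (L.compLpL 1 (volJ T) f) = L.compLpL 1 (volJ T) (volterra T D f) := by
  refine Lp.ext ?_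
  filter_upwards [volterra_coe (L.compLpL 1 (volJ T) f), compLpL_coe L (volterra T D f),
    volterra_coe f, ae_volJ_mem T] with t h1 h2 h3 ht
  have hm := Ioo_subset_Icc_self ht
  rw [h1, h2, h3, primitive_congr (compLpL_coe L f) hm]
  exact (L.intervalIntegral_comp_comm (intervalIntegrable_of_integrable_volJ
    (L1.integrable_coeFn f) ⟨le_rfl, hm.1.trans hm.2⟩ hm))

theorem volterra_injective [CompleteSpace X] {T : ℝ} (hT : 0 < T) :
    Function.Injective (volterra T X) := by
  refine (injective_iff_map_eq_zero _).2 fun v hv => ?_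
  have h0 : ((0 : Lp X 1 (volJ T)) : ℝ → X) =ᵐ[volJ T] 0 := Lp.coeFn_zero _ _ _
  refine Lp.ext (EventuallyEq.trans ?_ h0.symm)
  refine ae_eq_zero_of_primitive hT (L1.integrable_coeFn v) ?_
  filter_upwards [volterra_coe v, Lp.ext_iff.1 hv, h0] with t h1 h2 h3
  rw [← h1, h2, h3, Pi.zero_apply]

theorem isW0_iff_volterra [CompleteSpace X] {T : ℝ} (hT : 0 < T) {r : Exponent} (w v : LrJ T r X) :
    IsW0 T w v ↔ inclL1 T r X w = volterra T X (inclL1 T r X v) := by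
  rw [isW0_iff hT, Lp.ext_iff]
  constructor
  · intro h
    filter_upwards [h, inclL1_coe T r X w, volterra_coe (inclL1 T r X v), ae_volJ_mem T]
      with t h1 h2 h3 ht
    rw [h2, h3, h1, primitive_congr (inclL1_coe T r X v) (Ioo_subset_Icc_self ht)]
  · intro h
    filter_upwards [h, inclL1_coe T r X w, volterra_coe (inclL1 T r X v), ae_volJ_mem T]
      with t h1 h2 h3 ht
    rw [← h2, h1, h3, primitive_congr (inclL1_coe T r X v) (Ioo_subset_Icc_self ht)]

/-- Expresses membership by an equation between bounded operators into `L¹(J; X)`. This makes the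
space closed, hence complete, and replaces test functions in all later arguments. -/
theorem mem_mrSubmodule_iff [CompleteSpace X] {T : ℝ} (hT : 0 < T) {r : Exponent} (i : D →L[ℂ] X)
    (p : WithLp 1 (LrJ T r D × LrJ T r X)) :
    p ∈ mrSubmodule T r i (ContinuousLinearMap.id ℂ X) ↔
      i.compLpL 1 (volJ T) (inclL1 T r D p.fst) = volterra T X (inclL1 T r X p.snd) := by
  have hid : ∀ w : LrJ T r X, (ContinuousLinearMap.id ℂ X).compLpL _ _ w = w := fun w =>
    Lp.ext (compLpL_coe _ w)
  constructor
  · rintro ⟨w, hw, hp⟩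
    rw [hid] at hw
    rw [← inclL1_compLpL, hw]
    exact (isW0_iff_volterra hT _ _).1 hp
  · intro h
    refine ⟨i.compLpL _ _ p.fst, (hid _).symm, (isW0_iff_volterra hT _ _).2 ?_⟩
    rw [inclL1_compLpL, h]

theorem completeSpace_MR [CompleteSpace D] [CompleteSpace X] {T : ℝ} (hT : 0 < T) (r : Exponent)
    (i : D →L[ℂ] X) : CompleteSpace (MR T r i) := by
  have : IsClosed (mrSubmodule T r i (ContinuousLinearMap.id ℂ X) :
      Set (WithLp 1 (LrJ T r D × LrJ T r X))) := by
    have e : (mrSubmodule T r i (ContinuousLinearMap.id ℂ X) :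
        Set (WithLp 1 (LrJ T r D × LrJ T r X))) =
        {p | (i.compLpL 1 (volJ T) ∘L inclL1 T r D ∘L WithLp.fstL 1 ℂ (LrJ T r D) (LrJ T r X)) p
          = (volterra T X ∘L inclL1 T r X ∘L WithLp.sndL 1 ℂ (LrJ T r D) (LrJ T r X)) p} := by
      ext p
      exact mem_mrSubmodule_iff hT i p
    rw [e]
    exact isClosed_eq (ContinuousLinearMap.continuous _) (ContinuousLinearMap.continuous _)
  exact this.completeSpace_coe

/-- The map `u ↦ u` from `MR₀^r(J; D, X)` to `L^r(J; D)`. -/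
def MRSpace.fnL (T : ℝ) (r : Exponent) (iD : D →L[ℂ] V) (iX : X →L[ℂ] V) :
    MRSpace T r iD iX →L[ℂ] LrJ T r D :=
  WithLp.fstL 1 ℂ (LrJ T r D) (LrJ T r X) ∘L MRSpace.toPair T r iD iX

/-- The map `u ↦ u'` from `MR₀^r(J; D, X)` to `L^r(J; X)`. -/
def MRSpace.derivL (T : ℝ) (r : Exponent) (iD : D →L[ℂ] V) (iX : X →L[ℂ] V) :
    MRSpace T r iD iX →L[ℂ] LrJ T r X :=
  WithLp.sndL 1 ℂ (LrJ T r D) (LrJ T r X) ∘L MRSpace.toPair T r iD iX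

/-- The function `u` of an element of `MR₀^r(J; D, X)` is the primitive of its derivative. -/
theorem MR.compLpL_fnL [CompleteSpace X] {T : ℝ} (hT : 0 < T) {r : Exponent} {i : D →L[ℂ] X}
    (u : MR T r i) :
    i.compLpL 1 (volJ T) (inclL1 T r D (MRSpace.fnL T r i _ u))
      = volterra T X (inclL1 T r X (MRSpace.derivL T r i _ u)) :=
  (mem_mrSubmodule_iff hT i _).1 u.2

/-- The element of `MR₀^r(J; D, X)` with given function and derivative. -/
def MR.mk [CompleteSpace X] {T : ℝ} (hT : 0 < T) {r : Exponent} (i : D →L[ℂ] X)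
    (u : LrJ T r D) (v : LrJ T r X)
    (h : i.compLpL 1 (volJ T) (inclL1 T r D u) = volterra T X (inclL1 T r X v)) : MR T r i :=
  ⟨WithLp.toLp 1 (u, v), (mem_mrSubmodule_iff hT i _).2 h⟩

/-- The operator `u ↦ u' + A u` from `MR₀^r(J; D, X)` to `L^r(J; X)`. -/
def parabolic (T : ℝ) (r : Exponent) (i A : D →L[ℂ] X) : MR T r i →L[ℂ] LrJ T r X :=
  MRSpace.derivL T r i _ + A.compLpL _ _ ∘L MRSpace.fnL T r i _

theorem parabolic_eq_iff {T : ℝ} {r : Exponent} {i A : D →L[ℂ] X} (u : MR T r i) (f : LrJ T r X) :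
    parabolic T r i A u = f ↔ ∀ᵐ t ∂(volJ T), u.deriv t + A (u.fn t) = f t := by
  rw [Lp.ext_iff]
  have h1 := Lp.coeFn_add (MRSpace.derivL T r i (ContinuousLinearMap.id ℂ X) u)
    (A.compLpL _ _ (MRSpace.fnL T r i (ContinuousLinearMap.id ℂ X) u))
  have h2 := compLpL_coe A (MRSpace.fnL T r i (ContinuousLinearMap.id ℂ X) u)
  have h3 : parabolic T r i A u =ᵐ[volJ T] fun t => u.deriv t + A (u.fn t) := by
    filter_upwards [h1, h2] with t h1 h2
    refine h1.trans ?_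
    rw [Pi.add_apply, h2]
    rfl
  exact ⟨fun h => h3.symm.trans h, fun h => h3.trans h⟩

theorem hasMaxRegExp_iff {T : ℝ} {r : Exponent} {i A : D →L[ℂ] X} :
    HasMaxRegExp T r i A ↔ Function.Bijective (parabolic T r i A) := by
  rw [Function.bijective_iff_existsUnique]
  simp only [parabolic_eq_iff]
  rfl

end MRBasic

end

/-! ### Uniqueness of integrable solutions and the solution operator. -/

section
section SolutionOperator

variable {D X : Type*}
  [NormedAddCommGroup D] [NormedSpace ℂ D] [CompleteSpace D]
  [NormedAddCommGroup X] [NormedSpace ℂ X] [CompleteSpace X]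

theorem memLp_primitive {T : ℝ} (p : ℝ≥0∞) {v : ℝ → X} (hv : Integrable v (volJ T)) :
    MemLp (fun t => ∫ s in (0)..t, v s) p (volJ T) := by
  refine MemLp.of_bound (integrable_primitive hv).aestronglyMeasurable (∫ s in Ioo 0 T, ‖v s‖) ?_
  filter_upwards [ae_volJ_mem T] with t ht using norm_primitive_le hv (Ioo_subset_Icc_self ht)

/-- Primitives of integrable functions are bounded on a finite interval, hence lie in every `L^r`.
This gain of integrability is what moves solutions from one exponent to another. -/
theorem exists_inclL1_eq_volterra {T : ℝ} (r : Exponent) (v : Lp X 1 (volJ T)) :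
    ∃ w : LrJ T r X, inclL1 T r X w = volterra T X v := by
  have h := memLp_primitive (ENNReal.ofReal (r : ℝ)) (L1.integrable_coeFn v)
  refine ⟨h.toLp _, Lp.ext ?_⟩
  exact (inclL1_coe T r X _).trans (h.coeFn_toLp.trans (volterra_coe v).symm)

/-- Maximal regularity for one exponent implies uniqueness of integrable solutions. -/
theorem HasMaxRegExp.eq_zero {T : ℝ} (hT : 0 < T) {s : Exponent} {i A : D →L[ℂ] X}
    (h : HasMaxRegExp T s i A) {u : Lp D 1 (volJ T)} {v : Lp X 1 (volJ T)}
    (hu : i.compLpL 1 (volJ T) u = volterra T X v) (hv : v + A.compLpL 1 (volJ T) u = 0) :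
    u = 0 ∧ v = 0 := by
  -- The primitives of `u` and `v` lie in `L^s` and satisfy the same homogeneous relations, so
  -- uniqueness in `MR₀^s` applies to them. Injectivity of the Volterra operator then returns to
  -- `u`.
  obtain ⟨U, hU⟩ := exists_inclL1_eq_volterra s u
  obtain ⟨W, hW⟩ := exists_inclL1_eq_volterra s v
  have hp : i.compLpL 1 (volJ T) (inclL1 T s D U) = volterra T X (inclL1 T s X W) := by
    rw [hU, hW, ← volterra_compLpL, hu]
  have h0 : parabolic T s i A (MR.mk hT i U W hp) = 0 := by
    change W + A.compLpL _ _ U = 0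
    apply inclL1_injective T s
    rw [map_add, inclL1_compLpL, hU, hW, ← volterra_compLpL, ← map_add, hv, map_zero, map_zero]
  have h1 := (hasMaxRegExp_iff.1 h).1 (h0.trans (map_zero _).symm)
  have h2 : U = 0 := congrArg (MRSpace.fnL T s i (ContinuousLinearMap.id ℂ X)) h1
  have hu0 : u = 0 := by
    apply volterra_injective hT
    rw [← hU, h2, map_zero, map_zero]
  refine ⟨hu0, ?_⟩
  rwa [hu0, map_zero, add_zero] at hv

theorem toLp_one_congr_prim {T : ℝ} {i : D →L[ℂ] X} {u : ℝ → D} {v : ℝ → X}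
    (hu : Integrable u (volJ T)) (hv : Integrable v (volJ T))
    (h : ∀ᵐ t ∂(volJ T), i (u t) = ∫ s in (0)..t, v s) :
    i.compLpL 1 (volJ T) (hu.toL1 u) = volterra T X (hv.toL1 v) := by
  refine Lp.ext ?_
  filter_upwards [compLpL_coe i (hu.toL1 u), volterra_coe (hv.toL1 v), hu.coeFn_toL1, h,
    ae_volJ_mem T] with t h1 h2 h3 h4 ht
  rw [h1, h2, h3, h4, primitive_congr hv.coeFn_toL1 (Ioo_subset_Icc_self ht)]

/-- Two integrable solutions of the same equation agree. -/
theorem HasMaxRegExp.ae_eq {T : ℝ} (hT : 0 < T) {s : Exponent} {i A : D →L[ℂ] X}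
    (h : HasMaxRegExp T s i A) {u u' : ℝ → D} {v v' : ℝ → X}
    (hu : Integrable u (volJ T)) (hv : Integrable v (volJ T))
    (hu' : Integrable u' (volJ T)) (hv' : Integrable v' (volJ T))
    (hp : ∀ᵐ t ∂(volJ T), i (u t) = ∫ s in (0)..t, v s)
    (hp' : ∀ᵐ t ∂(volJ T), i (u' t) = ∫ s in (0)..t, v' s)
    (he : ∀ᵐ t ∂(volJ T), v t + A (u t) = v' t + A (u' t)) : v =ᵐ[volJ T] v' := by
  have h1 := toLp_one_congr_prim hu hv hp
  have h2 := toLp_one_congr_prim hu' hv' hp'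
  have h3 : hv.toL1 v + A.compLpL 1 (volJ T) (hu.toL1 u)
      = hv'.toL1 v' + A.compLpL 1 (volJ T) (hu'.toL1 u') := by
    refine Lp.ext ?_
    filter_upwards [Lp.coeFn_add (hv.toL1 v) (A.compLpL 1 (volJ T) (hu.toL1 u)),
      Lp.coeFn_add (hv'.toL1 v') (A.compLpL 1 (volJ T) (hu'.toL1 u')),
      compLpL_coe A (hu.toL1 u), compLpL_coe A (hu'.toL1 u'), hu.coeFn_toL1, hv.coeFn_toL1,
      hu'.coeFn_toL1, hv'.coeFn_toL1, he] with t a1 a2 a3 a4 a5 a6 a7 a8 a9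
    rw [a1, a2, Pi.add_apply, Pi.add_apply, a3, a4, a5, a6, a7, a8, a9]
  have h4 := h.eq_zero hT (u := hu.toL1 u - hu'.toL1 u') (v := hv.toL1 v - hv'.toL1 v')
    (by rw [map_sub, map_sub, h1, h2])
    (by rw [map_sub, sub_add_sub_comm, h3, sub_self])
  exact (Integrable.toL1_eq_toL1_iff v v' hv hv').1 (sub_eq_zero.1 h4.2)

/-- The bounded inverse theorem, available because the maximal regularity space is complete. -/
theorem HasMaxRegExp.exists_solution_operator {T : ℝ} (hT : 0 < T) {s : Exponent}
    {i A : D →L[ℂ] X} (h : HasMaxRegExp T s i A) :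
    ∃ S : LrJ T s X →L[ℂ] MR T s i, ∀ f, parabolic T s i A (S f) = f := by
  have := completeSpace_MR hT s i
  have hb := hasMaxRegExp_iff.1 h
  refine ⟨(ContinuousLinearEquiv.ofBijective (parabolic T s i A)
    (LinearMap.ker_eq_bot.2 hb.1) (LinearMap.range_eq_top.2 hb.2)).symm.toContinuousLinearMap,
    fun f => ?_⟩
  exact ContinuousLinearEquiv.ofBijective_apply_symm_apply _ _ _ f

theorem MR.fn_eq_primitive {T : ℝ} (hT : 0 < T) {r : Exponent} {i : D →L[ℂ] X} (u : MR T r i) :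
    ∀ᵐ t ∂(volJ T), i (MRSpace.fnL T r i (ContinuousLinearMap.id ℂ X) u t)
      = ∫ s in (0)..t, MRSpace.derivL T r i (ContinuousLinearMap.id ℂ X) u s := by
  have h := MR.compLpL_fnL hT u
  filter_upwards [Lp.ext_iff.1 h, compLpL_coe i (inclL1 T r D (MRSpace.fnL T r i _ u)),
    inclL1_coe T r D (MRSpace.fnL T r i _ u), volterra_coe (inclL1 T r X (MRSpace.derivL T r i _ u)),
    ae_volJ_mem T] with t h1 h2 h3 h4 ht
  rw [← h3, ← h2, h1, h4, primitive_congr (inclL1_coe T r X _) (Ioo_subset_Icc_self ht)]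

end SolutionOperator

end

/-! ### Step functions and cell averages on dyadic grids of `(0, T)`. -/

section
section Grid

variable {Z W : Type*} [NormedAddCommGroup Z] [NormedSpace ℂ Z]
  [NormedAddCommGroup W] [NormedSpace ℂ W]

/-- The mesh of the grid of `2 ^ n` intervals on `(0, T)`. -/
def mesh (T : ℝ) (n : ℕ) : ℝ := T / 2 ^ n

theorem mesh_pos {T : ℝ} (hT : 0 < T) (n : ℕ) : 0 < mesh T n := by
  unfold mesh; positivity

theorem two_pow_mul_mesh (T : ℝ) (n : ℕ) : (2 : ℝ) ^ n * mesh T n = T := by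
  unfold mesh; field_simp

/-- The `k`-th interval of the grid. -/
def cell (T : ℝ) (n k : ℕ) : Set ℝ := Ico (k * mesh T n) ((k + 1) * mesh T n)

theorem measurableSet_cell (T : ℝ) (n k : ℕ) : MeasurableSet (cell T n k) := measurableSet_Ico

theorem mem_cell_iff {T : ℝ} (hT : 0 < T) {n k : ℕ} {t : ℝ} (ht : 0 ≤ t) :
    t ∈ cell T n k ↔ ⌊t / mesh T n⌋₊ = k := by
  have hm := mesh_pos hT n
  rw [Nat.floor_eq_iff (div_nonneg ht hm.le), le_div_iff₀ hm, div_lt_iff₀ hm]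
  rfl

theorem floor_lt {T : ℝ} (hT : 0 < T) {n : ℕ} {t : ℝ} (ht : t ∈ Ioo 0 T) :
    ⌊t / mesh T n⌋₊ < 2 ^ n := by
  have hm := mesh_pos hT n
  rw [Nat.floor_lt (div_nonneg ht.1.le hm.le), div_lt_iff₀ hm]
  push_cast
  rw [two_pow_mul_mesh]
  exact ht.2

theorem cell_subset {T : ℝ} (hT : 0 < T) {n k : ℕ} (hk : k < 2 ^ n) :
    cell T n k ⊆ Ico 0 T := by
  have hm := mesh_pos hT n
  refine Ico_subset_Ico (by positivity) ?_
  have h1 : ((k : ℝ) + 1) ≤ 2 ^ n := by exact_mod_cast hk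
  calc ((k : ℝ) + 1) * mesh T n ≤ 2 ^ n * mesh T n := by gcongr
    _ = T := two_pow_mul_mesh T n

theorem restrict_cell {T : ℝ} (hT : 0 < T) {n k : ℕ} (hk : k < 2 ^ n) :
    (volJ T).restrict (cell T n k) = volume.restrict (cell T n k) := by
  have h : volJ T = volume.restrict (Ico 0 T) :=
    Measure.restrict_congr_set Ioo_ae_eq_Ico
  rw [h, Measure.restrict_restrict (measurableSet_cell _ _ _), inter_eq_left.2 (cell_subset hT hk)]

theorem volJ_cell {T : ℝ} (hT : 0 < T) {n k : ℕ} (hk : k < 2 ^ n) :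
    volJ T (cell T n k) = ENNReal.ofReal (mesh T n) := by
  rw [← Measure.restrict_apply_self, restrict_cell hT hk, Measure.restrict_apply_self, cell,
    Real.volume_Ico]
  congr 1; ring

/-- The step function with values `x k` on the cells of the grid. -/
def stepFun (T : ℝ) (n : ℕ) {Z : Type*} (x : ℕ → Z) (t : ℝ) : Z := x ⌊t / mesh T n⌋₊

theorem stepFun_eq_sum {Z : Type*} [NormedAddCommGroup Z] {T : ℝ} (hT : 0 < T) {n : ℕ} (x : ℕ → Z) {t : ℝ} (ht : t ∈ Ioo 0 T) :
    stepFun T n x t = ∑ k ∈ Finset.range (2 ^ n), (cell T n k).indicator (fun _ => x k) t := by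
  rw [Finset.sum_eq_single ⌊t / mesh T n⌋₊]
  · rw [indicator_of_mem ((mem_cell_iff hT ht.1.le).2 rfl)]; rfl
  · intro k _ hk
    exact indicator_of_notMem (fun h => hk ((mem_cell_iff hT ht.1.le).1 h).symm) _
  · intro h
    exact absurd (Finset.mem_range.2 (floor_lt hT ht)) h

theorem aestronglyMeasurable_stepFun {Z : Type*} [NormedAddCommGroup Z] (T : ℝ) (n : ℕ) (x : ℕ → Z) :
    AEStronglyMeasurable (stepFun T n x) (volJ T) := by
  have h : Measurable fun t : ℝ => ⌊t / mesh T n⌋₊ :=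
    Nat.measurable_floor.comp (measurable_id.div_const _)
  exact ((StronglyMeasurable.of_discrete (f := x)).comp_measurable h).aestronglyMeasurable

theorem memLp_stepFun {Z : Type*} [NormedAddCommGroup Z] {T : ℝ} (hT : 0 < T) (n : ℕ) (p : ℝ≥0∞) (x : ℕ → Z) :
    MemLp (stepFun T n x) p (volJ T) := by
  refine MemLp.of_bound (aestronglyMeasurable_stepFun T n x)
    (∑ k ∈ Finset.range (2 ^ n), ‖x k‖) ?_
  filter_upwards [ae_volJ_mem T] with t ht
  exact Finset.single_le_sum (f := fun k => ‖x k‖) (fun k _ => norm_nonneg _)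
    (Finset.mem_range.2 (floor_lt hT ht))

theorem integral_stepFun {E : Type*} [NormedAddCommGroup E] [NormedSpace ℝ E] [CompleteSpace E]
    {T : ℝ} (hT : 0 < T) (n : ℕ) (x : ℕ → E) :
    ∫ t in Ioo 0 T, stepFun T n x t = ∑ k ∈ Finset.range (2 ^ n), mesh T n • x k := by
  have e : ∀ᵐ t ∂(volJ T), stepFun T n x t =
      ∑ k ∈ Finset.range (2 ^ n), (cell T n k).indicator (fun _ => x k) t := by
    filter_upwards [ae_volJ_mem T] with t ht using stepFun_eq_sum hT x ht
  rw [integral_congr_ae e, integral_finsetSum]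
  · refine Finset.sum_congr rfl fun k hk => ?_
    rw [integral_indicator (measurableSet_cell _ _ _), setIntegral_const, measureReal_def,
      volJ_cell hT (Finset.mem_range.1 hk), ENNReal.toReal_ofReal (mesh_pos hT n).le]
  · intro k _
    exact (integrable_const _).indicator (measurableSet_cell _ _ _)

theorem LrJ.norm_rpow {Z : Type*} [NormedAddCommGroup Z] {T : ℝ} {r : Exponent} (f : LrJ T r Z) :
    ‖f‖ ^ (r : ℝ) = ∫ t in Ioo 0 T, ‖f t‖ ^ (r : ℝ) := by
  have hr : (0 : ℝ) < r := zero_lt_one.trans r.2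
  rw [Lp.norm_def, (Lp.memLp f).eLpNorm_eq_integral_rpow_norm (by simpa using hr) (by simp),
    ENNReal.toReal_ofReal (by positivity), ENNReal.toReal_ofReal hr.le, ← Real.rpow_mul,
    inv_mul_cancel₀ hr.ne', Real.rpow_one]
  exact integral_nonneg fun t => by positivity

theorem LrJ.integrable_rpow {Z : Type*} [NormedAddCommGroup Z] {T : ℝ} {r : Exponent} (f : LrJ T r Z) :
    Integrable (fun t => ‖f t‖ ^ (r : ℝ)) (volJ T) := by
  have hr : (0 : ℝ) < r := zero_lt_one.trans r.2
  have := (Lp.memLp f).integrable_norm_rpow (by simpa using hr) (by simp)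
  rwa [ENNReal.toReal_ofReal hr.le] at this

/-- The step functions of the grid as elements of `L^r(J; Z)`. -/
def stepLr {T : ℝ} (hT : 0 < T) (r : Exponent) (n : ℕ) (Z : Type*) [NormedAddCommGroup Z]
    [NormedSpace ℂ Z] : (ℕ → Z) →ₗ[ℂ] LrJ T r Z where
  toFun x := (memLp_stepFun hT n _ x).toLp _
  map_add' _ _ := rfl
  map_smul' _ _ := rfl

theorem stepLr_coe {T : ℝ} (hT : 0 < T) (r : Exponent) (n : ℕ) (x : ℕ → Z) :
    stepLr hT r n Z x =ᵐ[volJ T] stepFun T n x :=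
  MemLp.coeFn_toLp (memLp_stepFun hT n _ x)

theorem norm_stepLr_rpow {T : ℝ} (hT : 0 < T) (r : Exponent) (n : ℕ) (x : ℕ → Z) :
    ‖stepLr hT r n Z x‖ ^ (r : ℝ) = ∑ k ∈ Finset.range (2 ^ n), mesh T n * ‖x k‖ ^ (r : ℝ) := by
  rw [LrJ.norm_rpow, integral_congr_ae ((stepLr_coe hT r n x).mono fun t ht => by
    show ‖stepLr hT r n Z x t‖ ^ (r : ℝ) = stepFun T n (fun k => ‖x k‖ ^ (r : ℝ)) t
    rw [ht]; rfl), integral_stepFun hT]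
  rfl

/-- The mean value over a cell of the grid. -/
def cellAvg (T : ℝ) (n k : ℕ) (Z : Type*) [NormedAddCommGroup Z] [NormedSpace ℂ Z] :
    Lp Z 1 (volJ T) →L[ℂ] Z :=
  LinearMap.mkContinuous
    { toFun := fun f => (mesh T n)⁻¹ • ∫ t in cell T n k, f t ∂(volJ T)
      map_add' := fun f g => by
        rw [integral_congr_ae (ae_restrict_of_ae (Lp.coeFn_add f g))]
        simp only [Pi.add_apply]
        rw [integral_add (L1.integrable_coeFn f).restrict (L1.integrable_coeFn g).restrict,
          smul_add]
      map_smul' := fun c f => by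
        rw [integral_congr_ae (ae_restrict_of_ae (Lp.coeFn_smul c f))]
        simp only [Pi.smul_apply, RingHom.id_apply]
        rw [integral_smul, smul_comm] }
    |(mesh T n)⁻¹| (fun f => by
      change ‖(mesh T n)⁻¹ • ∫ t in cell T n k, f t ∂(volJ T)‖ ≤ _
      rw [norm_smul, Real.norm_eq_abs, L1.norm_eq_integral_norm]
      gcongr
      refine (norm_integral_le_integral_norm _).trans ?_
      exact setIntegral_le_integral (L1.integrable_coeFn f).norm
        (Eventually.of_forall fun _ => norm_nonneg _))

theorem cellAvg_apply {T : ℝ} {n k : ℕ} (f : Lp Z 1 (volJ T)) :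
    cellAvg T n k Z f = (mesh T n)⁻¹ • ∫ t in cell T n k, f t ∂(volJ T) := rfl

theorem cellAvg_inclL1 {T : ℝ} {r : Exponent} {n k : ℕ} (f : LrJ T r Z) :
    cellAvg T n k Z (inclL1 T r Z f) = (mesh T n)⁻¹ • ∫ t in cell T n k, f t ∂(volJ T) := by
  rw [cellAvg_apply, integral_congr_ae (ae_restrict_of_ae (inclL1_coe T r Z f))]

theorem cellAvg_compLpL [CompleteSpace Z] [CompleteSpace W] {T : ℝ} {n k : ℕ} (L : Z →L[ℂ] W)
    (f : Lp Z 1 (volJ T)) :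
    cellAvg T n k W (L.compLpL 1 (volJ T) f) = L (cellAvg T n k Z f) := by
  rw [cellAvg_apply, cellAvg_apply, integral_congr_ae (ae_restrict_of_ae (compLpL_coe L f)),
    L.integral_comp_comm (L1.integrable_coeFn f).restrict]
  exact ((L.restrictScalars ℝ).map_smul _ _).symm

/-- Jensen's inequality for the convex function `x ↦ x ^ r`. Summed over the cells it shows that the
averaging projection is a contraction of `L^r`. -/
theorem norm_cellAvg_rpow_le {T : ℝ} (hT : 0 < T) {r : Exponent} {n k : ℕ} (hk : k < 2 ^ n)
    (f : LrJ T r Z) :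
    mesh T n * ‖cellAvg T n k Z (inclL1 T r Z f)‖ ^ (r : ℝ)
      ≤ ∫ t in cell T n k, ‖f t‖ ^ (r : ℝ) ∂(volJ T) := by
  have hm := mesh_pos hT n
  have hr : (1 : ℝ) < r := r.2
  have hvol := volJ_cell hT hk
  have hreal : (volJ T).real (cell T n k) = mesh T n := by
    rw [measureReal_def, hvol, ENNReal.toReal_ofReal hm.le]
  have h1 : ‖cellAvg T n k Z (inclL1 T r Z f)‖ ≤ ⨍ t in cell T n k, ‖f t‖ ∂(volJ T) := by
    rw [cellAvg_inclL1, norm_smul, setAverage_eq, hreal, smul_eq_mul, norm_inv,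
      Real.norm_of_nonneg hm.le]
    gcongr
    exact norm_integral_le_integral_norm _
  have h2 := (convexOn_rpow hr.le).map_set_average_le (μ := volJ T) (t := cell T n k)
    (f := fun t => ‖f t‖) (Real.continuous_rpow_const (by linarith)).continuousOn isClosed_Ici
    (by rw [hvol]; simpa using hm) (by rw [hvol]; simp)
    (Eventually.of_forall fun t => norm_nonneg _) (LrJ.integrable f).norm.restrict
    (LrJ.integrable_rpow f).restrict
  have h3 := (Real.rpow_le_rpow (norm_nonneg _) h1 (by linarith : (0 : ℝ) ≤ r)).trans h2
  rw [setAverage_eq, hreal, smul_eq_mul, inv_mul_eq_div, le_div_iff₀ hm] at h3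
  rw [mul_comm]
  exact h3

theorem sum_norm_cellAvg_rpow_le {T : ℝ} (hT : 0 < T) {r : Exponent} (n : ℕ) (f : LrJ T r Z) :
    ∑ k ∈ Finset.range (2 ^ n), mesh T n * ‖cellAvg T n k Z (inclL1 T r Z f)‖ ^ (r : ℝ)
      ≤ ‖f‖ ^ (r : ℝ) := by
  refine (Finset.sum_le_sum fun k hk => norm_cellAvg_rpow_le hT (Finset.mem_range.1 hk) f).trans ?_
  rw [LrJ.norm_rpow, ← integral_biUnion_finset _ (fun k _ => measurableSet_cell _ _ _)]
  · exact setIntegral_le_integral (LrJ.integrable_rpow f)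
      (Eventually.of_forall fun t => by positivity)
  · intro j _ k _ hjk
    refine Set.disjoint_left.2 fun t hj hk => hjk ?_
    have ht : 0 ≤ t := (by have := mesh_pos hT n; positivity : (0 : ℝ) ≤ j * mesh T n).trans hj.1
    rw [← (mem_cell_iff hT ht).1 hj, ← (mem_cell_iff hT ht).1 hk]
  · exact fun k _ => (LrJ.integrable_rpow f).integrableOn

/-- The projection of `L^r(J; Z)` onto the step functions of the grid. -/
def gridProj {T : ℝ} (hT : 0 < T) (r : Exponent) (n : ℕ) (Z : Type*) [NormedAddCommGroup Z]
    [NormedSpace ℂ Z] : LrJ T r Z →L[ℂ] LrJ T r Z :=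
  LinearMap.mkContinuous
    (stepLr hT r n Z ∘ₗ LinearMap.pi fun k => (cellAvg T n k Z ∘L inclL1 T r Z).toLinearMap) 1
    (fun f => by
      have hr : (1 : ℝ) < r := r.2
      rw [one_mul, ← Real.rpow_le_rpow_iff (norm_nonneg _) (norm_nonneg _)
        (by linarith : (0 : ℝ) < r)]
      refine (norm_stepLr_rpow hT r n _).trans_le ?_
      exact sum_norm_cellAvg_rpow_le hT n f)

theorem gridProj_apply {T : ℝ} (hT : 0 < T) (r : Exponent) (n : ℕ) (f : LrJ T r Z) :
    gridProj hT r n Z f = stepLr hT r n Z fun k => cellAvg T n k Z (inclL1 T r Z f) := rfl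

theorem norm_gridProj_le {T : ℝ} (hT : 0 < T) (r : Exponent) (n : ℕ) (f : LrJ T r Z) :
    ‖gridProj hT r n Z f‖ ≤ ‖f‖ := by
  refine (ContinuousLinearMap.le_of_opNorm_le _ (LinearMap.mkContinuous_norm_le _ zero_le_one _)
    f).trans_eq (one_mul _)

end Grid

end

/-! ### Convergence of the averaging projections. -/

section
section GridLimit

variable {Z : Type*} [NormedAddCommGroup Z] [NormedSpace ℂ Z] [CompleteSpace Z]

theorem norm_gridProj_sub_le {T : ℝ} (hT : 0 < T) {r : Exponent} {n : ℕ} (g : ℝ → Z) (G : LrJ T r Z)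
    (hG : G =ᵐ[volJ T] g) {δ : ℝ}
    (hg : ∀ s ∈ Icc 0 T, ∀ t ∈ Icc 0 T, |s - t| ≤ mesh T n → ‖g s - g t‖ ≤ δ) :
    ∀ᵐ t ∂(volJ T), ‖(gridProj hT r n Z G - G) t‖ ≤ δ := by
  have hm := mesh_pos hT n
  filter_upwards [Lp.coeFn_sub (gridProj hT r n Z G) G, hG, ae_volJ_mem T,
    stepLr_coe hT r n fun k => cellAvg T n k Z (inclL1 T r Z G)] with t h1 h2 ht h3
  rw [h1, Pi.sub_apply, gridProj_apply, h3, h2]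
  set k := ⌊t / mesh T n⌋₊ with hk
  have hkn : k < 2 ^ n := floor_lt hT ht
  have htk : t ∈ cell T n k := (mem_cell_iff hT ht.1.le).2 rfl
  change ‖cellAvg T n k Z (inclL1 T r Z G) - g t‖ ≤ δ
  have hvol := volJ_cell hT hkn
  have hreal : (volJ T).real (cell T n k) = mesh T n := by
    rw [measureReal_def, hvol, ENNReal.toReal_ofReal hm.le]
  have e1 : g t = (mesh T n)⁻¹ • ∫ _ in cell T n k, g t ∂(volJ T) := by
    rw [setIntegral_const, hreal, smul_smul, inv_mul_cancel₀ hm.ne', one_smul]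
  have e2 : cellAvg T n k Z (inclL1 T r Z G) - g t
      = (mesh T n)⁻¹ • ∫ s in cell T n k, (G s - g t) ∂(volJ T) := by
    rw [integral_sub (LrJ.integrable G).restrict (integrable_const _), smul_sub, ← e1,
      cellAvg_inclL1]
  rw [e2, norm_smul, norm_inv, Real.norm_of_nonneg hm.le, inv_mul_le_iff₀ hm, mul_comm]
  have h4 : ∀ᵐ s ∂((volJ T).restrict (cell T n k)), ‖G s - g t‖ ≤ δ := by
    filter_upwards [ae_restrict_of_ae hG, ae_restrict_mem (measurableSet_cell T n k)] with s hs hsk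
    rw [hs]
    have hs' := cell_subset hT hkn hsk
    refine hg s ⟨hs'.1, hs'.2.le⟩ t ⟨ht.1.le, ht.2.le⟩ ?_
    have a1 := hsk.1; have a2 := hsk.2; have a3 := htk.1; have a4 := htk.2
    rw [abs_le]
    constructor <;> nlinarith
  have h5 := norm_setIntegral_le_of_norm_le_const_ae (μ := volJ T) (s := cell T n k)
    (by rw [hvol]; simp) h4
  rwa [hreal] at h5

theorem tendsto_mesh (T : ℝ) : Tendsto (mesh T) atTop (𝓝 0) := by
  have h := (tendsto_pow_atTop_nhds_zero_of_lt_one (r := (2 : ℝ)⁻¹) (by norm_num)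
    (by norm_num)).const_mul T
  rw [mul_zero] at h
  refine h.congr fun n => ?_
  rw [mesh, inv_pow, div_eq_mul_inv]

/-- The projections are contractions, so convergence on a dense set suffices. Bounded continuous
functions are dense and uniformly continuous on `[0, T]`, hence oscillate little on each cell. -/
theorem tendsto_gridProj {T : ℝ} (hT : 0 < T) (r : Exponent) (f : LrJ T r Z) :
    Tendsto (fun n => gridProj hT r n Z f) atTop (𝓝 f) := by
  rw [Metric.tendsto_atTop]
  intro ε hε
  obtain ⟨g, hgε, hgp⟩ := (Lp.memLp f).exists_boundedContinuous_eLpNorm_sub_le (by simp)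
    (ε := ENNReal.ofReal (ε / 4)) (by simpa using hε)
  set G : LrJ T r Z := hgp.toLp g with hG
  have hfG : ‖f - G‖ ≤ ε / 4 := by
    rw [Lp.norm_def]
    refine ENNReal.toReal_le_of_le_ofReal (by positivity) ?_
    refine (eLpNorm_congr_ae ?_).trans_le hgε
    filter_upwards [Lp.coeFn_sub f G, hgp.coeFn_toLp] with t h1 h2
    rw [h1, Pi.sub_apply, Pi.sub_apply, ← h2]
  set M : ℝ := (measureUnivNNReal (volJ T) : ℝ) ^ (ENNReal.ofReal (r : ℝ)).toReal⁻¹ with hM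
  have hM0 : 0 ≤ M := by positivity
  have huc : UniformContinuousOn g (Icc 0 T) :=
    isCompact_Icc.uniformContinuousOn_of_continuous g.continuous.continuousOn
  -- `M` is the factor between the supremum bound and the `L^r` norm; using `M + 1` avoids a
  -- division by zero.
  obtain ⟨δ, hδ, hgδ⟩ := Metric.uniformContinuousOn_iff_le.1 huc (ε / (4 * (M + 1))) (by positivity)
  obtain ⟨n₀, hn₀⟩ := ((tendsto_mesh T).eventually (gt_mem_nhds hδ)).exists_forall_of_atTop
  refine ⟨n₀, fun n hn => ?_⟩
  have h1 := Lp.norm_le_of_ae_bound (f := gridProj hT r n Z G - G) (by positivity)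
    (norm_gridProj_sub_le hT g G hgp.coeFn_toLp (n := n) (δ := ε / (4 * (M + 1)))
      fun s hs t ht hst => by
        rw [← dist_eq_norm]
        exact hgδ s hs t ht (by rw [Real.dist_eq]; exact hst.trans (hn₀ n hn).le))
  have h2 : ‖gridProj hT r n Z G - G‖ ≤ ε / 4 := by
    refine h1.trans ?_
    calc M * (ε / (4 * (M + 1))) = (M / (M + 1)) * (ε / 4) := by field_simp
      _ ≤ 1 * (ε / 4) := by
        gcongr
        rw [div_le_one (by positivity)]; linarith
      _ = ε / 4 := one_mul _
  rw [dist_eq_norm]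
  have e : gridProj hT r n Z f - f
      = gridProj hT r n Z (f - G) + (gridProj hT r n Z G - G) - (f - G) := by
    rw [map_sub]; abel
  rw [e]
  calc _ ≤ ‖gridProj hT r n Z (f - G)‖ + ‖gridProj hT r n Z G - G‖ + ‖f - G‖ :=
        (norm_sub_le _ _).trans (add_le_add_left (norm_add_le _ _) _)
    _ ≤ ε / 4 + ε / 4 + ε / 4 := by
        gcongr
        exact (norm_gridProj_le hT r n _).trans hfG
    _ < ε := by linarith

end GridLimit

end

/-! ### Dyadic stopping blocks: a discrete Calderón–Zygmund decomposition. -/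

section
section Dyadic

/-- The average of `φ` over the dyadic block of length `2 ^ m` that contains `i`, within
`{0, …, 2 ^ n - 1}`. -/
def dyadicAvg {E : Type*} [AddCommGroup E] [Module ℝ E] (n : ℕ) (φ : ℕ → E) (m i : ℕ) : E :=
  ((2 : ℝ) ^ m)⁻¹ • ∑ j ∈ Finset.range (2 ^ n) with j / 2 ^ m = i / 2 ^ m, φ j

/-- Since `2 ^ m` divides `2 ^ n`, no block is cut off by the end of the range, so `dyadicAvg` is a
genuine mean for the indices in the range and `m ≤ n`. -/
theorem card_dyadicBlock {n m i : ℕ} (hm : m ≤ n) (hi : i < 2 ^ n) :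
    (Finset.filter (fun j => j / 2 ^ m = i / 2 ^ m) (Finset.range (2 ^ n))).card = 2 ^ m := by
  have hp : 0 < 2 ^ m := by positivity
  have : Finset.filter (fun j => j / 2 ^ m = i / 2 ^ m) (Finset.range (2 ^ n))
      = Finset.Ico (i / 2 ^ m * 2 ^ m) (i / 2 ^ m * 2 ^ m + 2 ^ m) := by
    ext j
    simp only [Finset.mem_filter, Finset.mem_range, Finset.mem_Ico]
    have h1 : j / 2 ^ m = i / 2 ^ m ↔ i / 2 ^ m * 2 ^ m ≤ j ∧ j < i / 2 ^ m * 2 ^ m + 2 ^ m := by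
      rw [Nat.div_eq_iff hp]
      constructor <;> rintro ⟨h1, h2⟩ <;> constructor <;> omega
    rw [h1]
    refine ⟨fun h => h.2, fun h => ⟨h.2.trans_le ?_, h⟩⟩
    have h2 : i / 2 ^ m < 2 ^ (n - m) := by
      rw [Nat.div_lt_iff_lt_mul hp, ← pow_add, Nat.sub_add_cancel hm]
      exact hi
    calc i / 2 ^ m * 2 ^ m + 2 ^ m = (i / 2 ^ m + 1) * 2 ^ m := by ring
      _ ≤ 2 ^ (n - m) * 2 ^ m := Nat.mul_le_mul_right _ h2
      _ = 2 ^ n := by rw [← pow_add, Nat.sub_add_cancel hm]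
  rw [this, Nat.card_Ico, Nat.add_sub_cancel_left]

theorem div_two_pow_congr {i j m m' : ℕ} (h : j / 2 ^ m = i / 2 ^ m) (hm : m ≤ m') :
    j / 2 ^ m' = i / 2 ^ m' := by
  obtain ⟨k, rfl⟩ := Nat.exists_eq_add_of_le hm
  rw [pow_add, ← Nat.div_div_eq_div_mul, ← Nat.div_div_eq_div_mul, h]

theorem dyadicAvg_congr {E : Type*} [AddCommGroup E] [Module ℝ E] {n : ℕ} {φ : ℕ → E} {i j m : ℕ}
    (h : j / 2 ^ m = i / 2 ^ m) : dyadicAvg n φ m j = dyadicAvg n φ m i := by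
  rw [dyadicAvg, dyadicAvg, h]

/-- The stopping level of `i` at height `lam`: the largest `m ≤ n` for which the average of `F` over
the block of length `2 ^ m` around `i` exceeds `lam`, and `0` if there is none. -/
def stopLevel (n : ℕ) (F : ℕ → ℝ) (lam : ℝ) (i : ℕ) : ℕ :=
  open Classical in Nat.findGreatest (fun m => lam < dyadicAvg n F m i) n

theorem stopLevel_le (n : ℕ) (F : ℕ → ℝ) (lam : ℝ) (i : ℕ) : stopLevel n F lam i ≤ n := by
  classical exact Nat.findGreatest_le _

/-- An average at or above the stopping level depends only on the block of that level which contains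
the point. Hence the level is constant on a stopping block, and the stopping blocks partition the
range. -/
theorem stopLevel_congr {n : ℕ} {F : ℕ → ℝ} {lam : ℝ} {i j : ℕ}
    (h : j / 2 ^ stopLevel n F lam i = i / 2 ^ stopLevel n F lam i) :
    stopLevel n F lam j = stopLevel n F lam i := by
  classical
  have hi := Nat.findGreatest_eq_iff.1 (rfl : stopLevel n F lam i = _)
  refine Nat.findGreatest_eq_iff.2 ⟨hi.1, fun h0 => ?_, fun k hk hkn => ?_⟩
  · rw [dyadicAvg_congr h]; exact hi.2.1 h0
  · rw [dyadicAvg_congr (div_two_pow_congr h hk.le)]; exact hi.2.2 hk hkn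

theorem stopLevel_symm {n : ℕ} {F : ℕ → ℝ} {lam : ℝ} {i j : ℕ} :
    j / 2 ^ stopLevel n F lam i = i / 2 ^ stopLevel n F lam i ↔
      i / 2 ^ stopLevel n F lam j = j / 2 ^ stopLevel n F lam j :=
  ⟨fun h => by rw [stopLevel_congr h, h], fun h => by rw [stopLevel_congr h, h]⟩

/-- The average over the stopping block. -/
def stopAvg {E : Type*} [AddCommGroup E] [Module ℝ E] (n : ℕ) (F : ℕ → ℝ) (lam : ℝ) (φ : ℕ → E)
    (i : ℕ) : E := dyadicAvg n φ (stopLevel n F lam i) i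

/-- Replacing a function by its averages over the stopping blocks does not change its pairing with
weights that are constant on these blocks. -/
theorem sum_stopAvg {E E' : Type*} [AddCommGroup E] [Module ℝ E] [AddCommGroup E'] [Module ℝ E']
    {n : ℕ} {F : ℕ → ℝ} {lam : ℝ} {φ : ℕ → E} {w : ℕ → E →ₗ[ℝ] E'}
    (hw : ∀ i < 2 ^ n, ∀ j < 2 ^ n,
      j / 2 ^ stopLevel n F lam i = i / 2 ^ stopLevel n F lam i → w j = w i) :
    ∑ i ∈ Finset.range (2 ^ n), w i (stopAvg n F lam φ i)
      = ∑ i ∈ Finset.range (2 ^ n), w i (φ i) := by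
  have e1 : ∀ i, w i (stopAvg n F lam φ i) = ∑ j ∈ Finset.range (2 ^ n),
      if j / 2 ^ stopLevel n F lam i = i / 2 ^ stopLevel n F lam i then
        ((2 : ℝ) ^ stopLevel n F lam i)⁻¹ • w i (φ j) else 0 := by
    intro i
    rw [stopAvg, dyadicAvg, map_smul, map_sum, Finset.smul_sum, Finset.sum_filter]
  simp only [e1]
  rw [Finset.sum_comm]
  refine Finset.sum_congr rfl fun j hj => ?_
  have hj' := Finset.mem_range.1 hj
  have e2 : ∀ i ∈ Finset.range (2 ^ n),
      (if j / 2 ^ stopLevel n F lam i = i / 2 ^ stopLevel n F lam i then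
        ((2 : ℝ) ^ stopLevel n F lam i)⁻¹ • w i (φ j) else 0)
      = if i / 2 ^ stopLevel n F lam j = j / 2 ^ stopLevel n F lam j then
        ((2 : ℝ) ^ stopLevel n F lam j)⁻¹ • w j (φ j) else 0 := by
    intro i hi
    by_cases h : j / 2 ^ stopLevel n F lam i = i / 2 ^ stopLevel n F lam i
    · rw [if_pos h, if_pos (stopLevel_symm.1 h), stopLevel_congr h,
        hw i (Finset.mem_range.1 hi) j hj' h]
    · rw [if_neg h, if_neg fun h' => h (stopLevel_symm.2 h')]
  -- After exchanging the sums, each `j` is counted once for every member of its stopping block; the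
  -- cardinality of the block cancels the normalizing factor of the average.
  rw [Finset.sum_congr rfl e2, ← Finset.sum_filter, Finset.sum_const,
    card_dyadicBlock (stopLevel_le _ _ _ _) hj', ← Nat.cast_smul_eq_nsmul ℝ, smul_smul]
  simp

theorem dyadicAvg_zero {E : Type*} [AddCommGroup E] [Module ℝ E] {n : ℕ} {φ : ℕ → E} {i : ℕ}
    (hi : i < 2 ^ n) : dyadicAvg n φ 0 i = φ i := by
  simp [dyadicAvg, hi]

theorem norm_dyadicAvg_le {E : Type*} [NormedAddCommGroup E] [NormedSpace ℝ E] (n : ℕ) (φ : ℕ → E)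
    (m i : ℕ) : ‖dyadicAvg n φ m i‖ ≤ dyadicAvg n (fun j => ‖φ j‖) m i := by
  rw [dyadicAvg, dyadicAvg, norm_smul, smul_eq_mul, norm_inv, norm_pow, Real.norm_two]
  gcongr
  exact norm_sum_le _ _

theorem dyadicAvg_le_two_mul {n : ℕ} {F : ℕ → ℝ} (hF : ∀ i, 0 ≤ F i) (m i : ℕ) :
    dyadicAvg n F m i ≤ 2 * dyadicAvg n F (m + 1) i := by
  have e : ∀ S : ℝ, 2 * (((2 : ℝ) ^ (m + 1))⁻¹ * S) = ((2 : ℝ) ^ m)⁻¹ * S := by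
    intro S
    rw [pow_succ]
    field_simp
  rw [dyadicAvg, dyadicAvg, smul_eq_mul, smul_eq_mul, e]
  refine mul_le_mul_of_nonneg_left ?_ (by positivity)
  refine Finset.sum_le_sum_of_subset_of_nonneg (fun j hj => ?_) fun j _ _ => hF j
  rw [Finset.mem_filter] at hj ⊢
  refine ⟨hj.1, ?_⟩
  exact div_two_pow_congr hj.2 (Nat.le_succ m)

variable {n : ℕ} {F : ℕ → ℝ} {lam : ℝ}

/-- The union of the stopping blocks. -/
def stopSet (n : ℕ) (F : ℕ → ℝ) (lam : ℝ) : Finset ℕ :=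
  open Classical in (Finset.range (2 ^ n)).filter fun i => lam < stopAvg n F lam F i

theorem mem_stopSet {i : ℕ} : i ∈ stopSet n F lam ↔ i < 2 ^ n ∧ lam < stopAvg n F lam F i := by
  simp [stopSet]

theorem stopLevel_eq_zero {i : ℕ} (hi : i < 2 ^ n) (h : i ∉ stopSet n F lam) :
    stopLevel n F lam i = 0 := by
  classical
  by_contra h0
  exact h (mem_stopSet.2 ⟨hi, (Nat.findGreatest_eq_iff.1 (rfl : stopLevel n F lam i = _)).2.1 h0⟩)

theorem le_of_notMem_stopSet {i : ℕ} (hi : i < 2 ^ n) (h : i ∉ stopSet n F lam) : F i ≤ lam := by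
  by_contra hc
  refine h (mem_stopSet.2 ⟨hi, ?_⟩)
  rw [stopAvg, stopLevel_eq_zero hi h, dyadicAvg_zero hi]
  exact not_le.1 hc

theorem stopAvg_eq_self {E : Type*} [AddCommGroup E] [Module ℝ E] {φ : ℕ → E} {i : ℕ}
    (hi : i < 2 ^ n) (h : i ∉ stopSet n F lam) : stopAvg n F lam φ i = φ i := by
  rw [stopAvg, stopLevel_eq_zero hi h, dyadicAvg_zero hi]

theorem mem_stopSet_congr {i j : ℕ} (hi : i < 2 ^ n) (hj : j < 2 ^ n)
    (h : j / 2 ^ stopLevel n F lam i = i / 2 ^ stopLevel n F lam i) :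
    j ∈ stopSet n F lam ↔ i ∈ stopSet n F lam := by
  rw [mem_stopSet, mem_stopSet, stopAvg, stopAvg, stopLevel_congr h, dyadicAvg_congr h]
  simp [hi, hj]

theorem sum_stopSet_stopAvg :
    ∑ i ∈ stopSet n F lam, stopAvg n F lam F i = ∑ i ∈ stopSet n F lam, F i := by
  classical
  have key := sum_stopAvg (n := n) (F := F) (lam := lam) (φ := F)
    (w := fun i => if i ∈ stopSet n F lam then LinearMap.id else (0 : ℝ →ₗ[ℝ] ℝ))
    (fun i hi j hj h => by simp only [mem_stopSet_congr hi hj h])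
  have hs : stopSet n F lam ⊆ Finset.range (2 ^ n) := fun i hi =>
    Finset.mem_range.2 (mem_stopSet.1 hi).1
  have e : ∀ φ : ℕ → ℝ, ∑ i ∈ Finset.range (2 ^ n),
      (if i ∈ stopSet n F lam then LinearMap.id else (0 : ℝ →ₗ[ℝ] ℝ)) (φ i)
      = ∑ i ∈ stopSet n F lam, φ i := by
    intro φ
    rw [← Finset.inter_eq_right.2 hs, ← Finset.sum_ite_mem]
    refine Finset.sum_congr rfl fun i _ => ?_
    rw [Finset.inter_eq_right.2 hs]
    split_ifs <;> simp
  rw [e, e] at key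
  exact key

theorem lam_mul_card_stopSet_le :
    lam * (stopSet n F lam).card ≤ ∑ i ∈ stopSet n F lam, F i := by
  rw [← sum_stopSet_stopAvg, mul_comm, ← nsmul_eq_mul]
  exact Finset.card_nsmul_le_sum _ _ _ fun i hi => (mem_stopSet.1 hi).2.le

/-- The weak type estimate for the dyadic maximal function. -/
theorem card_stopSet_le (hF : ∀ i, 0 ≤ F i) (hlam : 0 < lam) :
    ((stopSet n F lam).card : ℝ) ≤
      2 / lam * ∑ i ∈ Finset.range (2 ^ n) with lam / 2 < F i, F i := by
  have h1 := lam_mul_card_stopSet_le (n := n) (F := F) (lam := lam)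
  -- Values of `F` below `lam / 2` contribute at most half of the lower bound `lam * card` and are
  -- absorbed; only the large values remain.
  have h2 : ∑ i ∈ stopSet n F lam, F i ≤
      (∑ i ∈ Finset.range (2 ^ n) with lam / 2 < F i, F i)
        + (stopSet n F lam).card * (lam / 2) := by
    rw [← Finset.sum_filter_add_sum_filter_not (stopSet n F lam) (fun i => lam / 2 < F i)]
    refine add_le_add ?_ ?_
    · refine Finset.sum_le_sum_of_subset_of_nonneg (fun i hi => ?_) fun i _ _ => hF i
      rw [Finset.mem_filter] at hi ⊢
      exact ⟨Finset.mem_range.2 (mem_stopSet.1 hi.1).1, hi.2⟩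
    · refine (Finset.sum_le_card_nsmul _ _ (lam / 2) fun i hi => ?_).trans ?_
      · exact not_lt.1 (Finset.mem_filter.1 hi).2
      · rw [nsmul_eq_mul]
        gcongr
        exact Finset.filter_subset _ _
  rw [div_mul_eq_mul_div, le_div_iff₀ hlam]
  nlinarith

/-- The parent of a stopping block has average at most `lam` by maximality of the level, and halving
a block at most doubles the average of a nonnegative function. The hypothesis `htop` covers the full
range, which has no parent. -/
theorem stopAvg_le (hF : ∀ i, 0 ≤ F i) (hlam : 0 < lam) (htop : dyadicAvg n F n 0 ≤ lam) {i : ℕ}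
    (hi : i < 2 ^ n) : stopAvg n F lam F i ≤ 2 * lam := by
  classical
  rw [stopAvg]
  rcases (stopLevel_le n F lam i).lt_or_eq with h | h
  · refine (dyadicAvg_le_two_mul hF _ _).trans (mul_le_mul_of_nonneg_left ?_ two_pos.le)
    exact not_lt.1 ((Nat.findGreatest_eq_iff.1 (rfl : stopLevel n F lam i = _)).2.2
      (Nat.lt_succ_self _) h)
  · rw [h, dyadicAvg_congr (j := i) (i := 0) (by rw [Nat.div_eq_of_lt hi, Nat.zero_div])]
    linarith

end Dyadic

end

/-! ### Weak type estimate for Toeplitz operators with Calderón–Zygmund entries. -/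

section
section Toeplitz

variable {X : Type*} [NormedAddCommGroup X] [NormedSpace ℂ X]

/-- The lower triangular Toeplitz operator with operator-valued entries `a`. -/
def toeplitz (a : ℕ → X →L[ℂ] X) (f : ℕ → X) (i : ℕ) : X :=
  ∑ j ∈ Finset.range (i + 1), a (i - j) (f j)

theorem toeplitz_add (a : ℕ → X →L[ℂ] X) (f g : ℕ → X) (i : ℕ) :
    toeplitz a (fun j => f j + g j) i = toeplitz a f i + toeplitz a g i := by
  simp [toeplitz, Finset.sum_add_distrib]

theorem norm_sub_le_of_step {a : ℕ → X →L[ℂ] X} {C : ℝ} (hC : 0 ≤ C) {N : ℕ}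
    (ha : ∀ m, m + 1 < N → ‖a (m + 1) - a m‖ ≤ C / (m + 1) ^ 2) (p q : ℕ) (h : p + q < N) :
    ‖a p - a (p + q)‖ ≤ q * (C / (p + 1) ^ 2) := by
  induction q with
  | zero => simp
  | succ q ih =>
    have h1 := ih (by omega)
    have h2 := ha (p + q) (by omega)
    have h3 : C / (((p + q : ℕ) : ℝ) + 1) ^ 2 ≤ C / (p + 1) ^ 2 := by
      gcongr
      linarith [(Nat.cast_nonneg q : (0 : ℝ) ≤ q)]
    calc ‖a p - a (p + (q + 1))‖ = ‖(a p - a (p + q)) - (a (p + q + 1) - a (p + q))‖ := by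
          rw [← add_assoc]; congr 1; abel
      _ ≤ _ := (norm_sub_le _ _).trans (add_le_add h1 (h2.trans h3))
      _ = _ := by push_cast; ring

/-- The shifted indices are distinct integers not below `L`, so this is a tail of `∑ k⁻²`. The
factor `1 / L` offsets the length of the block when the bad part is summed. -/
theorem sum_inv_sq_shift_le {L : ℕ} (hL : 0 < L) (c N : ℕ) :
    ∑ i ∈ Finset.range N with c + 2 * L ≤ i, (((i - c - L : ℕ) : ℝ) ^ 2)⁻¹ ≤ 2 / L := by
  have h := sum_Ioo_inv_sq_le (α := ℝ) (L - 1) N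
  have e : (((L - 1 : ℕ) : ℝ) + 1) = L := by
    rw [← Nat.cast_add_one, Nat.sub_add_cancel hL]
  rw [e] at h
  refine le_trans ?_ h
  rw [← Finset.sum_image (s := (Finset.range N).filter fun i => c + 2 * L ≤ i)
    (g := fun i => i - c - L) (f := fun k : ℕ => ((k : ℝ) ^ 2)⁻¹)]
  · refine Finset.sum_le_sum_of_subset_of_nonneg (fun k hk => ?_) fun _ _ _ => by positivity
    obtain ⟨i, hi, rfl⟩ := Finset.mem_image.1 hk
    rw [Finset.mem_filter, Finset.mem_range] at hi
    rw [Finset.mem_Ioo]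
    omega
  · intro i hi k hk hik
    simp only [Finset.coe_filter, Finset.mem_range, mem_ofPred_eq] at hi hk hik
    omega

variable {n : ℕ} {a : ℕ → X →L[ℂ] X} {C : ℝ} {f : ℕ → X} {lam : ℝ}

/-- The stopping blocks together with their right neighbours. -/
def stopSetStar (n : ℕ) (F : ℕ → ℝ) (lam : ℝ) : Finset ℕ :=
  stopSet n F lam ∪ (stopSet n F lam).image fun j => j + 2 ^ stopLevel n F lam j

theorem card_stopSetStar_le (n : ℕ) (F : ℕ → ℝ) (lam : ℝ) :
    (stopSetStar n F lam).card ≤ 2 * (stopSet n F lam).card := by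
  refine (Finset.card_union_le _ _).trans ?_
  have := Finset.card_image_le (s := stopSet n F lam) (f := fun j => j + 2 ^ stopLevel n F lam j)
  omega

/-- A point outside of the enlarged stopping blocks lies to the left of a given block or to the
right of its neighbour. -/
theorem lt_or_le_of_notMem_stopSetStar {F : ℕ → ℝ} {i j : ℕ} (hj : j ∈ stopSet n F lam)
    (hi : i < 2 ^ n) (hi' : i ∉ stopSetStar n F lam) :
    i < j / 2 ^ stopLevel n F lam j * 2 ^ stopLevel n F lam j ∨
      j / 2 ^ stopLevel n F lam j * 2 ^ stopLevel n F lam j + 2 * 2 ^ stopLevel n F lam j ≤ i := by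
  by_contra hcon
  push Not at hcon
  set L := 2 ^ stopLevel n F lam j with hL
  have hLp : 0 < L := by positivity
  have hjn := (mem_stopSet.1 hj).1
  apply hi'
  rw [stopSetStar, Finset.mem_union]
  by_cases h : i < j / L * L + L
  · left
    have : i / L = j / L := by
      rw [Nat.div_eq_iff hLp]; constructor <;> omega
    exact (mem_stopSet_congr hjn hi this).2 hj
  · right
    have h2 : (i - L) / L = j / L := by
      rw [Nat.div_eq_iff hLp]; constructor <;> omega
    have h3 := (mem_stopSet_congr hjn (by omega) h2).2 hj
    refine Finset.mem_image.2 ⟨i - L, h3, ?_⟩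
    rw [stopLevel_congr h2]
    omega

/-- The bad part of the Calderón–Zygmund decomposition. -/
theorem sum_toeplitz_bad_le (hC : 0 ≤ C)
    (ha : ∀ m, m + 1 < 2 ^ n → ‖a (m + 1) - a m‖ ≤ C / (m + 1) ^ 2) (F : ℕ → ℝ) :
    ∑ i ∈ Finset.range (2 ^ n) \ stopSetStar n F lam,
        ‖toeplitz a (fun j => f j - stopAvg n F lam f j) i‖
      ≤ 2 * C * ∑ j ∈ stopSet n F lam, ‖f j - stopAvg n F lam f j‖ := by
  classical
  set b : ℕ → X := fun j => f j - stopAvg n F lam f j with hb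
  set c : ℕ → ℕ := fun j => j / 2 ^ stopLevel n F lam j * 2 ^ stopLevel n F lam j with hc
  have hs : stopSet n F lam ⊆ Finset.range (2 ^ n) := fun i hi =>
    Finset.mem_range.2 (mem_stopSet.1 hi).1
  -- `c j` is the left end of the stopping block of `j`. The kernel vanishes to the left of the
  -- right neighbour's end: points to the left see nothing by triangularity, and nearer points on
  -- the right lie in the enlarged set.
  set κ : ℕ → ℕ → ℝ := fun i j => if c j + 2 * 2 ^ stopLevel n F lam j ≤ i then
    C * 2 ^ stopLevel n F lam j * (((i - c j - 2 ^ stopLevel n F lam j : ℕ) : ℝ) ^ 2)⁻¹ else 0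
    with hκ
  have hpt : ∀ i ∈ Finset.range (2 ^ n) \ stopSetStar n F lam,
      ‖toeplitz a b i‖ ≤ ∑ j ∈ stopSet n F lam, κ i j * ‖b j‖ := by
    intro i hi
    rw [Finset.mem_sdiff, Finset.mem_range] at hi
    -- The weights `a (i - c j)` are constant on stopping blocks, where the bad part has mean zero.
    -- They may therefore be subtracted from `a (i - j)`, which leaves a difference of entries over
    -- at most one block length.
    have h0 := sum_stopAvg (n := n) (F := F) (lam := lam) (φ := f)
      (w := fun j => if c j ≤ i then ((a (i - c j)).restrictScalars ℝ).toLinearMap else 0)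
      (fun j _ k _ h => by
        have : c k = c j := by simp only [hc]; rw [stopLevel_congr h, h]
        simp only [this])
    have h1 : toeplitz a b i = ∑ j ∈ Finset.range (2 ^ n),
        ((if j ≤ i then a (i - j) else 0) - (if c j ≤ i then a (i - c j) else 0)) (b j) := by
      have e1 : ∑ j ∈ Finset.range (2 ^ n), (if c j ≤ i then a (i - c j) else 0) (b j) = 0 := by
        rw [← sub_eq_zero, eq_comm] at h0
        rw [eq_comm, ← neg_eq_zero] at h0
        rw [← Finset.sum_sub_distrib, ← Finset.sum_neg_distrib] at h0
        rw [← h0]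
        refine Finset.sum_congr rfl fun j _ => ?_
        split_ifs <;> simp [hb]
      simp only [sub_apply]
      rw [Finset.sum_sub_distrib, e1, sub_zero, toeplitz]
      have e2 : Finset.range (i + 1) = (Finset.range (2 ^ n)).filter fun j => j ≤ i := by
        ext j; simp only [Finset.mem_range, Finset.mem_filter]; omega
      rw [e2, Finset.sum_filter]
      refine Finset.sum_congr rfl fun j _ => ?_
      split_ifs <;> simp
    rw [h1, ← Finset.sum_subset hs fun j hj hj' => by
      simp only [hb, stopAvg_eq_self (Finset.mem_range.1 hj) hj', sub_self, map_zero]]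
    refine (norm_sum_le _ _).trans (Finset.sum_le_sum fun j hj => ?_)
    refine (ContinuousLinearMap.le_opNorm _ _).trans
      (mul_le_mul_of_nonneg_right ?_ (norm_nonneg _))
    have hcj : c j ≤ j := Nat.div_mul_le_self _ _
    have hjc : j < c j + 2 ^ stopLevel n F lam j := by
      have := Nat.lt_div_mul_add (a := j) (b := 2 ^ stopLevel n F lam j) (by positivity)
      simpa [hc] using this
    rcases lt_or_le_of_notMem_stopSetStar hj hi.1 hi.2 with h | h
    · have h' : i < c j := h
      rw [if_neg (by omega), if_neg (by omega), sub_self, norm_zero]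
      simp only [hκ]
      rw [if_neg (by omega)]
    · have h' : c j + 2 * 2 ^ stopLevel n F lam j ≤ i := h
      rw [if_pos (by omega), if_pos (by omega)]
      simp only [hκ]
      rw [if_pos h']
      have e3 : i - c j = (i - j) + (j - c j) := by omega
      have h4 := norm_sub_le_of_step hC ha (i - j) (j - c j) (by omega)
      rw [← e3] at h4
      refine h4.trans ?_
      have h5 : ((j - c j : ℕ) : ℝ) ≤ 2 ^ stopLevel n F lam j := by
        have : j - c j ≤ 2 ^ stopLevel n F lam j := by omega
        exact_mod_cast this
      have h6 : ((i - c j - 2 ^ stopLevel n F lam j : ℕ) : ℝ) ≤ ((i - j : ℕ) : ℝ) + 1 := by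
        have : i - c j - 2 ^ stopLevel n F lam j ≤ i - j + 1 := by omega
        exact_mod_cast this
      have h7 : (0 : ℝ) < ((i - c j - 2 ^ stopLevel n F lam j : ℕ) : ℝ) := by
        have : 0 < 2 ^ stopLevel n F lam j := by positivity
        have : 0 < i - c j - 2 ^ stopLevel n F lam j := by omega
        exact_mod_cast this
      rw [mul_comm C, mul_assoc, ← div_eq_mul_inv]
      gcongr
  refine (Finset.sum_le_sum hpt).trans ?_
  rw [Finset.sum_comm, Finset.mul_sum]
  refine Finset.sum_le_sum fun j _ => ?_
  rw [← Finset.sum_mul]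
  refine mul_le_mul_of_nonneg_right ?_ (norm_nonneg _)
  have hκ0 : ∀ i, 0 ≤ κ i j := by
    intro i; simp only [hκ]; split_ifs <;> positivity
  refine (Finset.sum_le_sum_of_subset_of_nonneg Finset.sdiff_subset fun i _ _ => hκ0 i).trans ?_
  simp only [hκ]
  rw [← Finset.sum_filter, ← Finset.mul_sum]
  have hL : 0 < 2 ^ stopLevel n F lam j := by positivity
  have := sum_inv_sq_shift_le hL (c j) (2 ^ n)
  refine (mul_le_mul_of_nonneg_left this (by positivity)).trans (le_of_eq ?_)
  push_cast
  field_simp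

/-- The distributional inequality behind the extrapolation of Toeplitz operators. -/
theorem toeplitz_distribution (hC : 0 ≤ C) {s K : ℝ} (hs : 1 < s) (hK : 0 ≤ K)
    (ha : ∀ m, m + 1 < 2 ^ n → ‖a (m + 1) - a m‖ ≤ C / (m + 1) ^ 2)
    (hT : ∀ g : ℕ → X, ∑ i ∈ Finset.range (2 ^ n), ‖toeplitz a g i‖ ^ s
      ≤ K * ∑ i ∈ Finset.range (2 ^ n), ‖g i‖ ^ s) (f : ℕ → X) (hlam : 0 < lam) :
    (((Finset.range (2 ^ n)).filter fun i => 2 * lam < ‖toeplitz a f i‖).card : ℝ) ≤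
      2 * (2 + 8 * C + K * 2 ^ s) / lam *
          ∑ i ∈ Finset.range (2 ^ n) with lam / 2 < ‖f i‖, ‖f i‖
        + K / lam ^ s * ∑ i ∈ Finset.range (2 ^ n) with ‖f i‖ ≤ lam, ‖f i‖ ^ s := by
  classical
  set F : ℕ → ℝ := fun i => ‖f i‖ with hFdef
  have hF : ∀ i, 0 ≤ F i := fun i => norm_nonneg _
  set Ω := stopSet n F lam with hΩ
  have hΩs : Ω ⊆ Finset.range (2 ^ n) := fun i hi => Finset.mem_range.2 (mem_stopSet.1 hi).1
  have hΩc := card_stopSet_le (n := n) hF hlam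
  set S := ∑ i ∈ Finset.range (2 ^ n) with ‖f i‖ ≤ lam, ‖f i‖ ^ s with hS
  have hS0 : 0 ≤ S := Finset.sum_nonneg fun i _ => by positivity
  -- It remains to count against the stopping set; `card_stopSet_le` then converts its size into the
  -- sum over the large values of `f`.
  suffices hmain : (((Finset.range (2 ^ n)).filter fun i => 2 * lam < ‖toeplitz a f i‖).card : ℝ) ≤
      (2 + 8 * C + K * 2 ^ s) * Ω.card + K / lam ^ s * S by
    refine hmain.trans (add_le_add_left ?_ _)
    refine (mul_le_mul_of_nonneg_left hΩc (by positivity)).trans (le_of_eq ?_)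
    ring
  -- If even the total average exceeds `lam`, the stopping set is the whole range and the trivial
  -- count suffices.
  by_cases htop : dyadicAvg n F n 0 ≤ lam
  swap
  · have hall : Ω = Finset.range (2 ^ n) := by
      refine Finset.Subset.antisymm hΩs fun i hi => ?_
      by_contra hcon
      have hi' := Finset.mem_range.1 hi
      have h0 := stopLevel_eq_zero hi' hcon
      have h1 := (Nat.findGreatest_eq_iff.1 (rfl : stopLevel n F lam i = _)).2.2
      rcases Nat.eq_zero_or_pos n with hn | hn
      · subst hn
        refine hcon (mem_stopSet.2 ⟨hi', ?_⟩)
        rw [stopAvg, h0]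
        have : i = 0 := by simpa using hi'
        rw [this]
        exact not_le.1 htop
      · refine h1 (n := n) ?_ le_rfl ?_
        · rw [h0]; exact hn
        · rw [dyadicAvg_congr (j := i) (i := 0) (by rw [Nat.div_eq_of_lt hi', Nat.zero_div])]
          exact not_le.1 htop
    have h1 : (((Finset.range (2 ^ n)).filter fun i => 2 * lam < ‖toeplitz a f i‖).card : ℝ)
        ≤ Ω.card := by
      rw [hall]
      exact_mod_cast Finset.card_filter_le _ _
    have h2 : (0 : ℝ) ≤ (1 + 8 * C + K * 2 ^ s) * Ω.card := by positivity
    have h3 : 0 ≤ K / lam ^ s * S := by positivity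
    linarith
  set g : ℕ → X := stopAvg n F lam f with hg
  set b : ℕ → X := fun j => f j - g j with hb
  have hgle : ∀ i, ‖g i‖ ≤ stopAvg n F lam F i := fun i => norm_dyadicAvg_le _ _ _ _
  have hg2 : ∀ i < 2 ^ n, ‖g i‖ ≤ 2 * lam := fun i hi => (hgle i).trans (stopAvg_le hF hlam htop hi)
  have hΩF : ∑ i ∈ Ω, F i ≤ 2 * lam * Ω.card := by
    rw [← sum_stopSet_stopAvg, mul_comm, ← nsmul_eq_mul]
    exact Finset.sum_le_card_nsmul _ _ _ fun i hi => stopAvg_le hF hlam htop (mem_stopSet.1 hi).1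
  -- Chebyshev in `ℓ^s` for the good part: it equals `f`, of size at most `lam`, off the stopping
  -- set, and has size at most `2 * lam` on it.
  have hgood : (((Finset.range (2 ^ n)).filter fun i => lam < ‖toeplitz a g i‖).card : ℝ)
      ≤ K / lam ^ s * S + K * 2 ^ s * Ω.card := by
    have h1 : lam ^ s * ((Finset.range (2 ^ n)).filter fun i => lam < ‖toeplitz a g i‖).card
        ≤ ∑ i ∈ Finset.range (2 ^ n), ‖toeplitz a g i‖ ^ s := by
      rw [mul_comm, ← nsmul_eq_mul]
      refine (Finset.card_nsmul_le_sum _ (fun i => ‖toeplitz a g i‖ ^ s) _ fun i hi => ?_).trans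
        (Finset.sum_le_sum_of_subset_of_nonneg (Finset.filter_subset _ _)
          fun i _ _ => by positivity)
      exact Real.rpow_le_rpow hlam.le (Finset.mem_filter.1 hi).2.le (by linarith)
    have h2 : ∑ i ∈ Finset.range (2 ^ n), ‖g i‖ ^ s ≤ S + Ω.card * (2 * lam) ^ s := by
      rw [← Finset.sum_sdiff hΩs]
      refine add_le_add ?_ ?_
      · have h3 : ∀ i ∈ Finset.range (2 ^ n) \ Ω, ‖g i‖ ^ s = ‖f i‖ ^ s := fun i hi => by
          rw [Finset.mem_sdiff, Finset.mem_range] at hi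
          rw [hg, stopAvg_eq_self hi.1 hi.2]
        rw [Finset.sum_congr rfl h3]
        refine Finset.sum_le_sum_of_subset_of_nonneg (fun i hi => ?_) fun i _ _ => by positivity
        rw [Finset.mem_sdiff] at hi
        exact Finset.mem_filter.2 ⟨hi.1, le_of_notMem_stopSet (Finset.mem_range.1 hi.1) hi.2⟩
      · rw [← nsmul_eq_mul]
        refine Finset.sum_le_card_nsmul _ _ _ fun i hi => ?_
        exact Real.rpow_le_rpow (norm_nonneg _) (hg2 i (mem_stopSet.1 hi).1) (by linarith)
    have h4 : (0 : ℝ) < lam ^ s := by positivity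
    have h5 := h1.trans ((hT g).trans (mul_le_mul_of_nonneg_left h2 hK))
    rw [← le_div_iff₀' h4] at h5
    refine h5.trans (le_of_eq ?_)
    rw [Real.mul_rpow two_pos.le hlam.le]
    field_simp
  -- Chebyshev in `ℓ¹` off the enlarged blocks. The bad part has `ℓ¹` norm at most `4 * lam *
  -- Ω.card`, and `sum_toeplitz_bad_le` contributes the factor `2 * C`.
  have hbad : (((Finset.range (2 ^ n) \ stopSetStar n F lam).filter
      fun i => lam < ‖toeplitz a b i‖).card : ℝ) ≤ 8 * C * Ω.card := by
    have h1 := sum_toeplitz_bad_le (f := f) (lam := lam) hC ha F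
    have h2 : ∑ j ∈ Ω, ‖b j‖ ≤ 4 * lam * Ω.card := by
      calc ∑ j ∈ Ω, ‖b j‖ ≤ ∑ j ∈ Ω, (F j + stopAvg n F lam F j) :=
            Finset.sum_le_sum fun j _ => (norm_sub_le _ _).trans (add_le_add_right (hgle j) _)
        _ = 2 * ∑ j ∈ Ω, F j := by rw [Finset.sum_add_distrib, sum_stopSet_stopAvg]; ring
        _ ≤ _ := by linarith
    have h3 : lam * ((Finset.range (2 ^ n) \ stopSetStar n F lam).filter
        fun i => lam < ‖toeplitz a b i‖).card
        ≤ ∑ i ∈ Finset.range (2 ^ n) \ stopSetStar n F lam, ‖toeplitz a b i‖ := by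
      rw [mul_comm, ← nsmul_eq_mul]
      refine (Finset.card_nsmul_le_sum _ (fun i => ‖toeplitz a b i‖) _ fun i hi => ?_).trans
        (Finset.sum_le_sum_of_subset_of_nonneg (Finset.filter_subset _ _)
          fun i _ _ => by positivity)
      exact (Finset.mem_filter.1 hi).2.le
    have h4 := h3.trans (h1.trans (mul_le_mul_of_nonneg_left h2 (by positivity)))
    rw [← le_div_iff₀' hlam] at h4
    refine h4.trans (le_of_eq ?_)
    field_simp
    ring
  have hcover : (Finset.range (2 ^ n)).filter (fun i => 2 * lam < ‖toeplitz a f i‖) ⊆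
      stopSetStar n F lam ∪ ((Finset.range (2 ^ n)).filter (fun i => lam < ‖toeplitz a g i‖) ∪
        (Finset.range (2 ^ n) \ stopSetStar n F lam).filter fun i => lam < ‖toeplitz a b i‖) := by
    intro i hi
    rw [Finset.mem_filter] at hi
    by_cases h1 : i ∈ stopSetStar n F lam
    · exact Finset.mem_union_left _ h1
    refine Finset.mem_union_right _ ?_
    by_cases h2 : lam < ‖toeplitz a g i‖
    · exact Finset.mem_union_left _ (Finset.mem_filter.2 ⟨hi.1, h2⟩)
    refine Finset.mem_union_right _ (Finset.mem_filter.2 ⟨Finset.mem_sdiff.2 ⟨hi.1, h1⟩, ?_⟩)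
    have h3 : toeplitz a f i = toeplitz a g i + toeplitz a b i := by
      rw [← toeplitz_add]; congr 1; ext j; simp [hb]
    have h4 := norm_add_le (toeplitz a g i) (toeplitz a b i)
    rw [← h3] at h4
    linarith [hi.2]
  have hcard : (((Finset.range (2 ^ n)).filter fun i => 2 * lam < ‖toeplitz a f i‖).card : ℝ)
      ≤ (stopSetStar n F lam).card + (((Finset.range (2 ^ n)).filter
          (fun i => lam < ‖toeplitz a g i‖)).card + ((Finset.range (2 ^ n) \ stopSetStar n F lam).filter
        fun i => lam < ‖toeplitz a b i‖).card) := by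
    exact_mod_cast (Finset.card_le_card hcover).trans ((Finset.card_union_le _ _).trans
      (add_le_add_right (Finset.card_union_le _ _) _))
  have hstar : ((stopSetStar n F lam).card : ℝ) ≤ 2 * Ω.card := by
    exact_mod_cast card_stopSetStar_le n F lam
  linarith

end Toeplitz

end

/-! ### Marcinkiewicz interpolation by the layer cake formula. -/

section
section LayerCake

theorem integral_indicator_Ioo_rpow {p c : ℝ} (hp : -1 < p) (hc : 0 ≤ c) :
    Integrable ((Ioo 0 c).indicator fun x : ℝ => x ^ p) ∧
      ∫ x, (Ioo 0 c).indicator (fun x : ℝ => x ^ p) x = c ^ (p + 1) / (p + 1) := by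
  have h := intervalIntegral.intervalIntegrable_rpow' (a := 0) (b := c) hp
  rw [intervalIntegrable_iff_integrableOn_Ioo_of_le hc] at h
  refine ⟨h.integrable_indicator measurableSet_Ioo, ?_⟩
  rw [integral_indicator measurableSet_Ioo, ← integral_Ioc_eq_integral_Ioo,
    ← intervalIntegral.integral_of_le hc, integral_rpow (Or.inl hp),
    Real.zero_rpow (by linarith), sub_zero]

theorem integral_indicator_Ioi_rpow {p c : ℝ} (hp : p < -1) (hc : 0 < c) :
    Integrable ((Ici c).indicator fun x : ℝ => x ^ p) ∧
      ∫ x, (Ici c).indicator (fun x : ℝ => x ^ p) x = -c ^ (p + 1) / (p + 1) := by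
  have h := integrableOn_Ioi_rpow_of_lt hp hc
  refine ⟨((integrableOn_Ici_iff_integrableOn_Ioi).2 h).integrable_indicator measurableSet_Ici, ?_⟩
  rw [integral_indicator measurableSet_Ici, integral_Ici_eq_integral_Ioi,
    integral_Ioi_rpow_of_lt hp hc]

/-- Integrating a distributional inequality. -/
theorem sum_rpow_le_of_distribution {I : Finset ℕ} {y F : ℕ → ℝ} {r s A B : ℝ} (hr : 1 < r)
    (hrs : r < s) (hy : ∀ i, 0 ≤ y i) (hF : ∀ i, 0 ≤ F i) (hA : 0 ≤ A) (hB : 0 ≤ B)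
    (h : ∀ lam : ℝ, 0 < lam → ((I.filter fun i => 2 * lam < y i).card : ℝ) ≤
      A / lam * (∑ i ∈ I with lam / 2 < F i, F i)
        + B / lam ^ s * ∑ i ∈ I with F i ≤ lam, F i ^ s) :
    ∑ i ∈ I, y i ^ r ≤
      r * 2 ^ r * (A * 2 ^ (r - 1) / (r - 1) + B / (s - r)) * ∑ i ∈ I, F i ^ r := by
  -- The three sums of the hypothesis, multiplied by `lam ^ (r - 1)` and split into single terms, as
  -- functions of `lam`. Integrability of `f2` at zero uses `1 < r`, that of `f3` at infinity uses
  -- `r < s`.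
  set f1 : ℕ → ℝ → ℝ := fun i => (Ioo 0 (y i / 2)).indicator fun x : ℝ => x ^ (r - 1) with hf1
  set f2 : ℕ → ℝ → ℝ := fun i x => A * F i *
    (Ioo 0 (2 * F i)).indicator (fun x : ℝ => x ^ (r - 2)) x with hf2
  -- Terms with `F i = 0` are removed by hand, because the pure power on `[0, ∞)` is not integrable.
  set f3 : ℕ → ℝ → ℝ := fun i x => if F i = 0 then 0 else
    B * F i ^ s * (Ici (F i)).indicator (fun x : ℝ => x ^ (r - 1 - s)) x with hf3
  have i1 := fun i => integral_indicator_Ioo_rpow (p := r - 1) (c := y i / 2) (by linarith)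
    (by linarith [hy i])
  have i2 := fun i => integral_indicator_Ioo_rpow (p := r - 2) (c := 2 * F i) (by linarith)
    (by linarith [hF i])
  have I1 : ∀ i, Integrable (f1 i) := fun i => (i1 i).1
  have I2 : ∀ i, Integrable (f2 i) := fun i => (i2 i).1.const_mul _
  have E1 : ∀ i, ∫ x, f1 i x = y i ^ r / (2 ^ r * r) := by
    intro i
    simp only [hf1]
    rw [(i1 i).2, sub_add_cancel, Real.div_rpow (hy i) two_pos.le, div_div]
  have E2 : ∀ i, ∫ x, f2 i x = A * 2 ^ (r - 1) / (r - 1) * F i ^ r := by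
    intro i
    simp only [hf2]
    rw [integral_const_mul, (i2 i).2, show r - 2 + 1 = r - 1 by ring,
      Real.mul_rpow two_pos.le (hF i)]
    rcases (hF i).eq_or_lt with h0 | h0
    · rw [← h0, Real.zero_rpow (by linarith : r ≠ 0)]; simp
    · rw [show F i ^ r = F i * F i ^ (r - 1) by
        rw [← Real.rpow_one_add' (hF i) (by linarith)]; congr 1; ring]
      ring
  have IE3 : ∀ i, Integrable (f3 i) ∧ ∫ x, f3 i x = B / (s - r) * F i ^ r := by
    intro i
    by_cases h0 : F i = 0
    · simp only [hf3, h0, if_true]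
      rw [Real.zero_rpow (by linarith : r ≠ 0)]
      simp
    · have hpos : 0 < F i := lt_of_le_of_ne (hF i) (Ne.symm h0)
      have := integral_indicator_Ioi_rpow (p := r - 1 - s) (c := F i) (by linarith) hpos
      simp only [hf3, h0, if_false]
      refine ⟨this.1.const_mul _, ?_⟩
      rw [integral_const_mul, this.2, show r - 1 - s + 1 = r - s by ring,
        show F i ^ r = F i ^ s * F i ^ (r - s) by
          rw [← Real.rpow_add hpos]; congr 1; ring]
      have h1 : s - r ≠ 0 := by linarith
      have h2 : r - s ≠ 0 := by linarith
      field_simp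
      ring
  have hpt : ∀ x, ∑ i ∈ I, f1 i x ≤ (∑ i ∈ I, f2 i x) + ∑ i ∈ I, f3 i x := by
    intro x
    have h20 : ∀ i, 0 ≤ f2 i x := fun i => by
      simp only [hf2]
      refine mul_nonneg (mul_nonneg hA (hF i)) (indicator_nonneg (fun z hz => ?_) _)
      exact Real.rpow_nonneg hz.1.le _
    have h30 : ∀ i, 0 ≤ f3 i x := fun i => by
      simp only [hf3]
      split_ifs
      · exact le_rfl
      · refine mul_nonneg (mul_nonneg hB (Real.rpow_nonneg (hF i) _))
          (indicator_nonneg (fun z hz => ?_) _)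
        exact Real.rpow_nonneg ((hF i).trans hz) _
    rcases le_or_gt x 0 with hx | hx
    · have : ∀ i, f1 i x = 0 := fun i =>
        indicator_of_notMem (fun hm : x ∈ Ioo 0 (y i / 2) => absurd hm.1 (not_lt.2 hx)) _
      simp only [this, Finset.sum_const_zero]
      exact add_nonneg (Finset.sum_nonneg fun i _ => h20 i) (Finset.sum_nonneg fun i _ => h30 i)
    have hp : 0 ≤ x ^ (r - 1) := Real.rpow_nonneg hx.le _
    have e1 : ∑ i ∈ I, f1 i x = x ^ (r - 1) * ((I.filter fun i => 2 * x < y i).card : ℝ) := by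
      rw [mul_comm, ← nsmul_eq_mul, ← Finset.sum_const, Finset.sum_filter]
      refine Finset.sum_congr rfl fun i _ => ?_
      by_cases hi : 2 * x < y i
      · rw [if_pos hi]; exact indicator_of_mem (show x ∈ Ioo 0 (y i / 2) from ⟨hx, by linarith⟩) _
      · rw [if_neg hi]; exact indicator_of_notMem (fun hm => hi (by linarith [hm.2])) _
    have e2 : x ^ (r - 1) * (A / x * ∑ i ∈ I with x / 2 < F i, F i) = ∑ i ∈ I, f2 i x := by
      rw [Finset.sum_filter, Finset.mul_sum, Finset.mul_sum]
      refine Finset.sum_congr rfl fun i _ => ?_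
      by_cases hi : x / 2 < F i
      · rw [if_pos hi]
        simp only [hf2]
        rw [indicator_of_mem (show x ∈ Ioo 0 (2 * F i) from ⟨hx, by linarith⟩),
          show r - 1 = r - 2 + 1 by ring, Real.rpow_add_one hx.ne']
        field_simp
      · rw [if_neg hi]
        simp only [hf2]
        rw [indicator_of_notMem (fun hm => hi (by linarith [hm.2]))]
        ring
    have e3 : x ^ (r - 1) * (B / x ^ s * ∑ i ∈ I with F i ≤ x, F i ^ s) = ∑ i ∈ I, f3 i x := by
      rw [Finset.sum_filter, Finset.mul_sum, Finset.mul_sum]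
      refine Finset.sum_congr rfl fun i _ => ?_
      simp only [hf3]
      by_cases h0 : F i = 0
      · rw [if_pos h0, h0, Real.zero_rpow (by linarith : s ≠ 0)]; simp
      rw [if_neg h0]
      by_cases hi : F i ≤ x
      · rw [if_pos hi, indicator_of_mem (show x ∈ Ici (F i) from hi), Real.rpow_sub hx (r - 1) s]
        ring
      · rw [if_neg hi, indicator_of_notMem (show x ∉ Ici (F i) from hi)]
        ring
    rw [e1, ← e2, ← e3, ← mul_add]
    exact mul_le_mul_of_nonneg_left (h x hx) hp
  have hint := integral_mono (μ := volume) (integrable_finsetSum I fun i _ => I1 i)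
    ((integrable_finsetSum I fun i _ => I2 i).add
      (integrable_finsetSum I fun i _ => (IE3 i).1)) (fun x => hpt x)
  have hadd := integral_add (μ := volume) (integrable_finsetSum I fun i _ => I2 i)
      (integrable_finsetSum I fun i _ => (IE3 i).1)
  simp only [Pi.add_apply] at hint
  rw [hadd, integral_finsetSum I fun i _ => I1 i, integral_finsetSum I fun i _ => I2 i,
    integral_finsetSum I fun i _ => (IE3 i).1] at hint
  simp only [E1, E2, (IE3 _).2] at hint
  rw [← Finset.sum_div, ← Finset.mul_sum, ← Finset.mul_sum, ← add_mul,
    div_le_iff₀ (by positivity)] at hint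
  linarith

end LayerCake

/-! ### Toeplitz bounds for smaller exponents. -/

section Toeplitz

variable {X : Type*} [NormedAddCommGroup X] [NormedSpace ℂ X]

/-- The Toeplitz operator with entries `a` is bounded by `K ^ (1 / s)` on `ℓ^s`. -/
def ToeplitzBound (s K : ℝ) (N : ℕ) (a : ℕ → X →L[ℂ] X) : Prop :=
  ∀ f : ℕ → X, ∑ i ∈ Finset.range N, ‖toeplitz a f i‖ ^ s ≤ K * ∑ i ∈ Finset.range N, ‖f i‖ ^ s

/-- Toeplitz operators with Calderón–Zygmund entries that are bounded on `ℓ^s` are bounded on `ℓ^r`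
for `1 < r < s`, uniformly in the size. -/
theorem exists_toeplitzBound_of_lt {r s C K : ℝ} (hr : 1 < r) (hrs : r < s) (hC : 0 ≤ C)
    (hK : 0 ≤ K) : ∃ K' : ℝ, 0 ≤ K' ∧ ∀ (n : ℕ) (a : ℕ → X →L[ℂ] X),
      (∀ m, m + 1 < 2 ^ n → ‖a (m + 1) - a m‖ ≤ C / (m + 1) ^ 2) →
      ToeplitzBound s K (2 ^ n) a → ToeplitzBound r K' (2 ^ n) a := by
  have h1 : 0 < r - 1 := by linarith
  have h2 : 0 < s - r := by linarith
  refine ⟨_, ?_, fun n a ha hT f => sum_rpow_le_of_distribution hr hrs (fun i => norm_nonneg _)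
    (fun i => norm_nonneg _) (A := 2 * (2 + 8 * C + K * 2 ^ s)) (B := K) (by positivity) hK
    fun lam hlam => toeplitz_distribution hC (hr.trans hrs) hK ha hT f hlam⟩
  positivity

end Toeplitz

end

/-! ### Toeplitz bounds for larger exponents, by duality. -/

section
section Duality

variable {X Z : Type*} [NormedAddCommGroup X] [NormedSpace ℂ X]
  [NormedAddCommGroup Z] [NormedSpace ℂ Z]

/-- The transpose of a lower triangular Toeplitz matrix is upper triangular; reversing the order of
the indices makes it lower triangular again. This is why both sides carry the reflection `N - 1 -
i`. -/
theorem sum_pairing_toeplitz {a : ℕ → X →L[ℂ] X} {b : ℕ → Z →L[ℂ] Z}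
    {B : X →L[ℂ] Z →L[ℂ] ℂ} (hab : ∀ m x z, B (a m x) z = B x (b m z)) (N : ℕ) (f : ℕ → X)
    (g : ℕ → Z) :
    ∑ i ∈ Finset.range N, B (f (N - 1 - i)) (toeplitz b g i)
      = ∑ j ∈ Finset.range N, B (toeplitz a f (N - 1 - j)) (g j) := by
  have e1 : ∀ i ∈ Finset.range N, B (f (N - 1 - i)) (toeplitz b g i)
      = ∑ j ∈ Finset.range N, if j ≤ i then B (a (i - j) (f (N - 1 - i))) (g j) else 0 := by
    intro i hi
    rw [Finset.mem_range] at hi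
    rw [toeplitz, map_sum, ← Finset.sum_filter]
    have : Finset.range (i + 1) = (Finset.range N).filter fun j => j ≤ i := by
      ext j; simp only [Finset.mem_range, Finset.mem_filter]; omega
    rw [this]
    exact Finset.sum_congr rfl fun j _ => (hab _ _ _).symm
  rw [Finset.sum_congr rfl e1, Finset.sum_comm]
  refine Finset.sum_congr rfl fun j hj => ?_
  rw [Finset.mem_range] at hj
  rw [toeplitz, map_sum, sum_apply, ← Finset.sum_filter]
  refine Finset.sum_bij' (fun i _ => N - 1 - i) (fun k _ => N - 1 - k) ?_ ?_ ?_ ?_ ?_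
  · intro i hi
    simp only [Finset.mem_filter, Finset.mem_range] at hi ⊢
    omega
  · intro k hk
    simp only [Finset.mem_filter, Finset.mem_range] at hk ⊢
    omega
  · intro i hi
    simp only [Finset.mem_filter, Finset.mem_range] at hi
    omega
  · intro k hk
    simp only [Finset.mem_range] at hk
    omega
  · intro i hi
    simp only [Finset.mem_filter, Finset.mem_range] at hi
    have : N - 1 - j - (N - 1 - i) = i - j := by omega
    rw [this]

/-- The transposed Toeplitz operator is bounded on the dual sequence space. -/
theorem ToeplitzBound.dual {a : ℕ → X →L[ℂ] X} {b : ℕ → Z →L[ℂ] Z}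
    {B : X →L[ℂ] Z →L[ℂ] ℂ} (hab : ∀ m x z, B (a m x) z = B x (b m z))
    (hB : ∀ x z, ‖B x z‖ ≤ ‖x‖ * ‖z‖) (hB' : ∀ z, ∃ x, ‖x‖ ≤ 1 ∧ ‖z‖ / 2 ≤ (B x z).re)
    {s s' K : ℝ} (hs : s.HolderConjugate s') (hK : 0 ≤ K) {N : ℕ} (h : ToeplitzBound s K N a) :
    ToeplitzBound s' ((2 * K ^ (1 / s)) ^ s') N b := by
  intro g
  choose x hx1 hx2 using hB'
  set t : ℕ → ℝ := fun i => ‖toeplitz b g i‖ with ht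
  have ht0 : ∀ i, 0 ≤ t i := fun i => norm_nonneg _
  -- The extremal sequence for Hölder's inequality: almost norming vectors weighted by the power `s'
  -- - 1`, so that `(s' - 1) * s = s'`. The factor `2` in the constant arises because the vectors
  -- norm only up to one half.
  set f : ℕ → X := fun k => ((t (N - 1 - k) ^ (s' - 1) : ℝ) : ℂ) • x (toeplitz b g (N - 1 - k))
    with hf
  set S := ∑ i ∈ Finset.range N, t i ^ s' with hS
  set G := ∑ i ∈ Finset.range N, ‖g i‖ ^ s' with hG
  have hS0 : 0 ≤ S := Finset.sum_nonneg fun i _ => Real.rpow_nonneg (ht0 i) _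
  have hG0 : 0 ≤ G := Finset.sum_nonneg fun i _ => Real.rpow_nonneg (norm_nonneg _) _
  have hs1 := hs.lt
  have hs1' := hs.symm.lt
  have hfS : ∑ k ∈ Finset.range N, ‖f k‖ ^ s ≤ S := by
    rw [hS, ← Finset.sum_range_reflect (fun i => t i ^ s')]
    refine Finset.sum_le_sum fun k _ => ?_
    have h1 : ‖f k‖ ≤ t (N - 1 - k) ^ (s' - 1) := by
      rw [hf, norm_smul, Complex.norm_real, Real.norm_of_nonneg (Real.rpow_nonneg (ht0 _) _)]
      exact mul_le_of_le_one_right (Real.rpow_nonneg (ht0 _) _) (hx1 _)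
    refine (Real.rpow_le_rpow (norm_nonneg _) h1 (by linarith)).trans (le_of_eq ?_)
    rw [← Real.rpow_mul (ht0 _), hs.symm.sub_one_mul_conj]
  have hlow : S / 2 ≤ (∑ i ∈ Finset.range N, B (f (N - 1 - i)) (toeplitz b g i)).re := by
    rw [Complex.re_sum, hS, Finset.sum_div]
    refine Finset.sum_le_sum fun i hi => ?_
    rw [Finset.mem_range] at hi
    have e : N - 1 - (N - 1 - i) = i := by omega
    simp only [hf, e, map_smul, smul_apply, smul_eq_mul, Complex.re_ofReal_mul]
    have h1 := mul_le_mul_of_nonneg_left (hx2 (toeplitz b g i)) (Real.rpow_nonneg (ht0 i) (s' - 1))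
    refine le_trans (le_of_eq ?_) h1
    have h2 : t i ^ s' = t i ^ (s' - 1) * t i := by
      rw [← Real.rpow_add_one' (ht0 i) (by linarith)]; congr 1; ring
    rw [h2]; ring
  rw [sum_pairing_toeplitz hab] at hlow
  have hup : (∑ j ∈ Finset.range N, B (toeplitz a f (N - 1 - j)) (g j)).re
      ≤ (K * S) ^ (1 / s) * G ^ (1 / s') := by
    calc (∑ j ∈ Finset.range N, B (toeplitz a f (N - 1 - j)) (g j)).re
        ≤ ∑ j ∈ Finset.range N, ‖toeplitz a f (N - 1 - j)‖ * ‖g j‖ := by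
          refine (Complex.re_le_norm _).trans ((norm_sum_le _ _).trans ?_)
          exact Finset.sum_le_sum fun j _ => hB _ _
      _ ≤ (∑ j ∈ Finset.range N, ‖toeplitz a f (N - 1 - j)‖ ^ s) ^ (1 / s) * G ^ (1 / s') :=
          Real.inner_le_Lp_mul_Lq_of_nonneg _ hs (fun _ _ => norm_nonneg _)
            (fun _ _ => norm_nonneg _)
      _ ≤ _ := by
          refine mul_le_mul_of_nonneg_right (Real.rpow_le_rpow ?_ ?_ ?_) (Real.rpow_nonneg hG0 _)
          · exact Finset.sum_nonneg fun i _ => Real.rpow_nonneg (norm_nonneg _) _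
          · rw [Finset.sum_range_reflect (fun i => ‖toeplitz a f i‖ ^ s)]
            exact (h f).trans (mul_le_mul_of_nonneg_left hfS hK)
          · have := hs.pos
            positivity
  have hfin := hlow.trans hup
  change S ≤ _ * G
  rcases hS0.eq_or_lt with h0 | h0
  · rw [← h0]
    positivity
  rw [Real.mul_rpow hK hS0] at hfin
  have h1 : S = S ^ (1 / s) * S ^ (1 / s') := by
    rw [← Real.rpow_add h0, one_div, one_div, hs.inv_add_inv_eq_one, Real.rpow_one]
  have h2 : S ^ (1 / s') ≤ 2 * K ^ (1 / s) * G ^ (1 / s') := by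
    have h3 : 0 < S ^ (1 / s) := Real.rpow_pos_of_pos h0 _
    refine le_of_mul_le_mul_left ?_ h3
    rw [← h1]
    linarith
  have hs0 := hs.symm.pos
  have h4 := Real.rpow_le_rpow (Real.rpow_nonneg hS0 _) h2 hs0.le
  rw [Real.mul_rpow (by positivity) (Real.rpow_nonneg hG0 _), ← Real.rpow_mul hS0,
    ← Real.rpow_mul hG0, one_div_mul_cancel hs0.ne', Real.rpow_one, Real.rpow_one] at h4
  exact h4

/-- The norm of a functional need not be attained, so half of it is kept; rotating by the conjugate
phase makes the value real. -/
theorem exists_re_apply_ge (φ : StrongDual ℂ X) : ∃ x : X, ‖x‖ ≤ 1 ∧ ‖φ‖ / 2 ≤ (φ x).re := by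
  rcases (norm_nonneg φ).eq_or_lt with h0 | h0
  · exact ⟨0, by simp, by simp [← h0]⟩
  obtain ⟨x, hx, hφ⟩ := φ.exists_lt_apply_of_lt_opNorm (half_lt_self h0)
  have hne : φ x ≠ 0 := fun h => by rw [h, norm_zero] at hφ; linarith
  refine ⟨((starRingEnd ℂ (φ x)) / (‖φ x‖ : ℂ)) • x, ?_, ?_⟩
  · rw [norm_smul, norm_div, RCLike.norm_conj, Complex.norm_real, norm_norm,
      div_self (norm_ne_zero_iff.2 hne), one_mul]
    exact hx.le
  · rw [map_smul, smul_eq_mul, div_mul_eq_mul_div, mul_comm, Complex.mul_conj,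
      Complex.normSq_eq_norm_sq, ← Complex.ofReal_div, Complex.ofReal_re, sq,
      mul_div_cancel_right₀ _ (norm_ne_zero_iff.2 hne)]
    exact hφ.le

theorem exists_dual_re_apply_ge (x : X) :
    ∃ φ : StrongDual ℂ X, ‖φ‖ ≤ 1 ∧ ‖x‖ / 2 ≤ (φ x).re := by
  obtain ⟨φ, h1, h2⟩ := exists_dual_vector'' ℂ x
  refine ⟨φ, h1, ?_⟩
  rw [h2]
  simp only [Complex.coe_algebraMap, Complex.ofReal_re]
  linarith [norm_nonneg x]

/-- Toeplitz operators with Calderón–Zygmund entries that are bounded on `ℓ^s` are bounded on all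
`ℓ^r`, uniformly in the size. -/
theorem exists_toeplitzBound {r s C K : ℝ} (hr : 1 < r) (hs : 1 < s) (hC : 0 ≤ C)
    (hK : 0 ≤ K) : ∃ K' : ℝ, 0 ≤ K' ∧ ∀ (n : ℕ) (a : ℕ → X →L[ℂ] X),
      (∀ m, m + 1 < 2 ^ n → ‖a (m + 1) - a m‖ ≤ C / (m + 1) ^ 2) →
      ToeplitzBound s K (2 ^ n) a → ToeplitzBound r K' (2 ^ n) a := by
  rcases lt_trichotomy r s with h | h | h
  · exact exists_toeplitzBound_of_lt hr h hC hK
  · exact ⟨K, hK, fun n a _ ha => h ▸ ha⟩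
  -- For `s < r` the conjugate exponents satisfy `r' < s'`. The transposed entries act on the dual
  -- space, the case already treated applies there, and transposing along the pairing of the dual
  -- with `X` itself returns without the bidual.
  have hs' := Real.HolderConjugate.conjExponent hs
  have hr' := Real.HolderConjugate.conjExponent hr
  set s' := s.conjExponent
  set r' := r.conjExponent
  have hlt : r' < s' := by
    have h1 := hs'.inv_add_inv_eq_one
    have h2 := hr'.inv_add_inv_eq_one
    have h3 : r⁻¹ < s⁻¹ := inv_strictAnti₀ (by linarith) h
    exact (inv_lt_inv₀ hs'.symm.pos hr'.symm.pos).1 (by linarith)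
  obtain ⟨K', hK', hmain⟩ := exists_toeplitzBound_of_lt (X := StrongDual ℂ X) hr'.symm.lt hlt hC
    (K := (2 * K ^ (1 / s)) ^ s') (by positivity)
  refine ⟨(2 * K' ^ (1 / r')) ^ r, by positivity, fun n a ha hT => ?_⟩
  set b : ℕ → StrongDual ℂ X →L[ℂ] StrongDual ℂ X := fun m =>
    (ContinuousLinearMap.compL ℂ X X ℂ).flip (a m) with hb
  have h1 : ToeplitzBound s' ((2 * K ^ (1 / s)) ^ s') (2 ^ n) b := by
    refine ToeplitzBound.dual (B := (ContinuousLinearMap.id ℂ (StrongDual ℂ X)).flip)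
      (fun m x z => rfl) (fun x z => ?_) exists_re_apply_ge hs' hK hT
    rw [mul_comm]
    exact z.le_opNorm x
  have h2 : ∀ m, m + 1 < 2 ^ n → ‖b (m + 1) - b m‖ ≤ C / (m + 1) ^ 2 := by
    intro m hm
    refine le_trans ?_ (ha m hm)
    refine ContinuousLinearMap.opNorm_le_bound _ (norm_nonneg _) fun φ => ?_
    have e : (b (m + 1) - b m) φ = φ ∘L (a (m + 1) - a m) := by
      ext x
      simp [hb]
    rw [e, mul_comm]
    exact ContinuousLinearMap.opNorm_comp_le φ _
  exact ToeplitzBound.dual (B := ContinuousLinearMap.id ℂ (StrongDual ℂ X))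
      (fun m x z => rfl) (fun z x => z.le_opNorm x) exists_dual_re_apply_ge hr'.symm hK' (hmain n b h2 h1)

end Duality

end

/-! ### Translations of functions on `(0, T)`. -/

section
section Shift

variable {Z : Type*} [NormedAddCommGroup Z]

/-- Translation by `h` of a function on `(0, T)`, extended by zero. -/
def shiftFun (T h : ℝ) (v : ℝ → Z) (t : ℝ) : Z := (Ioo 0 T).indicator v (t - h)

theorem memLp_shiftFun {T : ℝ} (h : ℝ) {p : ℝ≥0∞} {v : ℝ → Z} (hv : MemLp v p (volJ T)) :
    MemLp (shiftFun T h v) p (volJ T) := by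
  have h1 : MemLp ((Ioo 0 T).indicator v) p volume :=
    (memLp_indicator_iff_restrict measurableSet_Ioo).2 hv
  exact (h1.comp_measurePreserving (measurePreserving_sub_right volume h)).restrict _

theorem integrable_shiftFun {T : ℝ} (h : ℝ) {v : ℝ → Z} (hv : Integrable v (volJ T)) :
    Integrable (shiftFun T h v) (volJ T) :=
  memLp_one_iff_integrable.1 (memLp_shiftFun h (memLp_one_iff_integrable.2 hv))

theorem ae_shift {T : ℝ} (h : ℝ) {p : ℝ → Prop} (hp : ∀ᵐ t ∂(volJ T), p t) :
    ∀ᵐ t : ℝ, t - h ∈ Ioo 0 T → p (t - h) := by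
  rw [ae_restrict_iff' measurableSet_Ioo] at hp
  exact (measurePreserving_sub_right volume h).quasiMeasurePreserving.ae hp

theorem integral_shiftFun [NormedSpace ℝ Z] {T h : ℝ} (hh : 0 ≤ h) {v : ℝ → Z} {t : ℝ}
    (ht : t ∈ Ioo 0 T) :
    ∫ s in (0)..t, shiftFun T h v s = if h < t then ∫ s in (0)..(t - h), v s else 0 := by
  have e1 : ∫ s in (0)..t, shiftFun T h v s = ∫ s in (0 - h)..(t - h), (Ioo 0 T).indicator v s :=
    intervalIntegral.integral_comp_sub_right (fun s => (Ioo 0 T).indicator v s) h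
  rw [e1, intervalIntegral.integral_of_le (by linarith [ht.1]),
    setIntegral_indicator measurableSet_Ioo]
  split_ifs with hlt
  · rw [intervalIntegral.integral_of_le (by linarith)]
    congr 2
    ext x
    simp only [mem_inter_iff, mem_Ioc, mem_Ioo]
    exact ⟨fun h' => ⟨h'.2.1, h'.1.2⟩,
      fun h' => ⟨⟨by linarith [h'.1], h'.2⟩, h'.1, by linarith [h'.2, ht.2]⟩⟩
  · have : Ioc (0 - h) (t - h) ∩ Ioo 0 T = ∅ := by
      ext x
      simp only [mem_inter_iff, mem_Ioc, mem_Ioo, mem_empty_iff_false, iff_false]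
      rintro ⟨⟨_, h2⟩, h3, _⟩
      linarith
    rw [this, setIntegral_empty]

end Shift

/-! ### The operator `f ↦ u'`: translation invariance, causality, commutator with `t`. -/

section DerivOp

variable {D X : Type*}
  [NormedAddCommGroup D] [NormedSpace ℂ D] [CompleteSpace D]
  [NormedAddCommGroup X] [NormedSpace ℂ X] [CompleteSpace X]

/-- `P` maps `f` to the derivative of the solution of `u' + A u = f`, `u(0) = 0`. -/
def IsDerivOp (T : ℝ) (s : Exponent) (i A : D →L[ℂ] X) (P : LrJ T s X →L[ℂ] LrJ T s X) : Prop :=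
  ∀ f, ∃ u : ℝ → D, Integrable u (volJ T) ∧
    (∀ᵐ t ∂(volJ T), i (u t) = ∫ τ in (0)..t, P f τ) ∧ ∀ᵐ t ∂(volJ T), P f t + A (u t) = f t

theorem HasMaxRegExp.exists_isDerivOp {T : ℝ} (hT : 0 < T) {s : Exponent} {i A : D →L[ℂ] X}
    (h : HasMaxRegExp T s i A) : ∃ P, IsDerivOp T s i A P := by
  obtain ⟨S, hS⟩ := h.exists_solution_operator hT
  refine ⟨MRSpace.derivL T s i _ ∘L S, fun f => ⟨MRSpace.fnL T s i _ (S f), ?_, ?_, ?_⟩⟩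
  · exact LrJ.integrable _
  · exact MR.fn_eq_primitive hT (S f)
  · exact (parabolic_eq_iff _ _).1 (hS f)

variable {T : ℝ} {s : Exponent} {i A : D →L[ℂ] X} {P : LrJ T s X →L[ℂ] LrJ T s X}

theorem IsDerivOp.ae_eq (hP : IsDerivOp T s i A P) (hT : 0 < T) (h : HasMaxRegExp T s i A)
    {f : LrJ T s X} {u : ℝ → D} {v : ℝ → X}
    (hu : Integrable u (volJ T)) (hv : Integrable v (volJ T))
    (hp : ∀ᵐ t ∂(volJ T), i (u t) = ∫ τ in (0)..t, v τ)
    (he : ∀ᵐ t ∂(volJ T), v t + A (u t) = f t) : P f =ᵐ[volJ T] v := by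
  obtain ⟨w, hw, hw1, hw2⟩ := hP f
  refine h.ae_eq hT hw (LrJ.integrable _) hu hv hw1 hp ?_
  filter_upwards [hw2, he] with t h1 h2 using h1.trans h2.symm

/-- Since solutions start at zero, a right translate of a solution, extended by zero, solves the
equation with the translated right-hand side; uniqueness identifies it. -/
theorem IsDerivOp.shift (hP : IsDerivOp T s i A P) (hT : 0 < T) (hA : HasMaxRegExp T s i A)
    {f g : LrJ T s X} {h : ℝ} (hh : 0 ≤ h) (hg : g =ᵐ[volJ T] shiftFun T h f) :
    P g =ᵐ[volJ T] shiftFun T h (P f) := by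
  obtain ⟨u, hu, hu1, hu2⟩ := hP f
  refine hP.ae_eq hT hA (integrable_shiftFun h hu) (integrable_shiftFun h (LrJ.integrable _)) ?_ ?_
  · filter_upwards [ae_restrict_of_ae (ae_shift h hu1), ae_volJ_mem T] with t h1 ht
    rw [integral_shiftFun hh ht]
    split_ifs with hlt
    · have hm : t - h ∈ Ioo 0 T := ⟨by linarith, by linarith [ht.2]⟩
      rw [shiftFun, indicator_of_mem hm, h1 hm]
    · have hm : t - h ∉ Ioo 0 T := fun hm => hlt (by linarith [hm.1])
      rw [shiftFun, indicator_of_notMem hm, map_zero]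
  · filter_upwards [ae_restrict_of_ae (ae_shift h hu2), hg] with t h1 h2
    rw [h2]
    simp only [shiftFun]
    by_cases hm : t - h ∈ Ioo 0 T
    · rw [indicator_of_mem hm, indicator_of_mem hm, indicator_of_mem hm, h1 hm]
    · rw [indicator_of_notMem hm, indicator_of_notMem hm, indicator_of_notMem hm, map_zero, add_zero]

/-- Causality: the solution vanishes as long as the right-hand side does. -/
theorem IsDerivOp.causal (hP : IsDerivOp T s i A P) (hT : 0 < T) (hA : HasMaxRegExp T s i A)
    {f : LrJ T s X} {h : ℝ} (hh : 0 ≤ h) (hf : ∀ᵐ t ∂(volJ T), t ≤ h → f t = 0) :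
    ∀ᵐ t ∂(volJ T), t ≤ h → P f t = 0 := by
  -- A function vanishing up to time `h` is the right translate of its own left translate, so
  -- causality follows from translation invariance.
  have hmem := memLp_shiftFun (-h) (Lp.memLp f)
  set g : LrJ T s X := hmem.toLp _ with hg
  have h1 : f =ᵐ[volJ T] shiftFun T h g := by
    filter_upwards [ae_restrict_of_ae (ae_shift h hmem.coeFn_toLp), hf, ae_volJ_mem T]
      with t h1 h2 ht
    rw [shiftFun]
    by_cases hm : t - h ∈ Ioo 0 T
    · rw [indicator_of_mem hm, h1 hm, shiftFun, sub_neg_eq_add, sub_add_cancel,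
        indicator_of_mem ht]
    · rw [indicator_of_notMem hm, h2]
      by_contra hlt
      exact hm ⟨by linarith, by linarith [ht.2]⟩
  filter_upwards [hP.shift hT hA hh h1] with t h2 hth
  rw [h2, shiftFun, indicator_of_notMem]
  exact fun hm => by linarith [hm.1]

/-- The product rule for `t ∫₀ᵗ v`, in integrated form. -/
theorem integral_id_smul_add_primitive {v : ℝ → X} (hv : Integrable v (volJ T)) {t : ℝ}
    (ht : t ∈ Ioo 0 T) :
    ∫ σ in (0)..t, (σ • v σ + ∫ τ in (0)..σ, v τ) = t • ∫ τ in (0)..t, v τ := by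
  have hm := Ioo_subset_Icc_self ht
  have h0 : (0 : ℝ) ∈ Icc 0 T := ⟨le_rfl, hm.1.trans hm.2⟩
  have hi := intervalIntegrable_of_integrable_volJ hv h0 hm
  have h1 := integral_deriv_smul_primitive (φ := fun x => x) (φ' := fun _ => 1)
    (fun x => hasDerivAt_id x) continuous_const ht.1.le hi
  simp only [one_smul] at h1
  rw [intervalIntegral.integral_add (f := fun σ => σ • v σ) (hi.continuousOn_smul continuousOn_id)
    (intervalIntegrable_of_integrable_volJ (integrable_primitive hv) h0 hm), h1]
  simp

theorem integrable_id_smul {Z : Type*} [NormedAddCommGroup Z] [NormedSpace ℝ Z] {v : ℝ → Z}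
    (hv : Integrable v (volJ T)) : Integrable (fun t => t • v t) (volJ T) := by
  refine hv.bdd_smul (𝕜 := ℝ) T measurable_id.aestronglyMeasurable ?_
  filter_upwards [ae_volJ_mem T] with t ht
  change ‖t‖ ≤ T
  rw [Real.norm_of_nonneg ht.1.le]
  exact ht.2.le

/-- The commutator of the solution operator with the multiplication by `t`. -/
theorem IsDerivOp.mul_id (hP : IsDerivOp T s i A P) (hT : 0 < T) (hA : HasMaxRegExp T s i A)
    {f k : LrJ T s X}
    (hk : ∀ᵐ t ∂(volJ T), t • f t + ∫ τ in (0)..t, P f τ = ∫ τ in (0)..t, k τ) :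
    ∀ᵐ t ∂(volJ T), t • P f t + ∫ τ in (0)..t, P f τ = ∫ τ in (0)..t, P k τ := by
  obtain ⟨u, hu, hu1, hu2⟩ := hP f
  obtain ⟨w, hw, hw1, hw2⟩ := hP k
  have hPf := LrJ.integrable (P f)
  have hPk := LrJ.integrable (P k)
  -- Both `t • u t` and the primitive of `w` solve the equation, with right-hand sides `t • f t +
  -- ∫₀ᵗ P f` and `∫₀ᵗ k`. These agree by hypothesis, so uniqueness equates the derivatives.
  refine hA.ae_eq hT (u := fun t => t • u t) (u' := fun t => ∫ τ in (0)..t, w τ)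
    (integrable_id_smul hu) ((integrable_id_smul hPf).add (integrable_primitive hPf))
    (integrable_primitive hw) (integrable_primitive hPk) ?_ ?_ ?_
  · filter_upwards [hu1, ae_volJ_mem T] with t h1 ht
    have e := integral_id_smul_add_primitive hPf ht
    refine Eq.trans ?_ e.symm
    rw [← h1]
    exact (i.restrictScalars ℝ).map_smul t (u t)
  · filter_upwards [ae_volJ_mem T] with t ht
    have hm := Ioo_subset_Icc_self ht
    have h0 : (0 : ℝ) ∈ Icc 0 T := ⟨le_rfl, hT.le⟩
    rw [← i.intervalIntegral_comp_comm (intervalIntegrable_of_integrable_volJ hw h0 hm)]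
    exact primitive_congr hw1 hm
  · filter_upwards [hu1, hu2, hk, ae_volJ_mem T] with t h1 h2 h3 ht
    have hm := Ioo_subset_Icc_self ht
    have h0 : (0 : ℝ) ∈ Icc 0 T := ⟨le_rfl, hT.le⟩
    have hwi := intervalIntegrable_of_integrable_volJ hw h0 hm
    have e1 : A (t • u t) = t • A (u t) := (A.restrictScalars ℝ).map_smul t (u t)
    have e2 : (∫ τ in (0)..t, P k τ) + A (∫ τ in (0)..t, w τ) = ∫ τ in (0)..t, k τ := by
      rw [← A.intervalIntegral_comp_comm hwi, ← intervalIntegral.integral_add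
        (intervalIntegrable_of_integrable_volJ hPk h0 hm)
        ⟨A.integrable_comp hwi.1, A.integrable_comp hwi.2⟩]
      exact primitive_congr hw2 hm
    rw [e2, ← h3, e1, ← h2, smul_add]
    abel

end DerivOp

end

/-! ### Running means and their second differences. -/

section
section Means

variable {X : Type*} [NormedAddCommGroup X] [NormedSpace ℂ X]

/-- The mean value over `(0, t)`. -/
def meanFun (z : ℝ → X) (t : ℝ) : X := t⁻¹ • ∫ s in (0)..t, z s

variable {T K : ℝ} {z : ℝ → X}

theorem norm_integral_le_of_ae_bound (hz : ∀ᵐ t ∂(volJ T), ‖z t‖ ≤ K) {a b : ℝ} (ha : 0 ≤ a)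
    (hab : a ≤ b) (hb : b ≤ T) : ‖∫ s in a..b, z s‖ ≤ K * (b - a) := by
  have h := intervalIntegral.norm_integral_le_of_norm_le_const_ae (a := a) (b := b) (C := K)
    (f := z) ?_
  · rwa [abs_of_nonneg (by linarith)] at h
  · rw [uIoc_of_le hab]
    rw [ae_restrict_iff' measurableSet_Ioo] at hz
    filter_upwards [hz, compl_mem_ae_iff.2 (measure_singleton T)] with t ht htT hm
    exact ht ⟨by linarith [hm.1], lt_of_le_of_ne (by linarith [hm.2]) htT⟩

theorem norm_meanFun_le (hz : ∀ᵐ t ∂(volJ T), ‖z t‖ ≤ K) {t : ℝ} (ht : t ∈ Ioc 0 T) :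
    ‖meanFun z t‖ ≤ K := by
  have h := norm_integral_le_of_ae_bound hz le_rfl ht.1.le ht.2
  rw [meanFun, norm_smul, norm_inv, Real.norm_of_nonneg ht.1.le, inv_mul_le_iff₀ ht.1]
  linarith

theorem norm_meanFun_sub_le (hzi : Integrable z (volJ T)) (hz : ∀ᵐ t ∂(volJ T), ‖z t‖ ≤ K)
    {t t' : ℝ} (ht : 0 < t) (htt : t ≤ t') (ht' : t' ≤ T) :
    ‖meanFun z t' - meanFun z t‖ ≤ 2 * K * (t' - t) / t' := by
  have hp : 0 < t' := ht.trans_le htt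
  have h0 : (0 : ℝ) ∈ Icc 0 T := ⟨le_rfl, by linarith⟩
  have h1 : t ∈ Icc 0 T := ⟨ht.le, by linarith⟩
  have h2 : t' ∈ Icc 0 T := ⟨hp.le, ht'⟩
  have e : meanFun z t' - meanFun z t
      = t'⁻¹ • (∫ s in t..t', z s) + (t'⁻¹ - t⁻¹) • ∫ s in (0)..t, z s := by
    rw [meanFun, meanFun, ← intervalIntegral.integral_add_adjacent_intervals
      (intervalIntegrable_of_integrable_volJ hzi h0 h1)
      (intervalIntegrable_of_integrable_volJ hzi h1 h2), smul_add, sub_smul]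
    abel
  have b1 := norm_integral_le_of_ae_bound hz ht.le htt ht'
  have b2 := norm_integral_le_of_ae_bound hz le_rfl ht.le h1.2
  have hinv : t'⁻¹ ≤ t⁻¹ := inv_anti₀ ht htt
  rw [e]
  refine (norm_add_le _ _).trans ?_
  rw [norm_smul, norm_smul, norm_inv, Real.norm_of_nonneg hp.le, Real.norm_eq_abs,
    abs_of_nonpos (by linarith)]
  calc t'⁻¹ * ‖∫ s in t..t', z s‖ + -(t'⁻¹ - t⁻¹) * ‖∫ s in (0)..t, z s‖
      ≤ t'⁻¹ * (K * (t' - t)) + -(t'⁻¹ - t⁻¹) * (K * (t - 0)) := by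
        gcongr
        linarith
    _ = 2 * K * (t' - t) / t' := by field_simp; ring

theorem continuousOn_meanFun (hzi : Integrable z (volJ T)) :
    ContinuousOn (meanFun z) (Ioc 0 T) := by
  have h1 : ContinuousOn (fun t : ℝ => t⁻¹) (Ioc 0 T) := continuousOn_id.inv₀ fun t ht => ht.1.ne'
  exact h1.smul ((continuousOn_primitive_volJ hzi).mono Ioc_subset_Icc_self)

theorem integrable_meanFun (hzi : Integrable z (volJ T)) (hz : ∀ᵐ t ∂(volJ T), ‖z t‖ ≤ K) :
    Integrable (meanFun z) (volJ T) := by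
  refine Integrable.of_bound (C := K) ?_ ?_
  · exact ((continuousOn_meanFun hzi).mono Ioo_subset_Ioc_self).aestronglyMeasurable
      measurableSet_Ioo
  · filter_upwards [ae_volJ_mem T] with t ht using norm_meanFun_le hz ⟨ht.1, ht.2.le⟩

theorem ae_norm_meanFun_le (hz : ∀ᵐ t ∂(volJ T), ‖z t‖ ≤ K) :
    ∀ᵐ t ∂(volJ T), ‖meanFun z t‖ ≤ K := by
  filter_upwards [ae_volJ_mem T] with t ht using norm_meanFun_le hz ⟨ht.1, ht.2.le⟩

theorem hasDerivAt_meanFun [CompleteSpace X] {w : ℝ → X} (hw : Integrable w (volJ T))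
    (hwc : ContinuousOn w (Ioo 0 T)) {t : ℝ} (ht : t ∈ Ioo 0 T) :
    HasDerivAt (meanFun w) (t⁻¹ • (w t - meanFun w t)) t := by
  have h1 : HasDerivAt (fun t => ∫ s in (0)..t, w s) (w t) t := by
    refine intervalIntegral.integral_hasDerivAt_right
      (intervalIntegrable_of_integrable_volJ hw ⟨le_rfl, (ht.1.trans ht.2).le⟩
        (Ioo_subset_Icc_self ht)) ?_ (hwc.continuousAt (isOpen_Ioo.mem_nhds ht))
    exact hwc.stronglyMeasurableAtFilter isOpen_Ioo t ht
  have h2 := (hasDerivAt_inv ht.1.ne').smul h1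
  refine h2.congr_deriv ?_
  have := ht.1.ne'
  rw [meanFun, smul_sub, smul_smul, neg_smul, sub_eq_add_neg, sq, mul_inv]

/-- The second differences of a twofold mean of a bounded function. -/
theorem norm_second_difference_le [CompleteSpace X] (hK : 0 ≤ K) (hzi : Integrable z (volJ T))
    (hz : ∀ᵐ t ∂(volJ T), ‖z t‖ ≤ K) {t h : ℝ} (hh : 0 < h) (ht : 0 < t - h) (htT : t + h < T) :
    ‖meanFun (meanFun z) (t + h) - meanFun (meanFun z) t
      - (meanFun (meanFun z) t - meanFun (meanFun z) (t - h))‖ ≤ 6 * K * h ^ 2 / (t - h) ^ 2 := by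
  set W := meanFun z with hW
  set Q := meanFun W with hQ
  have hWi : Integrable W (volJ T) := integrable_meanFun hzi hz
  have hWb : ∀ᵐ t ∂(volJ T), ‖W t‖ ≤ K := ae_norm_meanFun_le hz
  have hWc : ContinuousOn W (Ioo 0 T) := (continuousOn_meanFun hzi).mono Ioo_subset_Ioc_self
  -- The second difference of `Q` is the increment of `σ ↦ Q (σ + h) - Q σ` over an interval of
  -- length `h`. The derivative of `Q` is `(W - Q) / σ`, and first differences of the means `W` and
  -- `Q` supply the other factor `h`. The inner mean makes `W` continuous, so that `Q` is
  -- differentiable.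
  have hder : ∀ σ ∈ Icc (t - h) t, HasDerivAt (fun σ => Q (σ + h) - Q σ)
      ((σ + h)⁻¹ • (W (σ + h) - Q (σ + h)) - σ⁻¹ • (W σ - Q σ)) σ := by
    intro σ hσ
    refine HasDerivAt.sub ?_ (hasDerivAt_meanFun hWi hWc ⟨ht.trans_le hσ.1, by linarith [hσ.2]⟩)
    exact (hasDerivAt_meanFun hWi hWc (t := σ + h)
      ⟨by linarith [hσ.1], by linarith [hσ.2]⟩).comp_add_const σ h
  have hbd : ∀ σ ∈ Ico (t - h) t,
      ‖(σ + h)⁻¹ • (W (σ + h) - Q (σ + h)) - σ⁻¹ • (W σ - Q σ)‖ ≤ 6 * K * h / (t - h) ^ 2 := by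
    intro σ hσ
    have hσ0 : 0 < σ := ht.trans_le hσ.1
    have hσh : 0 < σ + h := by linarith
    have hσT : σ + h ≤ T := by linarith [hσ.2]
    have e : (σ + h)⁻¹ • (W (σ + h) - Q (σ + h)) - σ⁻¹ • (W σ - Q σ)
        = (σ + h)⁻¹ • ((W (σ + h) - W σ) - (Q (σ + h) - Q σ))
          - (σ⁻¹ - (σ + h)⁻¹) • (W σ - Q σ) := by
      simp only [smul_sub, sub_smul]
      abel
    have b1 := norm_meanFun_sub_le hzi hz hσ0 (by linarith : σ ≤ σ + h) hσT
    have b2 := norm_meanFun_sub_le hWi hWb hσ0 (by linarith : σ ≤ σ + h) hσT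
    have b3 := norm_meanFun_le hz (t := σ) ⟨hσ0, by linarith⟩
    have b4 := norm_meanFun_le hWb (t := σ) ⟨hσ0, by linarith⟩
    have hinv : (σ + h)⁻¹ ≤ σ⁻¹ := inv_anti₀ hσ0 (by linarith)
    rw [e]
    refine (norm_sub_le _ _).trans ?_
    rw [norm_smul, norm_smul, norm_inv, Real.norm_of_nonneg hσh.le,
      Real.norm_of_nonneg (by linarith : 0 ≤ σ⁻¹ - (σ + h)⁻¹)]
    have c1 : ‖(W (σ + h) - W σ) - (Q (σ + h) - Q σ)‖
        ≤ 2 * K * (σ + h - σ) / (σ + h) + 2 * K * (σ + h - σ) / (σ + h) :=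
      (norm_sub_le _ _).trans (add_le_add b1 b2)
    have c2 : ‖W σ - Q σ‖ ≤ K + K := (norm_sub_le _ _).trans (add_le_add b3 b4)
    calc _ ≤ (σ + h)⁻¹ * (2 * K * (σ + h - σ) / (σ + h) + 2 * K * (σ + h - σ) / (σ + h))
          + (σ⁻¹ - (σ + h)⁻¹) * (K + K) := by
          gcongr
      _ = 4 * K * h / (σ + h) ^ 2 + 2 * K * h / (σ * (σ + h)) := by field_simp; ring
      _ ≤ 4 * K * h / (t - h) ^ 2 + 2 * K * h / ((t - h) * (t - h)) := by
          gcongr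
          all_goals linarith [hσ.1]
      _ = _ := by field_simp; ring
  have := norm_image_sub_le_of_norm_deriv_le_segment' (f := fun σ => Q (σ + h) - Q σ)
    (fun σ hσ => (hder σ hσ).hasDerivWithinAt) hbd t ⟨by linarith, le_rfl⟩
  simp only [sub_add_cancel] at this
  refine this.trans (le_of_eq ?_)
  field_simp
  ring

end Means

/-! ### Powers of the derivative operator on constants. -/

section Iterates

variable {D X : Type*}
  [NormedAddCommGroup D] [NormedSpace ℂ D] [CompleteSpace D]
  [NormedAddCommGroup X] [NormedSpace ℂ X] [CompleteSpace X]
  {T : ℝ} {s : Exponent} {i A : D →L[ℂ] X} {P : LrJ T s X →L[ℂ] LrJ T s X}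

/-- The constant function `x` on `J`. -/
def constLr {T : ℝ} (hT : 0 < T) (s : Exponent) (x : X) : LrJ T s X := stepLr hT s 0 X fun _ => x

theorem constLr_coe (hT : 0 < T) (s : Exponent) (x : X) :
    constLr hT s x =ᵐ[volJ T] fun _ => x := stepLr_coe hT s 0 fun _ => x

/-- Induction with `IsDerivOp.mul_id`, applied to the `n`-th iterate; the case `n = 0` is the
primitive of a constant. Writing `w n` for the iterates, `n = 1` says that `w 1` is the running mean
of `w 2`, and `n = 2` that `w 2` is the running mean of `2 * w 3 - w 2`. -/
theorem IsDerivOp.mul_id_iterate (hP : IsDerivOp T s i A P) (hT : 0 < T)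
    (hA : HasMaxRegExp T s i A) (x : X) (n : ℕ) :
    ∀ᵐ t ∂(volJ T), t • (P ^ n) (constLr hT s x) t = ∫ τ in (0)..t,
      ((n : ℂ) • (P ^ (n + 1)) (constLr hT s x) - ((n : ℂ) - 1) • (P ^ n) (constLr hT s x) :
        LrJ T s X) τ := by
  induction n with
  | zero =>
    filter_upwards [constLr_coe hT s x, ae_volJ_mem T] with t h1 ht
    have e : ((((0 : ℕ) : ℂ) • (P ^ (0 + 1)) (constLr hT s x)
        - (((0 : ℕ) : ℂ) - 1) • (P ^ 0) (constLr hT s x) : LrJ T s X)) = constLr hT s x := by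
      simp
    rw [e, primitive_congr (constLr_coe hT s x) (Ioo_subset_Icc_self ht), pow_zero]
    simp [h1]
  | succ n ih =>
    have hk : ∀ᵐ t ∂(volJ T), t • (P ^ n) (constLr hT s x) t
        + ∫ τ in (0)..t, P ((P ^ n) (constLr hT s x)) τ = ∫ τ in (0)..t,
          (((n : ℂ) • (P ^ (n + 1)) (constLr hT s x) - ((n : ℂ) - 1) • (P ^ n) (constLr hT s x))
            + P ((P ^ n) (constLr hT s x)) : LrJ T s X) τ := by
      filter_upwards [ih, ae_volJ_mem T] with t h1 ht
      have hm := Ioo_subset_Icc_self ht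
      have h0 : (0 : ℝ) ∈ Icc 0 T := ⟨le_rfl, hT.le⟩
      rw [h1, primitive_congr (Lp.coeFn_add _ _) hm]
      exact (intervalIntegral.integral_add
        (intervalIntegrable_of_integrable_volJ (LrJ.integrable _) h0 hm)
        (intervalIntegrable_of_integrable_volJ (LrJ.integrable _) h0 hm)).symm
    filter_upwards [hP.mul_id hT hA hk, ae_volJ_mem T] with t h1 ht
    have hm := Ioo_subset_Icc_self ht
    have h0 : (0 : ℝ) ∈ Icc 0 T := ⟨le_rfl, hT.le⟩
    have e1 : (P ^ (n + 1)) (constLr hT s x) = P ((P ^ n) (constLr hT s x)) := by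
      rw [pow_succ']; rfl
    have e2 : (P ^ (n + 1 + 1)) (constLr hT s x) = P (P ((P ^ n) (constLr hT s x))) := by
      rw [pow_succ', pow_succ']; rfl
    rw [e1, e2]
    set f := P ((P ^ n) (constLr hT s x)) with hf
    have e3 : P (((n : ℂ) • (P ^ (n + 1)) (constLr hT s x)
        - ((n : ℂ) - 1) • (P ^ n) (constLr hT s x)) + f)
        = (((n + 1 : ℕ) : ℂ) • P f - (((n + 1 : ℕ) : ℂ) - 1) • f) + f := by
      rw [e1, map_add, map_sub, map_smul, map_smul, ← hf]
      push_cast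
      module
    rw [e3, primitive_congr (Lp.coeFn_add _ _) hm] at h1
    simp only [Pi.add_apply] at h1
    rw [intervalIntegral.integral_add
        (intervalIntegrable_of_integrable_volJ (LrJ.integrable _) h0 hm)
        (intervalIntegrable_of_integrable_volJ (LrJ.integrable _) h0 hm)] at h1
    exact add_right_cancel h1

/-- Causality turns the bound of `P` on `(0, T)` into bounds on `(0, h)`. -/
theorem IsDerivOp.setIntegral_le (hP : IsDerivOp T s i A P) (hT : 0 < T)
    (hA : HasMaxRegExp T s i A) {h : ℝ} (hh : 0 ≤ h) (f : LrJ T s X) :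
    ∫ t in Iic h, ‖P f t‖ ^ (s : ℝ) ∂(volJ T)
      ≤ ‖P‖ ^ (s : ℝ) * ∫ t in Iic h, ‖f t‖ ^ (s : ℝ) ∂(volJ T) := by
  have hs : (0 : ℝ) < s := zero_lt_one.trans s.2
  have hmem := (Lp.memLp f).indicator (s := Iic h) measurableSet_Iic
  set g : LrJ T s X := hmem.toLp _ with hg
  have hgc : g =ᵐ[volJ T] (Iic h).indicator f := hmem.coeFn_toLp
  have hz : ∀ᵐ t ∂(volJ T), t ≤ h → P (f - g) t = 0 := by
    refine hP.causal hT hA hh ?_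
    filter_upwards [Lp.coeFn_sub f g, hgc] with t h1 h2 ht
    rw [h1, Pi.sub_apply, h2, indicator_of_mem (show t ∈ Iic h from ht), sub_self]
  have e1 : ∫ t in Iic h, ‖P f t‖ ^ (s : ℝ) ∂(volJ T)
      = ∫ t in Iic h, ‖P g t‖ ^ (s : ℝ) ∂(volJ T) := by
    refine setIntegral_congr_ae measurableSet_Iic ?_
    rw [map_sub] at hz
    filter_upwards [hz, Lp.coeFn_sub (P f) (P g)] with t h1 h2 ht
    have h3 := h1 ht
    rw [h2, Pi.sub_apply, sub_eq_zero] at h3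
    rw [h3]
  have e2 : ‖g‖ ^ (s : ℝ) = ∫ t in Iic h, ‖f t‖ ^ (s : ℝ) ∂(volJ T) := by
    rw [LrJ.norm_rpow, ← integral_indicator measurableSet_Iic]
    refine integral_congr_ae ?_
    filter_upwards [hgc] with t ht
    rw [ht]
    by_cases hm : t ∈ Iic h
    · rw [indicator_of_mem hm, indicator_of_mem hm]
    · rw [indicator_of_notMem hm, indicator_of_notMem hm, norm_zero, Real.zero_rpow hs.ne']
  rw [e1, ← e2, ← Real.mul_rpow (norm_nonneg _) (norm_nonneg _)]
  calc _ ≤ ∫ t in Ioo 0 T, ‖P g t‖ ^ (s : ℝ) :=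
        setIntegral_le_integral (LrJ.integrable_rpow _) (Eventually.of_forall fun t => by positivity)
    _ = ‖P g‖ ^ (s : ℝ) := (LrJ.norm_rpow _).symm
    _ ≤ _ := Real.rpow_le_rpow (norm_nonneg _) (P.le_opNorm g) hs.le

theorem restrict_Iic_volJ {h : ℝ} (h1 : h ≤ T) :
    (volJ T).restrict (Iic h) = volume.restrict (Ioc 0 h) := by
  have e : volJ T = volume.restrict (Ioc 0 T) := Measure.restrict_congr_set Ioo_ae_eq_Ioc
  rw [e, Measure.restrict_restrict measurableSet_Iic, inter_comm, Ioc_inter_Iic, min_eq_right h1]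

theorem IsDerivOp.setIntegral_iterate_le (hP : IsDerivOp T s i A P) (hT : 0 < T)
    (hA : HasMaxRegExp T s i A) {h : ℝ} (hh : h ∈ Ioo 0 T) (x : X) (n : ℕ) :
    ∫ t in Iic h, ‖(P ^ n) (constLr hT s x) t‖ ^ (s : ℝ) ∂(volJ T)
      ≤ h * (‖P‖ ^ n * ‖x‖) ^ (s : ℝ) := by
  induction n with
  | zero =>
    have e : ∫ t in Iic h, ‖(P ^ 0) (constLr hT s x) t‖ ^ (s : ℝ) ∂(volJ T)
        = ∫ t in Iic h, ‖x‖ ^ (s : ℝ) ∂(volJ T) := by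
      refine integral_congr_ae (ae_restrict_of_ae ?_)
      filter_upwards [constLr_coe hT s x] with t ht
      have e : (P ^ 0) (constLr hT s x) = constLr hT s x := by rw [pow_zero]; rfl
      rw [e, ht]
    rw [e, restrict_Iic_volJ hh.2.le, setIntegral_const, measureReal_def, Real.volume_Ioc,
      sub_zero, ENNReal.toReal_ofReal hh.1.le]
    simp
  | succ n ih =>
    have e : (P ^ (n + 1)) (constLr hT s x) = P ((P ^ n) (constLr hT s x)) := by
      rw [pow_succ']; rfl
    rw [e]
    refine (hP.setIntegral_le hT hA hh.1.le _).trans ?_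
    refine (mul_le_mul_of_nonneg_left ih (by positivity)).trans (le_of_eq ?_)
    rw [pow_succ', mul_assoc ‖P‖, Real.mul_rpow (norm_nonneg P) (by positivity)]
    ring

/-- By causality the norm of `P` controls each iterate on `(0, h)` alone, and Jensen's inequality
converts the `L^s` mean over `(0, h)` into an `L¹` mean. The bound is linear in `h`. -/
theorem IsDerivOp.integral_norm_iterate_le (hP : IsDerivOp T s i A P) (hT : 0 < T)
    (hA : HasMaxRegExp T s i A) {h : ℝ} (hh : h ∈ Ioo 0 T) (x : X) (n : ℕ) :
    ∫ t in (0)..h, ‖(P ^ n) (constLr hT s x) t‖ ≤ h * (‖P‖ ^ n * ‖x‖) := by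
  have hs : (1 : ℝ) < s := s.2
  set w := (P ^ n) (constLr hT s x) with hw
  have hsub : volume.restrict (Ioc 0 h) ≤ volJ T :=
    Measure.restrict_mono (fun t (ht : t ∈ Ioc 0 h) => (⟨ht.1, ht.2.trans_lt hh.2⟩ : t ∈ Ioo 0 T)) le_rfl
  have hreal : volume.real (Ioc 0 h) = h := by
    rw [measureReal_def, Real.volume_Ioc, sub_zero, ENNReal.toReal_ofReal hh.1.le]
  have h1 := hP.setIntegral_iterate_le hT hA hh x n
  rw [restrict_Iic_volJ hh.2.le] at h1
  have h2 := (convexOn_rpow hs.le).map_set_average_le (μ := volume) (t := Ioc 0 h)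
    (f := fun t => ‖w t‖) (Real.continuous_rpow_const (by linarith)).continuousOn isClosed_Ici
    (by simpa using hh.1) (by simp)
    (Eventually.of_forall fun t => norm_nonneg _) ((LrJ.integrable w).norm.mono_measure hsub)
    ((LrJ.integrable_rpow w).mono_measure hsub)
  simp only [setAverage_eq, hreal, smul_eq_mul] at h2
  rw [intervalIntegral.integral_of_le hh.1.le]
  have h3 : (h⁻¹ * ∫ t in Ioc 0 h, ‖w t‖) ^ (s : ℝ) ≤ (‖P‖ ^ n * ‖x‖) ^ (s : ℝ) := by
    refine h2.trans ?_
    rw [inv_mul_le_iff₀ hh.1]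
    exact h1
  have h4 := (Real.rpow_le_rpow_iff (mul_nonneg (inv_nonneg.2 hh.1.le)
    (integral_nonneg fun t => norm_nonneg _)) (by positivity) (by linarith : (0 : ℝ) < s)).1 h3
  rwa [inv_mul_le_iff₀ hh.1] at h4

/-- In the identity for `t • w` the integrals on the right grow at most linearly in `t`, so division
by `t` gives a pointwise bound. No regularity beyond `L^s` boundedness of `P` enters. -/
theorem IsDerivOp.norm_iterate_le (hP : IsDerivOp T s i A P) (hT : 0 < T)
    (hA : HasMaxRegExp T s i A) (x : X) (n : ℕ) :
    ∀ᵐ t ∂(volJ T), ‖(P ^ n) (constLr hT s x) t‖ ≤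
      (n * ‖P‖ ^ (n + 1) + (n + 1) * ‖P‖ ^ n) * ‖x‖ := by
  filter_upwards [hP.mul_id_iterate hT hA x n, ae_volJ_mem T] with t h1 ht
  have hm := Ioo_subset_Icc_self ht
  have h0 : (0 : ℝ) ∈ Icc 0 T := ⟨le_rfl, hT.le⟩
  have hi := fun f : LrJ T s X =>
    intervalIntegrable_of_integrable_volJ (LrJ.integrable f) h0 hm
  set w := (P ^ n) (constLr hT s x) with hw
  set w' := (P ^ (n + 1)) (constLr hT s x) with hw'
  have e : ∫ τ in (0)..t, ((n : ℂ) • w' - ((n : ℂ) - 1) • w : LrJ T s X) τ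
      = (n : ℂ) • (∫ τ in (0)..t, w' τ) - ((n : ℂ) - 1) • ∫ τ in (0)..t, w τ := by
    rw [primitive_congr (v' := fun τ => (n : ℂ) • w' τ - ((n : ℂ) - 1) • w τ) ?_ hm,
      intervalIntegral.integral_sub (f := fun τ => (n : ℂ) • w' τ)
        (g := fun τ => ((n : ℂ) - 1) • w τ) ((hi w').smul _) ((hi w).smul _),
      intervalIntegral.integral_smul, intervalIntegral.integral_smul]
    filter_upwards [Lp.coeFn_sub ((n : ℂ) • w') (((n : ℂ) - 1) • w), Lp.coeFn_smul (n : ℂ) w',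
      Lp.coeFn_smul ((n : ℂ) - 1) w] with τ a1 a2 a3
    rw [a1, Pi.sub_apply, a2, a3, Pi.smul_apply, Pi.smul_apply]
  have b : ∀ k, ‖∫ τ in (0)..t, (P ^ k) (constLr hT s x) τ‖ ≤ t * (‖P‖ ^ k * ‖x‖) := fun k =>
    (intervalIntegral.norm_integral_le_integral_norm ht.1.le).trans
      (hP.integral_norm_iterate_le hT hA ht x k)
  have hn1 : ‖(n : ℂ) - 1‖ ≤ n + 1 := (norm_sub_le _ _).trans (by simp)
  have h2 : t * ‖w t‖ ≤ n * (t * (‖P‖ ^ (n + 1) * ‖x‖)) + (n + 1) * (t * (‖P‖ ^ n * ‖x‖)) := by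
    have : ‖t • w t‖ = t * ‖w t‖ := by rw [norm_smul, Real.norm_of_nonneg ht.1.le]
    rw [← this, h1, e]
    refine (norm_sub_le _ _).trans ?_
    rw [norm_smul, norm_smul, Complex.norm_natCast]
    exact add_le_add (mul_le_mul_of_nonneg_left (b (n + 1)) (by positivity))
      (mul_le_mul hn1 (b n) (norm_nonneg _) (by positivity))
  refine le_of_mul_le_mul_left (h2.trans (le_of_eq ?_)) ht.1
  ring

end Iterates

end

/-! ### Discretization of the derivative operator. -/

section
section Discretization

variable {D X : Type*}
  [NormedAddCommGroup D] [NormedSpace ℂ D] [CompleteSpace D]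
  [NormedAddCommGroup X] [NormedSpace ℂ X] [CompleteSpace X]
  {T : ℝ} {s : Exponent} {i A : D →L[ℂ] X} {P : LrJ T s X →L[ℂ] LrJ T s X}

/-- The step function with value `x` on the first cell. -/
def firstStep (hT : 0 < T) (s : Exponent) (n : ℕ) (X : Type*) [NormedAddCommGroup X]
    [NormedSpace ℂ X] : X →L[ℂ] LrJ T s X :=
  LinearMap.mkContinuous (stepLr hT s n X ∘ₗ LinearMap.single ℂ (fun _ : ℕ => X) 0)
    (mesh T n ^ (1 / (s : ℝ))) (fun x => by
      have hs : (0 : ℝ) < s := zero_lt_one.trans s.2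
      have hm := mesh_pos hT n
      rw [← Real.rpow_le_rpow_iff (norm_nonneg _) (by positivity) hs]
      change ‖stepLr hT s n X (Pi.single 0 x)‖ ^ (s : ℝ) ≤ _
      rw [norm_stepLr_rpow, Real.mul_rpow (by positivity) (norm_nonneg _), ← Real.rpow_mul hm.le,
        one_div_mul_cancel hs.ne', Real.rpow_one, Finset.sum_eq_single 0]
      · simp
      · intro k _ hk
        rw [Pi.single_eq_of_ne hk, norm_zero, Real.zero_rpow hs.ne', mul_zero]
      · intro h
        exact absurd (Finset.mem_range.2 (by positivity)) h)

/-- The entries of the discretized operator. -/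
def gridEntry (hT : 0 < T) (P : LrJ T s X →L[ℂ] LrJ T s X) (n m : ℕ) : X →L[ℂ] X :=
  cellAvg T n m X ∘L inclL1 T s X ∘L P ∘L firstStep hT s n X

theorem gridEntry_apply (hT : 0 < T) (P : LrJ T s X →L[ℂ] LrJ T s X) (n m : ℕ) (x : X) :
    gridEntry hT P n m x = cellAvg T n m X (inclL1 T s X (P (firstStep hT s n X x))) := rfl

theorem stepLr_single_eq_shift (hT : 0 < T) (n j : ℕ) (x : X) :
    stepLr hT s n X (Pi.single j x) =ᵐ[volJ T]
      shiftFun T (j * mesh T n) (firstStep hT s n X x) := by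
  have hm := mesh_pos hT n
  have h0 : firstStep hT s n X x =ᵐ[volJ T] stepFun T n (Pi.single 0 x) :=
    stepLr_coe hT s n (Pi.single 0 x)
  -- The left end of the cell is excluded as a null set: cells are half-open, whereas `shiftFun`
  -- truncates to an open interval.
  filter_upwards [stepLr_coe hT s n (Pi.single j x), ae_restrict_of_ae (ae_shift (j * mesh T n) h0),
    ae_volJ_mem T, ae_restrict_of_ae (compl_mem_ae_iff.2 (measure_singleton (j * mesh T n)))]
    with t h1 h2 ht hne
  rw [h1, shiftFun]
  by_cases hmem : t - j * mesh T n ∈ Ioo 0 T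
  · rw [indicator_of_mem hmem, h2 hmem, stepFun, stepFun]
    have e : (t - j * mesh T n) / mesh T n = t / mesh T n - (j : ℕ) := by
      field_simp
    rw [e, Nat.floor_sub_natCast]
    have hle : j ≤ ⌊t / mesh T n⌋₊ := by
      rw [Nat.le_floor_iff (div_nonneg ht.1.le hm.le), le_div_iff₀ hm]
      linarith [hmem.1]
    by_cases hj : ⌊t / mesh T n⌋₊ = j
    · rw [hj]; simp
    · rw [Pi.single_eq_of_ne hj, Pi.single_eq_of_ne (by omega)]
  · rw [indicator_of_notMem hmem, stepFun, Pi.single_eq_of_ne]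
    intro hj
    have hle : t ∈ cell T n j := (mem_cell_iff hT ht.1.le).2 hj
    have h3 : (j : ℝ) * mesh T n ≤ t := hle.1
    have h4 : t ≠ j * mesh T n := hne
    exact hmem ⟨by
      rcases h3.lt_or_eq with h | h
      · linarith
      · exact absurd h.symm h4, by
      have : (0 : ℝ) ≤ j * mesh T n := by positivity
      linarith [ht.2]⟩

theorem setIntegral_cell_shiftFun (hT : 0 < T) {n k j : ℕ} (hk : k < 2 ^ n) (g : ℝ → X) :
    ∫ t in cell T n k, shiftFun T (j * mesh T n) g t ∂(volJ T)
      = if j ≤ k then ∫ t in cell T n (k - j), g t ∂(volJ T) else 0 := by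
  have hm := mesh_pos hT n
  rw [restrict_cell hT hk]
  have hle : (k : ℝ) * mesh T n ≤ (k + 1) * mesh T n := by nlinarith
  rw [cell, integral_Ico_eq_integral_Ioc, ← intervalIntegral.integral_of_le hle]
  have e1 := intervalIntegral.integral_comp_sub_right (a := k * mesh T n)
    (b := (k + 1) * mesh T n) (fun s => (Ioo 0 T).indicator g s) (j * mesh T n)
  refine e1.trans ?_
  rw [intervalIntegral.integral_of_le (by linarith)]
  split_ifs with hjk
  · rw [restrict_cell hT (by omega : k - j < 2 ^ n), cell, integral_Ico_eq_integral_Ioc]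
    have e2 : (k : ℝ) * mesh T n - j * mesh T n = ((k - j : ℕ) : ℝ) * mesh T n := by
      push_cast [hjk]; ring
    have e3 : ((k : ℝ) + 1) * mesh T n - j * mesh T n = (((k - j : ℕ) : ℝ) + 1) * mesh T n := by
      push_cast [hjk]; ring
    rw [e2, e3]
    have hsub := cell_subset hT (by omega : k - j < 2 ^ n)
    rw [integral_Ioc_eq_integral_Ioo, integral_Ioc_eq_integral_Ioo]
    refine setIntegral_congr_fun measurableSet_Ioo fun t ht => indicator_of_mem ?_ _
    have h1 := hsub (⟨ht.1.le, ht.2⟩ : t ∈ cell T n (k - j))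
    refine ⟨lt_of_le_of_lt ?_ ht.1, h1.2⟩
    positivity
  · rw [setIntegral_indicator measurableSet_Ioo]
    have : Ioc ((k : ℝ) * mesh T n - j * mesh T n) ((k + 1) * mesh T n - j * mesh T n)
        ∩ Ioo 0 T = ∅ := by
      ext t
      simp only [mem_inter_iff, mem_Ioc, mem_Ioo, mem_empty_iff_false, iff_false]
      rintro ⟨⟨_, h2⟩, h3, _⟩
      have h4 : ((k : ℝ) + 1) ≤ j := by exact_mod_cast (by omega : k + 1 ≤ j)
      nlinarith
    rw [this, setIntegral_empty]

/-- The discretized operator is a Toeplitz operator. -/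
theorem IsDerivOp.cellAvg_stepLr (hP : IsDerivOp T s i A P) (hT : 0 < T)
    (hA : HasMaxRegExp T s i A) {n k : ℕ} (hk : k < 2 ^ n) (f : ℕ → X) :
    cellAvg T n k X (inclL1 T s X (P (stepLr hT s n X f))) = toeplitz (gridEntry hT P n) f k := by
  have e1 : stepLr hT s n X f = ∑ j ∈ Finset.range (2 ^ n), stepLr hT s n X (Pi.single j (f j)) := by
    rw [← map_sum]
    refine Lp.ext ?_
    filter_upwards [stepLr_coe hT s n f, stepLr_coe hT s n
      (∑ j ∈ Finset.range (2 ^ n), Pi.single j (f j)), ae_volJ_mem T] with t h1 h2 ht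
    rw [h1, h2, stepFun, stepFun, Finset.sum_apply, Finset.sum_eq_single ⌊t / mesh T n⌋₊]
    · simp
    · intro j _ hj
      rw [Pi.single_eq_of_ne hj.symm]
    · intro h
      exact absurd (Finset.mem_range.2 (floor_lt hT ht)) h
  rw [e1, map_sum, map_sum, map_sum]
  have e2 : ∀ j, cellAvg T n k X (inclL1 T s X (P (stepLr hT s n X (Pi.single j (f j)))))
      = if j ≤ k then gridEntry hT P n (k - j) (f j) else 0 := by
    intro j
    have hm := mesh_pos hT n
    have h1 := hP.shift hT hA (by positivity : 0 ≤ j * mesh T n)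
      (stepLr_single_eq_shift (s := s) hT n j (f j))
    rw [cellAvg_inclL1, integral_congr_ae (ae_restrict_of_ae h1), setIntegral_cell_shiftFun hT hk]
    split_ifs
    · rw [gridEntry_apply, cellAvg_inclL1]
    · rw [smul_zero]
  simp only [e2]
  rw [← Finset.sum_filter, toeplitz]
  refine Finset.sum_congr ?_ fun j _ => rfl
  ext j
  simp only [Finset.mem_range, Finset.mem_filter]
  omega

/-- Cell averaging does not increase the `L^s` norm, and the factor `mesh T n` relating `ℓ^s` to
step functions cancels. The bound is therefore independent of `n`. -/
theorem IsDerivOp.toeplitzBound (hP : IsDerivOp T s i A P) (hT : 0 < T)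
    (hA : HasMaxRegExp T s i A) (n : ℕ) :
    ToeplitzBound (s : ℝ) (‖P‖ ^ (s : ℝ)) (2 ^ n) (gridEntry hT P n) := by
  intro f
  have hs : (0 : ℝ) < s := zero_lt_one.trans s.2
  have hm := mesh_pos hT n
  have h1 := sum_norm_cellAvg_rpow_le hT n (P (stepLr hT s n X f))
  have h2 : ‖P (stepLr hT s n X f)‖ ^ (s : ℝ) ≤ ‖P‖ ^ (s : ℝ) * ‖stepLr hT s n X f‖ ^ (s : ℝ) := by
    rw [← Real.mul_rpow (norm_nonneg _) (norm_nonneg _)]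
    exact Real.rpow_le_rpow (norm_nonneg _) (P.le_opNorm _) hs.le
  rw [norm_stepLr_rpow] at h2
  have h3 := h1.trans h2
  rw [← Finset.mul_sum, ← Finset.mul_sum, mul_left_comm] at h3
  have h4 := le_of_mul_le_mul_left h3 hm
  refine le_trans (le_of_eq ?_) h4
  refine Finset.sum_congr rfl fun k hk => ?_
  rw [hP.cellAvg_stepLr hT hA (Finset.mem_range.1 hk)]

/-- The bound for the iterates of the solution operator on constants. -/
def iterBound (c : ℝ) (n : ℕ) : ℝ := n * c ^ (n + 1) + (n + 1) * c ^ n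

theorem iterBound_nonneg {c : ℝ} (hc : 0 ≤ c) (n : ℕ) : 0 ≤ iterBound c n := by
  unfold iterBound; positivity

/-- Take `z = 2 * P³ x - P² x` on the constant `x`. The cases `n = 2` and `n = 1` of
`IsDerivOp.mul_id_iterate` give the two means, and `IsDerivOp.norm_iterate_le` bounds `z`. -/
theorem IsDerivOp.exists_mean_mean (hP : IsDerivOp T s i A P) (hT : 0 < T)
    (hA : HasMaxRegExp T s i A) (x : X) :
    ∃ z : ℝ → X, Integrable z (volJ T) ∧
      (∀ᵐ t ∂(volJ T), ‖z t‖ ≤ (2 * iterBound ‖P‖ 3 + iterBound ‖P‖ 2) * ‖x‖) ∧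
      P (constLr hT s x) =ᵐ[volJ T] meanFun (meanFun z) := by
  have h1 := hP.mul_id_iterate hT hA x 1
  have h2 := hP.mul_id_iterate hT hA x 2
  have b2 := hP.norm_iterate_le hT hA x 2
  have b3 := hP.norm_iterate_le hT hA x 3
  set z : LrJ T s X := ((2 : ℕ) : ℂ) • (P ^ (2 + 1)) (constLr hT s x)
    - (((2 : ℕ) : ℂ) - 1) • (P ^ 2) (constLr hT s x) with hz
  have e1 : (((1 : ℕ) : ℂ) • (P ^ (1 + 1)) (constLr hT s x)
      - (((1 : ℕ) : ℂ) - 1) • (P ^ 1) (constLr hT s x) : LrJ T s X) = (P ^ 2) (constLr hT s x) := by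
    simp
  rw [e1] at h1
  have m2 : (P ^ 2) (constLr hT s x) =ᵐ[volJ T] meanFun z := by
    filter_upwards [h2, ae_volJ_mem T] with t h ht
    rw [meanFun, ← h, smul_smul, inv_mul_cancel₀ ht.1.ne', one_smul]
  refine ⟨z, LrJ.integrable z, ?_, ?_⟩
  · filter_upwards [b2, b3, Lp.coeFn_sub (((2 : ℕ) : ℂ) • (P ^ (2 + 1)) (constLr hT s x))
      ((((2 : ℕ) : ℂ) - 1) • (P ^ 2) (constLr hT s x)),
      Lp.coeFn_smul ((2 : ℕ) : ℂ) ((P ^ (2 + 1)) (constLr hT s x)),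
      Lp.coeFn_smul (((2 : ℕ) : ℂ) - 1) ((P ^ 2) (constLr hT s x))] with t a1 a2 a3 a4 a5
    rw [hz, a3, Pi.sub_apply, a4, a5, Pi.smul_apply, Pi.smul_apply]
    refine (norm_sub_le _ _).trans ?_
    rw [norm_smul, norm_smul]
    have c1 : ‖((2 : ℕ) : ℂ)‖ = 2 := by simp
    have c2 : ‖((2 : ℕ) : ℂ) - 1‖ = 1 := by norm_num
    rw [c1, c2, add_mul, mul_assoc]
    have a1' : ‖(P ^ 2) (constLr hT s x) t‖ ≤ iterBound ‖P‖ 2 * ‖x‖ := a1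
    have a2' : ‖(P ^ (2 + 1)) (constLr hT s x) t‖ ≤ iterBound ‖P‖ 3 * ‖x‖ := a2
    linarith
  · filter_upwards [h1, ae_volJ_mem T] with t h ht
    have hm := Ioo_subset_Icc_self ht
    rw [primitive_congr m2 hm, pow_one] at h
    rw [meanFun, ← h, smul_smul, inv_mul_cancel₀ ht.1.ne', one_smul]

/-- The indicator of the first cell is one minus its translate by one cell. Thus the entries of the
matrix are first differences, and their increments second differences, of the cell means of `P` on a
constant. -/
theorem firstStep_eq (hT : 0 < T) (n : ℕ) (x : X) :
    ∃ g : LrJ T s X, g =ᵐ[volJ T] shiftFun T (mesh T n) (constLr hT s x) ∧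
      firstStep hT s n X x = constLr hT s x - g := by
  have hm := mesh_pos hT n
  have hmem := memLp_shiftFun (mesh T n) (Lp.memLp (constLr hT s x))
  refine ⟨hmem.toLp _, hmem.coeFn_toLp, Lp.ext ?_⟩
  have h0 : firstStep hT s n X x =ᵐ[volJ T] stepFun T n (Pi.single 0 x) :=
    stepLr_coe hT s n (Pi.single 0 x)
  filter_upwards [h0, Lp.coeFn_sub (constLr hT s x) (hmem.toLp _), hmem.coeFn_toLp,
    constLr_coe hT s x, ae_restrict_of_ae (ae_shift (mesh T n) (constLr_coe hT s x)),
    ae_volJ_mem T, ae_restrict_of_ae (compl_mem_ae_iff.2 (measure_singleton (mesh T n)))]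
    with t h1 h2 h3 h4 h5 ht hne
  rw [h1, h2, Pi.sub_apply, h3, h4, shiftFun, stepFun]
  by_cases hlt : mesh T n < t
  · have hmem : t - mesh T n ∈ Ioo 0 T := ⟨by linarith, by linarith [ht.2]⟩
    rw [indicator_of_mem hmem, h5 hmem, sub_self, Pi.single_eq_of_ne]
    refine (Nat.floor_pos.2 ?_).ne'
    rw [le_div_iff₀ hm]; linarith
  · have hmem : t - mesh T n ∉ Ioo 0 T := fun h => hlt (by linarith [h.1])
    rw [indicator_of_notMem hmem, sub_zero]
    have : ⌊t / mesh T n⌋₊ = 0 := by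
      rw [Nat.floor_eq_zero, div_lt_one hm]
      exact lt_of_le_of_ne (not_lt.1 hlt) hne
    rw [this, Pi.single_eq_same]

end Discretization

end

/-! ### The kernel condition for the discretized operator. -/

section
section KernelDifference

variable {X : Type*} [NormedAddCommGroup X] [NormedSpace ℂ X] {T K : ℝ}

theorem setIntegral_cell_eq (hT : 0 < T) {n k : ℕ} (hk : k < 2 ^ n) (g : ℝ → X) :
    ∫ t in cell T n k, g t ∂(volJ T) = ∫ t in (k * mesh T n)..((k + 1) * mesh T n), g t := by
  have hm := mesh_pos hT n
  rw [restrict_cell hT hk, cell, integral_Ico_eq_integral_Ioc,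
    intervalIntegral.integral_of_le (by nlinarith)]

theorem cell_endpoints_mem (hT : 0 < T) {n k : ℕ} (hk : k < 2 ^ n) :
    (k : ℝ) * mesh T n ∈ Icc 0 T ∧ ((k : ℝ) + 1) * mesh T n ∈ Icc 0 T := by
  have hm := mesh_pos hT n
  have h1 : ((k : ℝ) + 1) ≤ 2 ^ n := by exact_mod_cast hk
  have h2 : ((k : ℝ) + 1) * mesh T n ≤ T := by
    calc ((k : ℝ) + 1) * mesh T n ≤ 2 ^ n * mesh T n := by gcongr
      _ = T := two_pow_mul_mesh T n
  exact ⟨⟨by positivity, by linarith⟩, ⟨by positivity, h2⟩⟩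

theorem norm_cell_mean_le (hT : 0 < T) {n k : ℕ} (hk : k < 2 ^ n) {g : ℝ → X}
    (hg : ∀ᵐ t ∂(volJ T), ‖g t‖ ≤ K) :
    ‖(mesh T n)⁻¹ • ∫ t in cell T n k, g t ∂(volJ T)‖ ≤ K := by
  have hm := mesh_pos hT n
  obtain ⟨h1, h2⟩ := cell_endpoints_mem hT hk
  have h := norm_integral_le_of_ae_bound hg h1.1 (by linarith : (k : ℝ) * mesh T n ≤ (k + 1) * mesh T n) h2.2
  rw [setIntegral_cell_eq hT hk, norm_smul, norm_inv, Real.norm_of_nonneg hm.le,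
    inv_mul_le_iff₀ hm]
  linarith

/-- Translating the outer cells onto the middle one gives the mean of a pointwise second difference
with step `h = mesh T n`. On that cell `t - h` is at least `(m + 1) * h`, so the step cancels and
the bound does not depend on the grid. -/
theorem norm_cell_mean_second_difference_le [CompleteSpace X] (hT : 0 < T) (hK : 0 ≤ K)
    {z : ℝ → X} (hzi : Integrable z (volJ T)) (hz : ∀ᵐ t ∂(volJ T), ‖z t‖ ≤ K) {n m : ℕ}
    (hm2 : m + 3 < 2 ^ n) :
    ‖(mesh T n)⁻¹ • (∫ t in cell T n (m + 3), meanFun (meanFun z) t ∂(volJ T))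
      - (mesh T n)⁻¹ • (∫ t in cell T n (m + 2), meanFun (meanFun z) t ∂(volJ T))
      - ((mesh T n)⁻¹ • (∫ t in cell T n (m + 2), meanFun (meanFun z) t ∂(volJ T))
        - (mesh T n)⁻¹ • (∫ t in cell T n (m + 1), meanFun (meanFun z) t ∂(volJ T)))‖
      ≤ 6 * K / (m + 1) ^ 2 := by
  set Q := meanFun (meanFun z) with hQ
  have hQi : Integrable Q (volJ T) :=
    integrable_meanFun (integrable_meanFun hzi hz) (ae_norm_meanFun_le hz)
  have hh := mesh_pos hT n
  set h := mesh T n with hdef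
  have hint : ∀ k : ℕ, k < 2 ^ n → IntervalIntegrable Q volume (k * h) ((k + 1) * h) := fun k hk =>
    intervalIntegrable_of_integrable_volJ hQi (cell_endpoints_mem hT hk).1
      (cell_endpoints_mem hT hk).2
  have e1 := intervalIntegral.integral_comp_add_right (a := ((m + 2 : ℕ) : ℝ) * h)
    (b := (((m + 2 : ℕ) : ℝ) + 1) * h) Q h
  have e2 := intervalIntegral.integral_comp_sub_right (a := ((m + 2 : ℕ) : ℝ) * h)
    (b := (((m + 2 : ℕ) : ℝ) + 1) * h) Q h
  have i1 := (hint (m + 3) hm2).comp_add_right h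
  have i2 := (hint (m + 1) (by omega)).comp_sub_right h
  have i0 := hint (m + 2) (by omega)
  push_cast at e1 e2 i0 i1 i2
  have a1 : ((m : ℝ) + 2) * h + h = (m + 3) * h := by ring
  have a2 : ((m : ℝ) + 2 + 1) * h + h = (m + 3 + 1) * h := by ring
  have a3 : ((m : ℝ) + 2) * h - h = (m + 1) * h := by ring
  have a4 : ((m : ℝ) + 2 + 1) * h - h = (m + 1 + 1) * h := by ring
  have a5 : ((m : ℝ) + 3) * h - h = (m + 2) * h := by ring
  have a6 : ((m : ℝ) + 3 + 1) * h - h = (m + 2 + 1) * h := by ring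
  have a7 : ((m : ℝ) + 1) * h + h = (m + 2) * h := by ring
  have a8 : ((m : ℝ) + 1 + 1) * h + h = (m + 2 + 1) * h := by ring
  rw [a1, a2] at e1
  rw [a3, a4] at e2
  rw [a5, a6] at i1
  rw [a7, a8] at i2
  rw [setIntegral_cell_eq hT hm2, setIntegral_cell_eq hT (by omega), setIntegral_cell_eq hT (by omega)]
  push_cast
  rw [← hdef, ← e1, ← e2, ← smul_sub, ← smul_sub, ← smul_sub, ← intervalIntegral.integral_sub i1 i0,
    ← intervalIntegral.integral_sub i0 i2, ← intervalIntegral.integral_sub (i1.sub i0) (i0.sub i2)]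
  have hend := (cell_endpoints_mem hT hm2).2.2
  push_cast at hend
  have hle : ((m : ℝ) + 2) * h ≤ (m + 2 + 1) * h := by nlinarith
  have hb := intervalIntegral.norm_integral_le_of_norm_le_const_ae (a := ((m : ℝ) + 2) * h)
    (b := (m + 2 + 1) * h) (C := 6 * K / (m + 1) ^ 2)
    (f := fun t => Q (t + h) - Q t - (Q t - Q (t - h))) ?_
  · rw [norm_smul, norm_inv, Real.norm_of_nonneg hh.le, inv_mul_le_iff₀ hh]
    refine hb.trans_eq ?_
    rw [abs_of_nonneg (by linarith)]
    ring
  · rw [uIoc_of_le hle]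
    filter_upwards [compl_mem_ae_iff.2 (measure_singleton (((m : ℝ) + 2 + 1) * h))] with t ht hmem
    have ht1 : t < (m + 2 + 1) * h := lt_of_le_of_ne hmem.2 ht
    have ht2 : (m + 1) * h < t - h := by linarith [hmem.1]
    have hm0 : 0 < (m + 1) * h := by positivity
    have := norm_second_difference_le hK hzi hz hh (hm0.trans ht2) (t := t) (by linarith)
    refine this.trans ?_
    calc 6 * K * h ^ 2 / (t - h) ^ 2 ≤ 6 * K * h ^ 2 / ((m + 1) * h) ^ 2 := by gcongr
      _ = 6 * K / (m + 1) ^ 2 := by field_simp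

variable {D : Type*} [NormedAddCommGroup D] [NormedSpace ℂ D] [CompleteSpace D] [CompleteSpace X]
  {s : Exponent} {i A : D →L[ℂ] X} {P : LrJ T s X →L[ℂ] LrJ T s X}

theorem IsDerivOp.gridEntry_eq (hP : IsDerivOp T s i A P) (hT : 0 < T)
    (hA : HasMaxRegExp T s i A) {n m : ℕ} (hm : m < 2 ^ n) (x : X) {Q : ℝ → X}
    (hQ : P (constLr hT s x) =ᵐ[volJ T] Q) :
    gridEntry hT P n m x = (mesh T n)⁻¹ • (∫ t in cell T n m, Q t ∂(volJ T))
      - if 1 ≤ m then (mesh T n)⁻¹ • (∫ t in cell T n (m - 1), Q t ∂(volJ T)) else 0 := by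
  obtain ⟨g, hg, he⟩ := firstStep_eq (s := s) hT n x
  have hsh := hP.shift hT hA (mesh_pos hT n).le hg
  have hc := setIntegral_cell_shiftFun hT (j := 1) hm (P (constLr hT s x))
  rw [Nat.cast_one, one_mul] at hc
  rw [gridEntry_apply, he, map_sub, map_sub, map_sub, cellAvg_inclL1, cellAvg_inclL1,
    integral_congr_ae (ae_restrict_of_ae hsh), hc, integral_congr_ae (ae_restrict_of_ae hQ),
    integral_congr_ae (ae_restrict_of_ae hQ)]
  split_ifs <;> simp

theorem IsDerivOp.norm_gridEntry_sub_le (hP : IsDerivOp T s i A P) (hT : 0 < T)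
    (hA : HasMaxRegExp T s i A) : ∃ C : ℝ, 0 ≤ C ∧ ∀ n m : ℕ, m + 1 < 2 ^ n →
      ‖gridEntry hT P n (m + 1) - gridEntry hT P n m‖ ≤ C / (m + 1) ^ 2 := by
  set K := 2 * iterBound ‖P‖ 3 + iterBound ‖P‖ 2 with hK
  have hK0 : 0 ≤ K := by
    have h3 := iterBound_nonneg (norm_nonneg P) 3
    have h2 := iterBound_nonneg (norm_nonneg P) 2
    positivity
  -- The constant is `6 * 9`: the second difference estimate loses two in the index, and `m + 3 ≤ 3
  -- * (m + 1)`. The first two entries are too close to zero for that estimate and use only the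
  -- boundedness of the means.
  refine ⟨54 * K, by positivity, fun n m hmn => ContinuousLinearMap.opNorm_le_bound _ (by positivity)
    fun x => ?_⟩
  obtain ⟨z, hzi, hz, hq⟩ := hP.exists_mean_mean hT hA x
  rw [← hK] at hz
  have hKx : 0 ≤ K * ‖x‖ := by positivity
  have hQb : ∀ᵐ t ∂(volJ T), ‖meanFun (meanFun z) t‖ ≤ K * ‖x‖ :=
    ae_norm_meanFun_le (ae_norm_meanFun_le hz)
  have hb := fun k (hk : k < 2 ^ n) => norm_cell_mean_le hT hk hQb
  rw [sub_apply, hP.gridEntry_eq hT hA hmn x hq, hP.gridEntry_eq hT hA (by omega) x hq]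
  rcases m with _ | _ | m
  · have h0 := hb 0 (by omega)
    have h1 := hb 1 (by omega)
    rw [if_pos le_rfl, if_neg (by omega), sub_zero]
    simp only [zero_add, Nat.sub_self]
    simp only [Nat.cast_zero, zero_add, one_pow, div_one]
    refine (norm_sub_le _ _).trans ?_
    refine (add_le_add_left (norm_sub_le _ _) _).trans ?_
    linarith [mul_assoc 54 K ‖x‖]
  · have h0 := hb 0 (by omega)
    have h1 := hb 1 (by omega)
    have h2 := hb 2 (by omega)
    simp only [zero_add, le_refl, if_true, Nat.sub_self, Nat.reduceAdd, Nat.one_le_ofNat,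
      Nat.add_one_sub_one]
    push_cast
    have e : 54 * K / (1 + 1) ^ 2 * ‖x‖ = 54 / 4 * (K * ‖x‖) := by ring
    rw [e]
    refine (norm_sub_le _ _).trans ?_
    refine (add_le_add (norm_sub_le _ _) (norm_sub_le _ _)).trans ?_
    linarith
  · have h := norm_cell_mean_second_difference_le hT hKx hzi hz (m := m) (n := n) (by omega)
    rw [if_pos (by omega), if_pos (by omega)]
    refine h.trans ?_
    push_cast
    have h1 : ((m : ℝ) + 1 + 1 + 1) ≤ 3 * (m + 1) := by
      have : (0 : ℝ) ≤ m := by positivity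
      linarith
    calc 6 * (K * ‖x‖) / ((m : ℝ) + 1) ^ 2 = 54 * K * ‖x‖ / (3 * (m + 1)) ^ 2 := by
          field_simp; ring
      _ ≤ 54 * K * ‖x‖ / (m + 1 + 1 + 1) ^ 2 := by gcongr
      _ = _ := by ring

end KernelDifference

end

/-! ### Approximate preimages and lifting through an embedding. -/

section
section Lifting

variable {A B V : Type*} [NormedAddCommGroup A] [NormedSpace ℂ A] [NormedAddCommGroup B]
  [NormedSpace ℂ B] [CompleteSpace B] [NormedAddCommGroup V] [NormedSpace ℂ V]

/-- Repeating the approximation on the remainders halves their norms each time, and the corrections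
form a geometric series in the complete space `B`. It reduces solvability and all embeddings between
interpolation spaces to step functions. -/
theorem exists_preimage_of_approx {j : B →L[ℂ] V} {i : A →L[ℂ] V} {C : ℝ}
    (h : ∀ a, ∃ b a', i a = j b + i a' ∧ ‖b‖ ≤ C * ‖a‖ ∧ ‖a'‖ ≤ ‖a‖ / 2) (a : A) :
    ∃ b, j b = i a ∧ ‖b‖ ≤ C * ‖a‖ * 2 := by
  choose b a' h1 h2 h3 using h
  set x : ℕ → A := fun n => a'^[n] a with hx
  have hC : ∀ y, 0 ≤ C * ‖y‖ := fun y => (norm_nonneg _).trans (h2 y)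
  have hx' : ∀ n, ‖x n‖ ≤ ‖a‖ * (1 / 2) ^ n := by
    intro n
    induction n with
    | zero => simp [hx]
    | succ n ih =>
      have e : x (n + 1) = a' (x n) := Function.iterate_succ_apply' _ _ _
      rw [e, pow_succ]
      linarith [h3 (x n)]
  have hb : ∀ n, ‖b (x n)‖ ≤ C * ‖a‖ * (1 / 2) ^ n := by
    intro n
    rcases (norm_nonneg a).eq_or_lt with h0 | h0
    · have hxn : ‖x n‖ = 0 := le_antisymm ((hx' n).trans_eq (by rw [← h0, zero_mul])) (norm_nonneg _)
      have := h2 (x n)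
      rw [hxn, mul_zero] at this
      exact this.trans (by have := hC a; positivity)
    · have hC0 : 0 ≤ C := nonneg_of_mul_nonneg_left (hC a) h0
      calc ‖b (x n)‖ ≤ C * ‖x n‖ := h2 _
        _ ≤ C * (‖a‖ * (1 / 2) ^ n) := by gcongr; exact hx' n
        _ = _ := by ring
  have hg := hasSum_geometric_two.mul_left (C * ‖a‖)
  have hs : Summable fun n => b (x n) := Summable.of_norm_bounded hg.summable hb
  refine ⟨∑' n, b (x n), ?_, tsum_of_norm_bounded hg hb⟩
  have t1 := (j.continuous.tendsto _).comp hs.hasSum.tendsto_sum_nat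
  have e : ∀ n, j (∑ k ∈ Finset.range n, b (x k)) = i a - i (x n) := by
    intro n
    induction n with
    | zero => simp [hx]
    | succ n ih =>
      rw [Finset.sum_range_succ, map_add, ih]
      have e : x (n + 1) = a' (x n) := Function.iterate_succ_apply' _ _ _
      rw [e, h1 (x n)]
      abel
  have t2 : Tendsto x atTop (𝓝 0) := by
    refine squeeze_zero_norm hx' ?_
    have := (tendsto_pow_atTop_nhds_zero_of_lt_one (r := (1 / 2 : ℝ)) (by norm_num)
      (by norm_num)).const_mul ‖a‖
    rwa [mul_zero] at this
  have t3 : Tendsto (fun n => i a - i (x n)) atTop (𝓝 (i a)) := by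
    have := ((i.continuous.tendsto 0).comp t2).const_sub (i a)
    rwa [map_zero, sub_zero] at this
  exact tendsto_nhds_unique t1 (t3.congr fun n => (e n).symm)

/-- Factorization of an operator through an embedding. -/
theorem exists_lift {j : B →L[ℂ] V} (hj : Function.Injective j) {i : A →L[ℂ] V} {C : ℝ}
    (h : ∀ a, ∃ b a', i a = j b + i a' ∧ ‖b‖ ≤ C * ‖a‖ ∧ ‖a'‖ ≤ ‖a‖ / 2) :
    ∃ Λ : A →L[ℂ] B, ∀ a, j (Λ a) = i a := by
  choose Λ h1 h2 using exists_preimage_of_approx h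
  refine ⟨LinearMap.mkContinuous
    { toFun := Λ
      map_add' := fun a b => hj (by rw [map_add, h1, h1, h1, map_add])
      map_smul' := fun c a => hj (by rw [map_smul, h1, h1, map_smul]; rfl) } (2 * C)
    (fun a => (h2 a).trans_eq (by ring)), h1⟩

end Lifting

/-! ### Extrapolation of the derivative operator to `L^r`. -/

section Extrapolation

variable {D X : Type*}
  [NormedAddCommGroup D] [NormedSpace ℂ D] [CompleteSpace D]
  [NormedAddCommGroup X] [NormedSpace ℂ X] [CompleteSpace X]
  {T : ℝ} {s : Exponent} {i A : D →L[ℂ] X} {P : LrJ T s X →L[ℂ] LrJ T s X}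

theorem tendsto_gridProj_comp (hT : 0 < T) (P : LrJ T s X →L[ℂ] LrJ T s X) (f : LrJ T s X) :
    Tendsto (fun n => gridProj hT s n X (P (gridProj hT s n X f))) atTop (𝓝 (P f)) := by
  have t1 := tendsto_gridProj hT s (P f)
  have t2 := ((P.continuous.tendsto _).comp (tendsto_gridProj hT s f)).sub_const (P f)
  rw [sub_self] at t2
  have t3 : Tendsto (fun n => gridProj hT s n X (P (gridProj hT s n X f) - P f)) atTop (𝓝 0) :=
    squeeze_zero_norm (fun n => norm_gridProj_le hT s n _) (tendsto_zero_iff_norm_tendsto_zero.1 t2)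
  have t4 := t3.add t1
  rw [zero_add] at t4
  refine t4.congr fun n => ?_
  rw [map_sub, sub_add_cancel]

/-- The discretized operators converge in `L^s`, hence in measure, and obey an `L^r` bound
independent of the grid by `exists_toeplitzBound`. Fatou's lemma along an almost everywhere
convergent subsequence passes the bound to the limit. -/
theorem IsDerivOp.exists_extrapolation (hP : IsDerivOp T s i A P) (hT : 0 < T)
    (hA : HasMaxRegExp T s i A) (r : Exponent) : ∃ C : ℝ, 0 ≤ C ∧ ∀ (f : LrJ T s X) (g : LrJ T r X),
      g =ᵐ[volJ T] f → ∃ w : LrJ T r X, w =ᵐ[volJ T] P f ∧ ‖w‖ ≤ C * ‖g‖ := by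
  obtain ⟨C, hC, hCb⟩ := hP.norm_gridEntry_sub_le hT hA
  obtain ⟨K, hK, hKb⟩ := exists_toeplitzBound (X := X) r.2 s.2 hC
    (Real.rpow_nonneg (norm_nonneg P) (s : ℝ))
  have hr : (0 : ℝ) < r := zero_lt_one.trans r.2
  refine ⟨K ^ (1 / (r : ℝ)), by positivity, fun f g hfg => ?_⟩
  set y : ℕ → ℕ → X := fun n =>
    toeplitz (gridEntry hT P n) fun k => cellAvg T n k X (inclL1 T r X g) with hy
  have hfg1 : inclL1 T r X g = inclL1 T s X f :=
    Lp.ext ((inclL1_coe T r X g).trans (hfg.trans (inclL1_coe T s X f).symm))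
  have hb : ∀ n, ‖stepLr hT r n X (y n)‖ ≤ K ^ (1 / (r : ℝ)) * ‖g‖ := by
    intro n
    rw [← Real.rpow_le_rpow_iff (norm_nonneg _) (by positivity) hr, norm_stepLr_rpow,
      Real.mul_rpow (by positivity) (norm_nonneg _), ← Real.rpow_mul hK,
      one_div_mul_cancel hr.ne', Real.rpow_one]
    have h1 := hKb n _ (hCb n) (hP.toeplitzBound hT hA n)
      fun k => cellAvg T n k X (inclL1 T r X g)
    have h2 := sum_norm_cellAvg_rpow_le hT n g
    rw [← Finset.mul_sum] at h2 ⊢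
    refine le_trans ?_ (mul_le_mul_of_nonneg_left h2 hK)
    rw [mul_left_comm]
    exact mul_le_mul_of_nonneg_left h1 (mesh_pos hT n).le
  have he : ∀ n, gridProj hT s n X (P (gridProj hT s n X f)) =ᵐ[volJ T] stepLr hT r n X (y n) := by
    intro n
    rw [gridProj_apply, gridProj_apply]
    filter_upwards [stepLr_coe hT r n (y n), stepLr_coe hT s n fun k => cellAvg T n k X (inclL1 T s X
      (P (stepLr hT s n X fun k => cellAvg T n k X (inclL1 T s X f)))), ae_volJ_mem T] with t h1 h2 ht
    rw [h1, h2, stepFun, stepFun, hP.cellAvg_stepLr hT hA (floor_lt hT ht), hy, hfg1]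
  have hm := (tendstoInMeasure_of_tendsto_Lp (tendsto_gridProj_comp hT P f)).congr_left he
  obtain ⟨ns, -, hns⟩ := hm.exists_seq_tendsto_ae
  have hlim : eLpNorm (P f) (ENNReal.ofReal (r : ℝ)) (volJ T)
      ≤ ENNReal.ofReal (K ^ (1 / (r : ℝ)) * ‖g‖) := by
    refine (Lp.eLpNorm_lim_le_liminf_eLpNorm (fun n => Lp.aestronglyMeasurable _) _ hns).trans ?_
    refine liminf_le_of_frequently_le' (Eventually.of_forall fun n => ?_).frequently
    rw [← Lp.enorm_def, ← ofReal_norm]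
    exact ENNReal.ofReal_le_ofReal (hb _)
  have hmem : MemLp (P f) (ENNReal.ofReal (r : ℝ)) (volJ T) :=
    ⟨Lp.aestronglyMeasurable _, hlim.trans_lt ENNReal.ofReal_lt_top⟩
  refine ⟨hmem.toLp _, hmem.coeFn_toLp, ?_⟩
  rw [Lp.norm_toLp]
  exact ENNReal.toReal_le_of_le_ofReal (by positivity) hlim

end Extrapolation

end

/-! ### Maximal regularity for all exponents. -/

section
section AllExponents

variable {D X : Type*}
  [NormedAddCommGroup D] [NormedSpace ℂ D] [CompleteSpace D]
  [NormedAddCommGroup X] [NormedSpace ℂ X] [CompleteSpace X]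
  {T : ℝ} {i A : D →L[ℂ] X}

/-- The map onto the graph is injective with closed range, so the open mapping theorem makes the
graph norm dominate the norm of `D`. -/
theorem exists_norm_le_of_isClosed (hi : Function.Injective i)
    (hc : IsClosed (range fun d : D => (i d, A d))) :
    ∃ c : ℝ, 0 ≤ c ∧ ∀ d, ‖d‖ ≤ c * ‖(i d, A d)‖ := by
  obtain ⟨K, hK⟩ := ContinuousLinearMap.antilipschitz_of_injective_of_isClosed_range
    (i.prod A) (fun a b hab => hi (congrArg Prod.fst hab)) hc
  exact ⟨K, K.2, fun d => hK.le_mul_norm (map_zero _) d⟩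

theorem exists_volterra_bound (T : ℝ) (r : Exponent) : ∃ C : ℝ, 0 ≤ C ∧ ∀ w : LrJ T r X,
    ∃ W : LrJ T r X, inclL1 T r X W = volterra T X (inclL1 T r X w) ∧ ‖W‖ ≤ C * ‖w‖ := by
  set c := (volJ T).real univ ^ (ENNReal.ofReal (r : ℝ)).toReal⁻¹ with hc
  refine ⟨c * ‖inclL1 T r X‖, by positivity, fun w => ?_⟩
  obtain ⟨W, hW⟩ := exists_inclL1_eq_volterra r (inclL1 T r X w)
  refine ⟨W, hW, ?_⟩
  have hb : ∀ᵐ t ∂(volJ T), ‖W t‖ ≤ ‖inclL1 T r X w‖ := by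
    filter_upwards [inclL1_coe T r X W, Lp.ext_iff.1 hW, volterra_coe (inclL1 T r X w), ae_volJ_mem T]
      with t h1 h2 h3 ht
    rw [← h1, h2, h3]
    refine (norm_primitive_le (L1.integrable_coeFn _) (Ioo_subset_Icc_self ht)).trans_eq ?_
    rw [L1.norm_eq_integral_norm]
  have := Lp.norm_le_of_ae_bound (norm_nonneg _) hb
  refine this.trans ?_
  rw [mul_assoc]
  exact mul_le_mul_of_nonneg_left ((inclL1 T r X).le_opNorm w) (by positivity)

/-- Maximal parabolic regularity does not depend on the exponent. -/
theorem HasMaxReg.hasMaxRegExp (hT : 0 < T) (hi : Function.Injective i) (h : HasMaxReg T i A)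
    (r : Exponent) : HasMaxRegExp T r i A := by
  obtain ⟨hc, s, hs⟩ := h
  rw [hasMaxRegExp_iff]
  constructor
  · refine (injective_iff_map_eq_zero _).2 fun u hu => ?_
    have h1 := MR.compLpL_fnL hT u
    have h2 : inclL1 T r X (MRSpace.derivL T r i _ u)
        + A.compLpL 1 (volJ T) (inclL1 T r D (MRSpace.fnL T r i _ u)) = 0 := by
      rw [← inclL1_compLpL, ← map_add]
      exact (congrArg _ hu).trans (map_zero _)
    obtain ⟨h3, h4⟩ := hs.eq_zero hT h1 h2
    refine Subtype.ext ((WithLp.ofLp_injective 1) (Prod.ext ?_ ?_))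
    · exact inclL1_injective T r (h3.trans (map_zero _).symm)
    · exact inclL1_injective T r (h4.trans (map_zero _).symm)
  · obtain ⟨P, hP⟩ := hs.exists_isDerivOp hT
    obtain ⟨C, hC, hCb⟩ := hP.exists_extrapolation hT hs r
    obtain ⟨c, hc0, hcb⟩ := exists_norm_le_of_isClosed hi hc
    obtain ⟨b, hb0, hb⟩ := exists_volterra_bound (X := X) T r
    have := completeSpace_MR hT r i
    set M := c * (b * C + 1 + C) + C with hM
    -- A step function close to `f` lies in `L^s` as well as in `L^r`, so its solution exists by the
    -- assumed regularity, and extrapolation bounds that solution in `L^r`.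
    have key : ∀ f : LrJ T r X, ∃ (u : MR T r i) (f' : LrJ T r X),
        ContinuousLinearMap.id ℂ _ f = parabolic T r i A u + ContinuousLinearMap.id ℂ _ f' ∧
          ‖u‖ ≤ M * 2 * ‖f‖ ∧ ‖f'‖ ≤ ‖f‖ / 2 := by
      intro f
      rcases (norm_nonneg f).eq_or_lt with h0 | h0
      · have : f = 0 := norm_eq_zero.1 h0.symm
        exact ⟨0, 0, by simp [this], by simp [this], by simp [this]⟩
      obtain ⟨n, hn⟩ := (Metric.tendsto_atTop.1 (tendsto_gridProj hT r f) (‖f‖ / 2) (by positivity))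
      have hn := hn n le_rfl
      rw [dist_comm, dist_eq_norm] at hn
      set g := gridProj hT r n X f with hg
      set x : ℕ → X := fun k => cellAvg T n k X (inclL1 T r X f) with hx
      have hgr : g =ᵐ[volJ T] stepLr hT s n X x :=
        (stepLr_coe hT r n x).trans (stepLr_coe hT s n x).symm
      have hgn : ‖g‖ ≤ ‖f‖ := norm_gridProj_le hT r n f
      obtain ⟨w, hw, hwb⟩ := hCb _ _ hgr
      obtain ⟨u, hu, hu1, hu2⟩ := hP (stepLr hT s n X x)
      obtain ⟨W, hW, hWb⟩ := hb w
      -- An `L^r` representative of the graph `(i u, A u)`: the first entry is the primitive of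
      -- `u'`, the second is the right-hand side minus `u'`. Closedness then places `u` in `L^r(J;
      -- D)`.
      set p : LrJ T r (X × X) := (ContinuousLinearMap.inl ℂ X X).compLpL _ _ W
        + (ContinuousLinearMap.inr ℂ X X).compLpL _ _ (g - w) with hp
      have hWu : ∀ᵐ t ∂(volJ T), W t = i (u t) := by
        filter_upwards [inclL1_coe T r X W, Lp.ext_iff.1 hW, volterra_coe (inclL1 T r X w), hu1,
          ae_volJ_mem T] with t h1 h2 h3 h4 ht
        rw [← h1, h2, h3, h4]
        exact primitive_congr ((inclL1_coe T r X w).trans hw) (Ioo_subset_Icc_self ht)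
      have hup : ∀ᵐ t ∂(volJ T), p t = (i (u t), A (u t)) := by
        filter_upwards [hWu, Lp.coeFn_add ((ContinuousLinearMap.inl ℂ X X).compLpL _ _ W)
          ((ContinuousLinearMap.inr ℂ X X).compLpL _ _ (g - w)),
          compLpL_coe (ContinuousLinearMap.inl ℂ X X) W,
          compLpL_coe (ContinuousLinearMap.inr ℂ X X) (g - w), Lp.coeFn_sub g w, hgr, hw, hu2]
          with t h1 h2 h3 h4 h5 h6 h7 h8
        rw [hp, h2, Pi.add_apply, h3, h4, h5, Pi.sub_apply, h6, h7, h1, ← h8]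
        simp
      have hub : ∀ᵐ t ∂(volJ T), ‖u t‖ ≤ c * ‖p t‖ := by
        filter_upwards [hup] with t ht
        rw [ht]
        exact hcb _
      have hmem : MemLp u (ENNReal.ofReal (r : ℝ)) (volJ T) :=
        (Lp.memLp p).of_le_mul hu.aestronglyMeasurable hub
      set U : LrJ T r D := hmem.toLp u with hU
      have hUu : U =ᵐ[volJ T] u := hmem.coeFn_toLp
      have hUn : ‖U‖ ≤ c * ‖p‖ := by
        refine Lp.norm_le_mul_norm_of_ae_le_mul ?_
        filter_upwards [hub, hUu] with t h1 h2
        rwa [h2]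
      have hpn : ‖p‖ ≤ ‖W‖ + ‖g - w‖ := by
        refine (norm_add_le _ _).trans (add_le_add ?_ ?_)
        · refine (Lp.norm_le_norm_of_ae_le ?_)
          filter_upwards [compLpL_coe (ContinuousLinearMap.inl ℂ X X) W] with t ht
          rw [ht]; simp
        · refine (Lp.norm_le_norm_of_ae_le ?_)
          filter_upwards [compLpL_coe (ContinuousLinearMap.inr ℂ X X) (g - w)] with t ht
          rw [ht]; simp
      have hprim : i.compLpL 1 (volJ T) (inclL1 T r D U) = volterra T X (inclL1 T r X w) := by
        rw [← hW]
        refine Lp.ext ?_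
        filter_upwards [compLpL_coe i (inclL1 T r D U), inclL1_coe T r D U, hUu, inclL1_coe T r X W,
          hWu] with t h1 h2 h3 h4 h5
        rw [h1, h2, h3, h4, h5]
      refine ⟨MR.mk hT i U w hprim, f - g, ?_, ?_, hn.le⟩
      · have e : parabolic T r i A (MR.mk hT i U w hprim) = g := by
          rw [parabolic_eq_iff]
          change ∀ᵐ t ∂(volJ T), w t + A (U t) = g t
          filter_upwards [hw, hUu, hgr, hu2] with t h1 h2 h3 h4
          rw [h1, h2, h3, h4]
        rw [e]
        simp
      · have e : ‖MR.mk hT i U w hprim‖ = ‖U‖ + ‖w‖ := by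
          change ‖WithLp.toLp 1 (U, w)‖ = _
          exact WithLp.prod_norm_eq_of_L1 _
        have h1 : ‖w‖ ≤ C * ‖f‖ := hwb.trans (by gcongr)
        have h2 : ‖W‖ ≤ b * C * ‖f‖ := hWb.trans (by rw [mul_assoc]; gcongr)
        have h3 : ‖g - w‖ ≤ (1 + C) * ‖f‖ := (norm_sub_le _ _).trans (by linarith)
        have h4 : ‖U‖ ≤ c * ((b * C + 1 + C) * ‖f‖) := by
          refine hUn.trans (mul_le_mul_of_nonneg_left ?_ hc0)
          linarith
        have hM0 : 0 ≤ M * ‖f‖ := by positivity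
        rw [e]
        calc ‖U‖ + ‖w‖ ≤ c * ((b * C + 1 + C) * ‖f‖) + C * ‖f‖ := add_le_add h4 h1
          _ = M * ‖f‖ := by rw [hM]; ring
          _ ≤ M * 2 * ‖f‖ := by linarith
    intro f
    obtain ⟨u, hu, -⟩ := exists_preimage_of_approx key f
    exact ⟨u, hu⟩

end AllExponents

end

/-! ### Functions vanishing at infinity. -/

section
section VanishingFunctions

variable {A B : Type*} [NormedAddCommGroup A] [NormedSpace ℂ A] [NormedAddCommGroup B]
  [NormedSpace ℂ B]

theorem norm_apply_le_of_zeroAtInfty (f : C₀(ℝ, A)) (t : ℝ) : ‖f t‖ ≤ ‖f‖ :=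
  f.toBCF.norm_coe_le_norm t

theorem zeroAtInfty_norm_le {f : C₀(ℝ, A)} {M : ℝ} (hM : 0 ≤ M) : ‖f‖ ≤ M ↔ ∀ t, ‖f t‖ ≤ M :=
  BoundedContinuousFunction.norm_le (f := f.toBCF) hM

/-- Composition with a continuous linear map. -/
def zeroAtInftyMap (S : A →L[ℂ] B) : C₀(ℝ, A) →L[ℂ] C₀(ℝ, B) :=
  LinearMap.mkContinuous
    { toFun := fun f => ⟨⟨fun t => S (f t), S.continuous.comp f.continuous⟩, by
        have := (S.continuous.tendsto 0).comp f.zero_at_infty'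
        rwa [map_zero] at this⟩
      map_add' := fun f g => ZeroAtInftyContinuousMap.ext fun t => S.map_add _ _
      map_smul' := fun c f => ZeroAtInftyContinuousMap.ext fun t => S.map_smul _ _ } ‖S‖
    (fun f => (zeroAtInfty_norm_le (by positivity)).2 fun t =>
      (S.le_opNorm (f t)).trans (by gcongr; exact norm_apply_le_of_zeroAtInfty f t))

/-- Outside a compact set `f` is small, and the image of the compact set is covered by finitely many
small balls. Contractions that converge at the centres therefore converge uniformly on the range of
`f`. -/
theorem tendsto_zeroAtInftyMap {S : ℕ → A →L[ℂ] A} (hS : ∀ n a, ‖S n a‖ ≤ ‖a‖)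
    (hlim : ∀ a, Tendsto (fun n => S n a) atTop (𝓝 a)) (f : C₀(ℝ, A)) :
    Tendsto (fun n => zeroAtInftyMap (S n) f) atTop (𝓝 f) := by
  rw [Metric.tendsto_atTop]
  intro ε hε
  have h0 := f.zero_at_infty'.eventually (Metric.ball_mem_nhds 0 (by positivity : 0 < ε / 4))
  obtain ⟨K, hK, hKf⟩ := mem_cocompact.1 h0
  obtain ⟨s, -, hsf, hs⟩ := (hK.image f.continuous).finite_cover_balls (by positivity : 0 < ε / 4)
  have h1 : ∀ᶠ n in atTop, ∀ a ∈ s, ‖S n a - a‖ < ε / 4 := by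
    rw [eventually_all_finite hsf]
    intro a _
    have := (Metric.tendsto_atTop.1 (hlim a)) (ε / 4) (by positivity)
    simpa only [dist_eq_norm, eventually_atTop] using this
  obtain ⟨N, hN⟩ := eventually_atTop.1 h1
  refine ⟨N, fun n hn => ?_⟩
  rw [dist_eq_norm]
  refine lt_of_le_of_lt ((zeroAtInfty_norm_le (M := 3 * (ε / 4)) (by positivity)).2 fun t => ?_)
    (by linarith)
  change ‖S n (f t) - f t‖ ≤ _
  by_cases ht : t ∈ K
  · obtain ⟨a, ha, hta⟩ := mem_iUnion₂.1 (hs (mem_image_of_mem f ht))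
    rw [Metric.mem_ball, dist_eq_norm] at hta
    have e : S n (f t) - f t = S n (f t - a) + (S n a - a) - (f t - a) := by
      rw [map_sub]; abel
    rw [e]
    refine (norm_sub_le _ _).trans ?_
    refine (add_le_add_left (norm_add_le _ _) _).trans ?_
    have := hS n (f t - a)
    linarith [hN n hn a ha]
  · have h2 : ‖f t‖ < ε / 4 := by simpa using hKf ht
    refine (norm_sub_le _ _).trans ?_
    linarith [hS n (f t)]

theorem tendsto_smul_zeroAtInfty {φ : ℝ → ℂ} {C : ℝ} (hb : ∀ t, ‖φ t‖ ≤ C) (f : C₀(ℝ, A)) :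
    Tendsto (fun t => φ t • f t) (cocompact ℝ) (𝓝 0) := by
  have h0 := (tendsto_zero_iff_norm_tendsto_zero.1 f.zero_at_infty').const_mul C
  rw [mul_zero] at h0
  refine squeeze_zero_norm (fun t => ?_) h0
  rw [norm_smul]
  exact mul_le_mul_of_nonneg_right (hb t) (norm_nonneg _)

end VanishingFunctions

/-! ### Functoriality of complex interpolation. -/

section Functoriality

variable {A₀ A₁ V B₀ B₁ W : Type*}
  [NormedAddCommGroup A₀] [NormedSpace ℂ A₀] [NormedAddCommGroup A₁] [NormedSpace ℂ A₁]
  [NormedAddCommGroup V] [NormedSpace ℂ V]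
  [NormedAddCommGroup B₀] [NormedSpace ℂ B₀] [NormedAddCommGroup B₁] [NormedSpace ℂ B₁]
  [NormedAddCommGroup W] [NormedSpace ℂ W]
  {i₀ : A₀ →L[ℂ] V} {i₁ : A₁ →L[ℂ] V} {j₀ : B₀ →L[ℂ] W} {j₁ : B₁ →L[ℂ] W}

theorem sumMk_eq (p : WithLp 1 (A₀ × A₁)) :
    sumMk i₀ i₁ p = sumInl i₀ i₁ p.fst + sumInr i₀ i₁ p.snd := by
  refine Eq.trans (congrArg _ ?_) ((sumMk i₀ i₁).map_add (WithLp.toLp 1 (p.fst, (0 : A₁)))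
    (WithLp.toLp 1 ((0 : A₀), p.snd))).symm
  refine WithLp.ofLp_injective 1 (Prod.ext ?_ ?_)
  · simp
  · simp

theorem sumToAmbient_sumMk (p : WithLp 1 (A₀ × A₁)) :
    sumToAmbient i₀ i₁ (sumMk i₀ i₁ p) = i₀ p.fst + i₁ p.snd := rfl

theorem sumToAmbient_sumInl (a : A₀) : sumToAmbient i₀ i₁ (sumInl i₀ i₁ a) = i₀ a := by
  refine (sumToAmbient_sumMk _).trans ?_
  simp

theorem sumToAmbient_sumInr (a : A₁) : sumToAmbient i₀ i₁ (sumInr i₀ i₁ a) = i₁ a := by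
  refine (sumToAmbient_sumMk _).trans ?_
  simp

theorem sumToAmbient_injective (i₀ : A₀ →L[ℂ] V) (i₁ : A₁ →L[ℂ] V) :
    Function.Injective (sumToAmbient i₀ i₁) :=
  LinearMap.ker_eq_bot.1 (Submodule.ker_liftQ_eq_bot' _ _ rfl)

theorem interpToSum_injective (i₀ : A₀ →L[ℂ] V) (i₁ : A₁ →L[ℂ] V) (θ : Ioo (0 : ℝ) 1) :
    Function.Injective (interpToSum i₀ i₁ θ) :=
  LinearMap.ker_eq_bot.1 (Submodule.ker_liftQ_eq_bot' _ _ rfl)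

theorem interpToAmbient_injective (i₀ : A₀ →L[ℂ] V) (i₁ : A₁ →L[ℂ] V) (θ : Ioo (0 : ℝ) 1) :
    Function.Injective (interpToAmbient i₀ i₁ θ) :=
  (sumToAmbient_injective i₀ i₁).comp (interpToSum_injective i₀ i₁ θ)

/-- The class `f(θ)` of an element `f` of the Calderón space. -/
def interpMk (i₀ : A₀ →L[ℂ] V) (i₁ : A₁ →L[ℂ] V) (θ : Ioo (0 : ℝ) 1) :
    CalderonSpace i₀ i₁ →L[ℂ] Interp i₀ i₁ θ :=
  (evalKer i₀ i₁ θ).mkQL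

theorem norm_interpMk_le (θ : Ioo (0 : ℝ) 1) (F : CalderonSpace i₀ i₁) :
    ‖interpMk i₀ i₁ θ F‖ ≤ ‖F‖ :=
  Submodule.Quotient.norm_mk_le (S := evalKer i₀ i₁ θ) F

theorem exists_interpMk_eq (θ : Ioo (0 : ℝ) 1) (x : Interp i₀ i₁ θ) :
    ∃ F, interpMk i₀ i₁ θ F = x ∧ ‖F‖ ≤ 2 * ‖x‖ := by
  rcases (norm_nonneg x).eq_or_lt with h | h
  · refine ⟨0, ?_, ?_⟩
    · rw [map_zero, norm_eq_zero.1 h.symm]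
    · rw [norm_zero]; positivity
  · obtain ⟨F, hF, hn⟩ := Submodule.Quotient.norm_mk_lt (S := evalKer i₀ i₁ θ) x h
    refine ⟨F, hF, ?_⟩
    change ‖F‖ < ‖x‖ + ‖x‖ at hn
    linarith

theorem interpMk_eq_of_eval_eq (θ : Ioo (0 : ℝ) 1) {F G : CalderonSpace i₀ i₁}
    (h : F.1.1 (midPt θ) = G.1.1 (midPt θ)) : interpMk i₀ i₁ θ F = interpMk i₀ i₁ θ G :=
  interpToSum_injective i₀ i₁ θ h

/-- `S₀` and `S₁` agree on the intersection of `A₀` and `A₁`. -/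
def Compatible (i₀ : A₀ →L[ℂ] V) (i₁ : A₁ →L[ℂ] V) (j₀ : B₀ →L[ℂ] W) (j₁ : B₁ →L[ℂ] W)
    (S₀ : A₀ →L[ℂ] B₀) (S₁ : A₁ →L[ℂ] B₁) : Prop :=
  ∀ a b, i₀ a + i₁ b = 0 → j₀ (S₀ a) + j₁ (S₁ b) = 0

theorem Compatible.of_linearMap {S₀ : A₀ →L[ℂ] B₀} {S₁ : A₁ →L[ℂ] B₁} (S : V →ₗ[ℂ] W)
    (h₀ : ∀ a, j₀ (S₀ a) = S (i₀ a)) (h₁ : ∀ b, j₁ (S₁ b) = S (i₁ b)) :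
    Compatible i₀ i₁ j₀ j₁ S₀ S₁ := fun a b hab => by
  rw [h₀, h₁, ← map_add, hab, map_zero]

variable {S₀ : A₀ →L[ℂ] B₀} {S₁ : A₁ →L[ℂ] B₁}

/-- The map `S₀ + S₁`. -/
def sumMap (h : Compatible i₀ i₁ j₀ j₁ S₀ S₁) : SumSpace i₀ i₁ →L[ℂ] SumSpace j₀ j₁ :=
  let L : WithLp 1 (A₀ × A₁) →L[ℂ] SumSpace j₀ j₁ :=
    sumInl j₀ j₁ ∘L S₀ ∘L WithLp.fstL 1 ℂ A₀ A₁ + sumInr j₀ j₁ ∘L S₁ ∘L WithLp.sndL 1 ℂ A₀ A₁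
  { toLinearMap := (addKer i₀ i₁).liftQ L.toLinearMap (fun p hp => by
      refine sumToAmbient_injective j₀ j₁ ?_
      change sumToAmbient j₀ j₁ (sumInl j₀ j₁ (S₀ p.fst) + sumInr j₀ j₁ (S₁ p.snd)) = _
      rw [map_add, sumToAmbient_sumInl, sumToAmbient_sumInr, map_zero]
      exact h _ _ hp)
    cont := L.continuous.quotient_lift _ }

theorem sumMap_sumMk (h : Compatible i₀ i₁ j₀ j₁ S₀ S₁) (p : WithLp 1 (A₀ × A₁)) :
    sumMap h (sumMk i₀ i₁ p) = sumInl j₀ j₁ (S₀ p.fst) + sumInr j₀ j₁ (S₁ p.snd) := rfl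

theorem sumMap_sumInl (h : Compatible i₀ i₁ j₀ j₁ S₀ S₁) (a : A₀) :
    sumMap h (sumInl i₀ i₁ a) = sumInl j₀ j₁ (S₀ a) := by
  refine (sumMap_sumMk h _).trans ?_
  simp

theorem sumMap_sumInr (h : Compatible i₀ i₁ j₀ j₁ S₀ S₁) (a : A₁) :
    sumMap h (sumInr i₀ i₁ a) = sumInr j₀ j₁ (S₁ a) := by
  refine (sumMap_sumMk h _).trans ?_
  simp

theorem exists_sumMk_eq (x : SumSpace i₀ i₁) : ∃ a b, sumInl i₀ i₁ a + sumInr i₀ i₁ b = x := by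
  obtain ⟨p, hp⟩ := (addKer i₀ i₁).mkQ_surjective x
  exact ⟨p.fst, p.snd, (sumMk_eq p).symm.trans hp⟩

theorem sumToAmbient_sumMap (h : Compatible i₀ i₁ j₀ j₁ S₀ S₁) (S : V →ₗ[ℂ] W)
    (h₀ : ∀ a, j₀ (S₀ a) = S (i₀ a)) (h₁ : ∀ b, j₁ (S₁ b) = S (i₁ b)) (x : SumSpace i₀ i₁) :
    sumToAmbient j₀ j₁ (sumMap h x) = S (sumToAmbient i₀ i₁ x) := by
  obtain ⟨a, b, rfl⟩ := exists_sumMk_eq x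
  rw [map_add, map_add, map_add, sumMap_sumInl, sumMap_sumInr, sumToAmbient_sumInl,
    sumToAmbient_sumInr, sumToAmbient_sumInl, sumToAmbient_sumInr, h₀, h₁, map_add]

theorem differentiableOn_extend_iff {E : Type*} [NormedAddCommGroup E] [NormedSpace ℂ E]
    {f : ClosedStrip → E} {g : ℂ → E} (h : ∀ z : ClosedStrip, f z = g z) :
    DifferentiableOn ℂ (Function.extend Subtype.val f 0) OpenStrip ↔
      DifferentiableOn ℂ g OpenStrip := by
  refine differentiableOn_congr fun z hz => ?_
  exact (extend_coe f ⟨z, openStrip_subset hz⟩).trans (h _)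

/-- Composition of the elements of the Calderón space with `S₀ + S₁`. -/
def calderonMap (h : Compatible i₀ i₁ j₀ j₁ S₀ S₁) :
    CalderonSpace i₀ i₁ →L[ℂ] CalderonSpace j₀ j₁ :=
  ((((sumMap h).compLeftContinuousBounded ClosedStrip).prodMap
    ((zeroAtInftyMap S₀).prodMap (zeroAtInftyMap S₁))) ∘L (CalderonSpace i₀ i₁).subtypeL).codRestrict
    (CalderonSpace j₀ j₁) fun F => by
      obtain ⟨F, hF, hF0, hF1⟩ := F
      refine ⟨?_, fun t => ?_, fun t => ?_⟩
      · refine (differentiableOn_extend_iff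
          (g := fun z => sumMap h (Function.extend Subtype.val F.1 0 z)) fun z => ?_).2 ?_
        · rw [extend_coe]; rfl
        · exact (sumMap h).differentiable.comp_differentiableOn hF
      · exact (congrArg (sumMap h) (hF0 t)).trans (sumMap_sumInl h _)
      · exact (congrArg (sumMap h) (hF1 t)).trans (sumMap_sumInr h _)

/-- The map between the interpolation spaces induced by `S₀` and `S₁`. -/
def interpMap (h : Compatible i₀ i₁ j₀ j₁ S₀ S₁) (θ : Ioo (0 : ℝ) 1) :
    Interp i₀ i₁ θ →L[ℂ] Interp j₀ j₁ θ :=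
  let L := interpMk j₀ j₁ θ ∘L calderonMap h
  { toLinearMap := (evalKer i₀ i₁ θ).liftQ L.toLinearMap (fun F hF => by
      refine interpToSum_injective j₀ j₁ θ ?_
      change sumMap h (F.1.1 (midPt θ)) = interpToSum j₀ j₁ θ 0
      have : F.1.1 (midPt θ) = 0 := hF
      rw [this, map_zero, map_zero])
    cont := L.continuous.quotient_lift _ }

theorem interpMap_interpMk (h : Compatible i₀ i₁ j₀ j₁ S₀ S₁) (θ : Ioo (0 : ℝ) 1)
    (F : CalderonSpace i₀ i₁) :
    interpMap h θ (interpMk i₀ i₁ θ F) = interpMk j₀ j₁ θ (calderonMap h F) := rfl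

theorem interpToSum_interpMap (h : Compatible i₀ i₁ j₀ j₁ S₀ S₁) (θ : Ioo (0 : ℝ) 1)
    (x : Interp i₀ i₁ θ) :
    interpToSum j₀ j₁ θ (interpMap h θ x) = sumMap h (interpToSum i₀ i₁ θ x) := by
  obtain ⟨F, rfl, -⟩ := exists_interpMk_eq θ x
  rfl

theorem interpToAmbient_interpMap (h : Compatible i₀ i₁ j₀ j₁ S₀ S₁) (θ : Ioo (0 : ℝ) 1)
    (S : V →ₗ[ℂ] W) (h₀ : ∀ a, j₀ (S₀ a) = S (i₀ a)) (h₁ : ∀ b, j₁ (S₁ b) = S (i₁ b))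
    (x : Interp i₀ i₁ θ) :
    interpToAmbient j₀ j₁ θ (interpMap h θ x) = S (interpToAmbient i₀ i₁ θ x) := by
  rw [interpToAmbient, ContinuousLinearMap.comp_apply, interpToSum_interpMap,
    sumToAmbient_sumMap h S h₀ h₁]
  rfl

/-- The norm of the Calderón space sees only the two boundary functions, where
`tendsto_zeroAtInftyMap` applies; evaluation at `θ` is continuous. -/
theorem tendsto_interpMap {S₀ : ℕ → A₀ →L[ℂ] A₀} {S₁ : ℕ → A₁ →L[ℂ] A₁}
    (h : ∀ n, Compatible i₀ i₁ i₀ i₁ (S₀ n) (S₁ n))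
    (hS₀ : ∀ n a, ‖S₀ n a‖ ≤ ‖a‖) (hlim₀ : ∀ a, Tendsto (fun n => S₀ n a) atTop (𝓝 a))
    (hS₁ : ∀ n a, ‖S₁ n a‖ ≤ ‖a‖) (hlim₁ : ∀ a, Tendsto (fun n => S₁ n a) atTop (𝓝 a))
    (θ : Ioo (0 : ℝ) 1) (x : Interp i₀ i₁ θ) :
    Tendsto (fun n => interpMap (h n) θ x) atTop (𝓝 x) := by
  obtain ⟨F, rfl, -⟩ := exists_interpMk_eq θ x
  simp only [interpMap_interpMk]
  refine ((interpMk i₀ i₁ θ).continuous.tendsto F).comp ?_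
  have t0 := tendsto_iff_norm_sub_tendsto_zero.1 (tendsto_zeroAtInftyMap hS₀ hlim₀ F.1.2.1)
  have t1 := tendsto_iff_norm_sub_tendsto_zero.1 (tendsto_zeroAtInftyMap hS₁ hlim₁ F.1.2.2)
  rw [tendsto_iff_norm_sub_tendsto_zero]
  have := t0.max t1
  rw [max_self] at this
  refine this.congr fun n => ?_
  rw [calderon_norm_eq]
  rfl

/-- Multiplication of an element of the Calderón space by a bounded holomorphic function. -/
theorem exists_calderon_smul {φ : ℂ → ℂ} (hd : DifferentiableOn ℂ φ OpenStrip)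
    (hc : ContinuousOn φ ClosedStrip) {C : ℝ} (hb : ∀ z ∈ ClosedStrip, ‖φ z‖ ≤ C)
    (F : CalderonSpace i₀ i₁) : ∃ G : CalderonSpace i₀ i₁, (∀ z, G.1.1 z = φ z • F.1.1 z) ∧
      (∀ t, G.1.2.1 t = φ (leftPt t) • F.1.2.1 t) ∧ ∀ t, G.1.2.2 t = φ (rightPt t) • F.1.2.2 t := by
  have hC : 0 ≤ C := (norm_nonneg _).trans (hb _ (leftPt 0).2)
  have hc' : Continuous fun z : ClosedStrip => φ z := continuousOn_iff_continuous_domRestrict.1 hc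
  have hl : Continuous leftPt :=
    Continuous.subtype_mk (by fun_prop : Continuous fun t : ℝ => (t : ℂ) * Complex.I) _
  have hr : Continuous rightPt :=
    Continuous.subtype_mk (by fun_prop : Continuous fun t : ℝ => 1 + (t : ℂ) * Complex.I) _
  obtain ⟨F, hF, hF0, hF1⟩ := F
  refine ⟨⟨(BoundedContinuousFunction.ofNormedAddCommGroup (fun z => φ z • F.1 z)
    (hc'.smul F.1.continuous) (C * ‖F.1‖) fun z => ?_,
    ⟨⟨fun t => φ (leftPt t) • F.2.1 t, (hc'.comp hl).smul F.2.1.continuous⟩, 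
      tendsto_smul_zeroAtInfty (fun t => hb _ (leftPt t).2) F.2.1⟩,
    ⟨⟨fun t => φ (rightPt t) • F.2.2 t, (hc'.comp hr).smul F.2.2.continuous⟩, 
      tendsto_smul_zeroAtInfty (fun t => hb _ (rightPt t).2) F.2.2⟩),
    ?_, fun t => ?_, fun t => ?_⟩, fun z => rfl, fun t => rfl, fun t => rfl⟩
  · rw [norm_smul]
    exact mul_le_mul (hb z z.2) (F.1.norm_coe_le_norm z) (norm_nonneg _) hC
  · refine (differentiableOn_extend_iff
      (g := fun z => φ z • Function.extend Subtype.val F.1 0 z) fun z => ?_).2 (hd.smul hF)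
    rw [extend_coe]; rfl
  · change φ (leftPt t) • F.1 (leftPt t) = sumInl i₀ i₁ (φ (leftPt t) • F.2.1 t)
    rw [hF0, map_smul]
  · change φ (rightPt t) • F.1 (rightPt t) = sumInr i₀ i₁ (φ (rightPt t) • F.2.2 t)
    rw [hF1, map_smul]

end Functoriality

end

/-! ### Holomorphic functions dominating given boundary values. -/

section
section HalfPlane

theorem le_norm_add_sub {ε : ℝ} {w : ℂ} {c : ℝ} (hc : c ≤ w.re) (σ : ℝ) :
    c + ε ≤ ‖w + ε - σ * Complex.I‖ := by
  refine le_trans ?_ (Complex.re_le_norm _)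
  simp
  exact hc

theorem integrable_mul_inv {u : ℝ → ℝ} (hi : Integrable u) {ε : ℝ} {w : ℂ} (hw : 0 < w.re + ε) :
    Integrable fun σ : ℝ => (u σ : ℂ) * (w + ε - σ * Complex.I)⁻¹ := by
  refine hi.ofReal.mul_bdd (c := (w.re + ε)⁻¹) ?_ ?_
  · refine (Continuous.inv₀ (by fun_prop) fun σ h => ?_).aestronglyMeasurable
    have := le_norm_add_sub (ε := ε) (le_refl w.re) σ
    rw [h, norm_zero] at this
    linarith
  · refine Eventually.of_forall fun σ => ?_
    rw [norm_inv]
    exact inv_anti₀ hw (le_norm_add_sub le_rfl σ)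

/-- A function that is holomorphic on the right half plane and dominates a given function on the
boundary. -/
theorem exists_holomorphic_dominating {u : ℝ → ℝ} (hu : UniformContinuous u) (h0 : ∀ t, 0 ≤ u t)
    (hi : Integrable u) (h1 : ∫ t, u t ≤ 1) : ∃ G : ℂ → ℂ,
      (∀ w, 0 ≤ w.re → DifferentiableAt ℂ G w) ∧ (∀ w, 0 ≤ w.re → 1 ≤ ‖G w‖) ∧
      (∀ w, 0 < w.re → ‖G w‖ ≤ 1 + 1 / w.re) ∧ ∀ τ : ℝ, u τ ≤ ‖G (τ * Complex.I)‖ := by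
  obtain ⟨δ, hδ, hδu⟩ := Metric.uniformContinuous_iff.1 hu 1 one_pos
  set ε := δ / 2 with hε
  have hε0 : 0 < ε := by positivity
  -- The kernel `1 / (w + ε - iσ)` is holomorphic up to the imaginary axis thanks to `ε`, and its
  -- real part is a multiple of the Poisson kernel, hence nonnegative. The summand `1` keeps `G`
  -- away from zero, so that one may divide by it.
  set G : ℂ → ℂ := fun w => 1 + ∫ σ : ℝ, (u σ : ℂ) * (w + ε - σ * Complex.I)⁻¹ with hG
  have hre : ∀ w : ℂ, 0 ≤ w.re → (G w).re = 1 + ∫ σ : ℝ, u σ * ((w + ε - σ * Complex.I)⁻¹).re := by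
    intro w hw
    rw [hG]
    simp only [Complex.add_re, Complex.one_re]
    congr 1
    rw [← Complex.reCLM_apply, ← Complex.reCLM.integral_comp_comm (integrable_mul_inv hi (by linarith))]
    refine integral_congr_ae (Eventually.of_forall fun σ => ?_)
    simp only [Complex.reCLM_apply, Complex.re_ofReal_mul]
  have hpos : ∀ w : ℂ, 0 ≤ w.re → ∀ σ : ℝ, 0 ≤ ((w + ε - σ * Complex.I)⁻¹).re := by
    intro w hw σ
    rw [Complex.inv_re]
    refine div_nonneg ?_ (Complex.normSq_nonneg _)
    simp
    linarith
  refine ⟨G, fun w hw => ?_, fun w hw => ?_, fun w hw => ?_, fun τ => ?_⟩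
  · have hball : ∀ x ∈ Metric.ball w (ε / 2), -(ε / 2) ≤ x.re := by
      intro x hx
      rw [Metric.mem_ball, dist_eq_norm] at hx
      have := (abs_le.1 (Complex.abs_re_le_norm (x - w))).1
      rw [Complex.sub_re] at this
      linarith
    have hd := hasDerivAt_integral_of_dominated_loc_of_deriv_le (𝕜 := ℂ) (μ := volume)
      (F := fun w (σ : ℝ) => (u σ : ℂ) * (w + ε - σ * Complex.I)⁻¹)
      (F' := fun w (σ : ℝ) => (u σ : ℂ) * (-1 / (w + ε - σ * Complex.I) ^ 2))
      (x₀ := w) (s := Metric.ball w (ε / 2)) (bound := fun σ => u σ * (1 / (ε / 2) ^ 2))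
      (Metric.ball_mem_nhds w (by positivity)) ?_ (integrable_mul_inv hi (by linarith)) ?_ ?_
      (hi.mul_const _) ?_
    · exact (hd.2.const_add 1).differentiableAt
    · filter_upwards [Metric.ball_mem_nhds w (by positivity : 0 < ε / 2)] with x hx
      exact (integrable_mul_inv hi (by linarith [hball x hx])).aestronglyMeasurable
    · refine hi.ofReal.aestronglyMeasurable.mul ?_
      refine Continuous.aestronglyMeasurable ?_
      refine Continuous.div continuous_const (by fun_prop) fun σ => pow_ne_zero 2 fun h => ?_
      have := le_norm_add_sub (ε := ε) hw σ
      rw [h, norm_zero] at this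
      linarith
    · refine Eventually.of_forall fun σ x hx => ?_
      have h2 := le_norm_add_sub (ε := ε) (hball x hx) σ
      rw [norm_mul, Complex.norm_real, Real.norm_of_nonneg (h0 σ), norm_div, norm_neg, norm_one,
        norm_pow]
      have := h0 σ
      gcongr
      linarith
    · refine Eventually.of_forall fun σ x hx => ?_
      have h2 := le_norm_add_sub (ε := ε) (hball x hx) σ
      have hne : x + ε - σ * Complex.I ≠ 0 := fun h => by
        rw [h, norm_zero] at h2
        linarith
      have h3 : HasDerivAt (fun x : ℂ => x + ε - σ * Complex.I) 1 x :=
        ((hasDerivAt_id x).add_const _).sub_const _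
      exact (h3.inv hne).const_mul _
  · refine le_trans ?_ (Complex.re_le_norm _)
    rw [hre w hw]
    have : 0 ≤ ∫ σ : ℝ, u σ * ((w + ε - σ * Complex.I)⁻¹).re :=
      integral_nonneg fun σ => mul_nonneg (h0 σ) (hpos w hw σ)
    linarith
  · refine (norm_add_le _ _).trans ?_
    rw [norm_one]
    gcongr
    have hb : ‖∫ σ : ℝ, (u σ : ℂ) * (w + ε - σ * Complex.I)⁻¹‖ ≤ ∫ σ : ℝ, u σ * (1 / w.re) := by
      refine norm_integral_le_of_norm_le (hi.mul_const _) (Eventually.of_forall fun σ => ?_)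
      have h2 := le_norm_add_sub (ε := ε) le_rfl (w := w) σ
      rw [norm_mul, Complex.norm_real, Real.norm_of_nonneg (h0 σ), norm_inv, ← one_div]
      have := h0 σ
      gcongr
      linarith
    refine hb.trans ?_
    rw [integral_mul_const]
    have : 0 < 1 / w.re := by positivity
    nlinarith
  · refine le_trans ?_ (Complex.re_le_norm _)
    have hw : (0 : ℝ) ≤ ((τ : ℂ) * Complex.I).re := by simp
    rw [hre _ hw]
    have hint : Integrable fun σ : ℝ => u σ * (((τ : ℂ) * Complex.I + ε - σ * Complex.I)⁻¹).re := by
      have := (integrable_mul_inv hi (by linarith : 0 < ((τ : ℂ) * Complex.I).re + ε)).re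
      refine this.congr (Eventually.of_forall fun σ => ?_)
      exact Complex.re_ofReal_mul _ _
    -- Within distance `ε` of `τ` the real part of the kernel is at least `1 / (2 * ε)` and `u` is
    -- at least `u τ - 1`. The window of length `2 * ε` yields `u τ - 1`, and the summand `1` of `G`
    -- restores `u τ`.
    have h2 : ∫ σ in Icc (τ - ε) (τ + ε), (u τ - 1) * (1 / (2 * ε))
        ≤ ∫ σ in Icc (τ - ε) (τ + ε), u σ * (((τ : ℂ) * Complex.I + ε - σ * Complex.I)⁻¹).re := by
      refine setIntegral_mono_on (integrableOn_const (by simp)) hint.integrableOn measurableSet_Icc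
        fun σ hσ => ?_
      have hd : dist σ τ < δ := by
        rw [Real.dist_eq, abs_lt]
        constructor <;> linarith [hσ.1, hσ.2]
      have h3 := hδu hd
      rw [Real.dist_eq, abs_lt] at h3
      have h4 : 1 / (2 * ε) ≤ (((τ : ℂ) * Complex.I + ε - σ * Complex.I)⁻¹).re := by
        rw [Complex.inv_re, Complex.normSq_apply]
        simp only [Complex.sub_re, Complex.add_re, Complex.mul_re, Complex.ofReal_re, Complex.I_re,
          mul_zero, Complex.ofReal_im, Complex.I_im, mul_one, sub_self, zero_add, sub_zero,
          Complex.sub_im, Complex.add_im, Complex.mul_im, add_zero]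
        rw [div_le_div_iff₀ (by positivity) (by nlinarith)]
        have h5 : (τ - σ) * (τ - σ) ≤ ε * ε := by nlinarith [hσ.1, hσ.2]
        nlinarith
      have h6 : 0 < 1 / (2 * ε) := by positivity
      calc (u τ - 1) * (1 / (2 * ε)) ≤ u σ * (1 / (2 * ε)) := by gcongr; linarith
        _ ≤ _ := mul_le_mul_of_nonneg_left h4 (h0 σ)
    have h3 := setIntegral_le_integral (s := Icc (τ - ε) (τ + ε)) hint
      (Eventually.of_forall fun σ => mul_nonneg (h0 σ) (hpos _ hw σ))
    rw [setIntegral_const, measureReal_def, Real.volume_Icc, ENNReal.toReal_ofReal (by linarith),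
      smul_eq_mul] at h2
    have e : (τ + ε - (τ - ε)) * ((u τ - 1) * (1 / (2 * ε))) = u τ - 1 := by
      field_simp; ring
    rw [e] at h2
    linarith

end HalfPlane

end

/-! ### The interpolation norm and Gaussian means of the boundary values. -/

section
section WeightedBoundaryEstimate

open ProbabilityTheory

theorem gaussianPDFReal_zero_one (t : ℝ) :
    gaussianPDFReal 0 1 t = (√(2 * Real.pi))⁻¹ * Real.exp (-t ^ 2 / 2) := by
  simp [gaussianPDFReal]

theorem exp_le_three_mul_gaussianPDFReal (t : ℝ) :
    Real.exp (-t ^ 2 / 2) ≤ 3 * gaussianPDFReal 0 1 t := by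
  rw [gaussianPDFReal_zero_one, ← mul_assoc]
  refine le_mul_of_one_le_left (Real.exp_nonneg _) ?_
  have h1 : 0 < √(2 * Real.pi) := by positivity
  rw [← div_eq_mul_inv, one_le_div h1]
  exact Real.sqrt_le_iff.2 ⟨by norm_num, by nlinarith [Real.pi_lt_four]⟩

/-- Apply `exists_holomorphic_dominating` to the Gaussian density times `f / β`, whose integral is
at most one. The factor `3` bounds the normalization `√(2π)` of the density. -/
theorem exists_holomorphic_dominating_gaussian {f : ℝ → ℝ} (hf : Continuous f) (h0 : ∀ t, 0 ≤ f t)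
    (hlim : Tendsto f (cocompact ℝ) (𝓝 0)) {β : ℝ} (hβ : 0 < β)
    (hint : ∫ t, f t ∂(gaussianReal 0 1) ≤ β) : ∃ G : ℂ → ℂ,
      (∀ w, 0 ≤ w.re → DifferentiableAt ℂ G w) ∧ (∀ w, 0 ≤ w.re → 1 ≤ ‖G w‖) ∧
      (∀ w, 0 < w.re → ‖G w‖ ≤ 1 + 1 / w.re) ∧
      ∀ τ : ℝ, Real.exp (-τ ^ 2 / 2) * f τ ≤ 3 * β * ‖G (τ * Complex.I)‖ := by
  have hρ : Continuous fun t : ℝ => gaussianPDFReal 0 1 t := by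
    simp only [gaussianPDFReal_zero_one]
    fun_prop
  have hρ1 : ∀ t : ℝ, gaussianPDFReal 0 1 t ≤ 1 := by
    intro t
    rw [gaussianPDFReal_zero_one]
    refine mul_le_one₀ ?_ (Real.exp_nonneg _) (Real.exp_le_one_iff.2 (by nlinarith [sq_nonneg t]))
    refine inv_le_one_of_one_le₀ (Real.one_le_sqrt.2 (by nlinarith [Real.pi_gt_three]))
  have hρ0 := gaussianPDFReal_nonneg 0 1
  obtain ⟨C, hC⟩ : ∃ C, ∀ t, ‖f t‖ ≤ C := by
    let F : C₀(ℝ, ℝ) := ⟨⟨f, hf⟩, hlim⟩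
    exact ⟨‖F.toBCF‖, fun t => F.toBCF.norm_coe_le_norm t⟩
  have hu0 : ∀ t, 0 ≤ gaussianPDFReal 0 1 t * f t / β := fun t =>
    div_nonneg (mul_nonneg (hρ0 t) (h0 t)) hβ.le
  have huc : UniformContinuous fun t => gaussianPDFReal 0 1 t * f t / β := by
    refine Continuous.uniformContinuous_of_tendsto_cocompact (x := 0)
      ((hρ.mul hf).div_const β) ?_
    have := hlim.div_const β
    rw [zero_div] at this
    refine squeeze_zero hu0 (fun t => ?_) this
    have := h0 t
    gcongr
    exact mul_le_of_le_one_left this (hρ1 t)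
  have hui : Integrable fun t => gaussianPDFReal 0 1 t * f t / β :=
    ((integrable_gaussianPDFReal 0 1).mul_bdd (c := C) hf.aestronglyMeasurable
      (Eventually.of_forall hC)).div_const β
  have hu1 : ∫ t, gaussianPDFReal 0 1 t * f t / β ≤ 1 := by
    rw [integral_div, div_le_one hβ]
    rwa [integral_gaussianReal_eq_integral_smul one_ne_zero] at hint
  obtain ⟨G, h1, h2, h3, h4⟩ := exists_holomorphic_dominating huc hu0 hui hu1
  refine ⟨G, h1, h2, h3, fun τ => ?_⟩
  have := h4 τ
  rw [div_le_iff₀ hβ] at this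
  calc Real.exp (-τ ^ 2 / 2) * f τ ≤ 3 * gaussianPDFReal 0 1 τ * f τ :=
        mul_le_mul_of_nonneg_right (exp_le_three_mul_gaussianPDFReal τ) (h0 τ)
    _ = 3 * (gaussianPDFReal 0 1 τ * f τ) := mul_assoc _ _ _
    _ ≤ 3 * (‖G (τ * Complex.I)‖ * β) := by gcongr
    _ = _ := by ring

variable {A₀ A₁ V : Type*}
  [NormedAddCommGroup A₀] [NormedSpace ℂ A₀] [NormedAddCommGroup A₁] [NormedSpace ℂ A₁]
  [NormedAddCommGroup V] [NormedSpace ℂ V]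
  {i₀ : A₀ →L[ℂ] V} {i₁ : A₁ →L[ℂ] V}

/-- The constant in the estimate of the interpolation norm by weighted boundary means. -/
def boundaryConst (θ : ℝ) : ℝ := 3 * Real.exp 1 * (1 + 1 / θ) * (1 + 1 / (1 - θ))

/-- Divide `F` by holomorphic functions that dominate its boundary norms. The quotient is bounded on
both boundary lines, hence its value at `θ` is bounded in the interpolation space, and there the
divisors are explicitly bounded. -/
theorem norm_interpMk_le_of_boundary_means (θ : Ioo (0 : ℝ) 1) (F : CalderonSpace i₀ i₁) {β₀ β₁ : ℝ}
    (hβ₀ : 0 < β₀) (hβ₁ : 0 < β₁) (h₀ : ∫ t, ‖F.1.2.1 t‖ ∂(gaussianReal 0 1) ≤ β₀)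
    (h₁ : ∫ t, ‖F.1.2.2 t‖ ∂(gaussianReal 0 1) ≤ β₁) :
    ‖interpMk i₀ i₁ θ F‖ ≤ boundaryConst θ * (β₀ ^ (1 - (θ : ℝ)) * β₁ ^ (θ : ℝ)) := by
  obtain ⟨hθ0, hθ1⟩ := θ.2
  obtain ⟨G₀, hG₀d, hG₀1, hG₀2, hG₀3⟩ := exists_holomorphic_dominating_gaussian
    F.1.2.1.continuous.norm (fun t => norm_nonneg _)
    (tendsto_zero_iff_norm_tendsto_zero.1 F.1.2.1.zero_at_infty') hβ₀ h₀
  -- The right boundary is reached through `z ↦ 1 - z`, which maps `1 + iτ` to `-iτ`; hence the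
  -- reflected boundary function, with the same Gaussian mean.
  obtain ⟨G₁, hG₁d, hG₁1, hG₁2, hG₁3⟩ := exists_holomorphic_dominating_gaussian
    (f := fun t => ‖F.1.2.2 (-t)‖) (F.1.2.2.continuous.comp continuous_neg).norm
    (fun t => norm_nonneg _)
    ((tendsto_zero_iff_norm_tendsto_zero.1 F.1.2.2.zero_at_infty').comp
      (Homeomorph.neg ℝ).isClosedEmbedding.tendsto_cocompact) hβ₁ (by
      refine le_trans (le_of_eq ?_) h₁
      rw [integral_gaussianReal_eq_integral_smul one_ne_zero,
        integral_gaussianReal_eq_integral_smul one_ne_zero,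
        ← integral_neg_eq_self]
      simp [gaussianPDFReal_zero_one])
  -- The quadratic term produces the Gaussian weight on the boundary and is normalized to vanish at
  -- `θ`. The logarithmic terms have modulus `1 / β₀` on the left line, `1 / β₁` on the right line,
  -- and the inverse geometric mean at `θ`.
  set φ : ℂ → ℂ := fun z => Complex.exp ((z ^ 2 - (θ : ℝ) ^ 2) / 2 + Real.log β₀ * (z - 1)
    - Real.log β₁ * z) / (G₀ z * G₁ (1 - z)) with hφ
  have hnum : ∀ z : ℂ, ‖Complex.exp ((z ^ 2 - (θ : ℝ) ^ 2) / 2 + Real.log β₀ * (z - 1)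
      - Real.log β₁ * z)‖ = Real.exp ((z.re ^ 2 - z.im ^ 2 - (θ : ℝ) ^ 2) / 2
        + Real.log β₀ * (z.re - 1) - Real.log β₁ * z.re) := by
    intro z
    rw [Complex.norm_exp]
    congr 1
    have e1 : ((z ^ 2 - ((θ : ℝ) : ℂ) ^ 2) / 2).re = (z.re ^ 2 - z.im ^ 2 - (θ : ℝ) ^ 2) / 2 := by
      have : (z ^ 2 - ((θ : ℝ) : ℂ) ^ 2) / 2 = ((1 / 2 : ℝ) : ℂ) * (z ^ 2 - ((θ : ℝ) : ℂ) ^ 2) := by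
        push_cast; ring
      rw [this, Complex.re_ofReal_mul]
      simp [pow_two]
      ring
    rw [Complex.sub_re, Complex.add_re, e1, Complex.re_ofReal_mul, Complex.re_ofReal_mul,
      Complex.sub_re, Complex.one_re]
  have hre : ∀ z ∈ ClosedStrip, 0 ≤ z.re ∧ 0 ≤ (1 - z).re := fun z hz => by
    have h1 : 0 ≤ z.re := hz.1
    have h2 : z.re ≤ 1 := hz.2
    refine ⟨h1, ?_⟩
    rw [Complex.sub_re, Complex.one_re]
    linarith
  have hden : ∀ z ∈ ClosedStrip, 1 ≤ ‖G₀ z‖ ∧ 1 ≤ ‖G₁ (1 - z)‖ := fun z hz =>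
    ⟨hG₀1 z (hre z hz).1, hG₁1 _ (hre z hz).2⟩
  have hdiff : ∀ z ∈ ClosedStrip, DifferentiableAt ℂ φ z := by
    intro z hz
    obtain ⟨h1, h2⟩ := hden z hz
    refine DifferentiableAt.fun_div (by fun_prop) ?_ ?_
    · refine (hG₀d z (hre z hz).1).mul ?_
      exact (hG₁d (1 - z) (hre z hz).2).comp z (by fun_prop)
    · refine mul_ne_zero ?_ ?_
      · rw [← norm_pos_iff]; linarith
      · rw [← norm_pos_iff]; linarith
  have hφn : ∀ z, ‖φ z‖ = Real.exp ((z.re ^ 2 - z.im ^ 2 - (θ : ℝ) ^ 2) / 2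
        + Real.log β₀ * (z.re - 1) - Real.log β₁ * z.re) / (‖G₀ z‖ * ‖G₁ (1 - z)‖) := fun z => by
    rw [hφ]
    simp only
    rw [norm_div, hnum, norm_mul]
  obtain ⟨H, hH, hH0, hH1⟩ := exists_calderon_smul (φ := φ)
    (C := Real.exp (1 / 2 + |Real.log β₀| + |Real.log β₁|))
    (fun z hz => (hdiff z (openStrip_subset hz)).differentiableWithinAt)
    (fun z hz => (hdiff z hz).continuousAt.continuousWithinAt) (fun z hz => by
      obtain ⟨h1, h2⟩ := hden z hz
      have hz1 : 0 ≤ z.re := hz.1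
      have hz2 : z.re ≤ 1 := hz.2
      rw [hφn]
      refine (div_le_self (Real.exp_nonneg _) (by nlinarith)).trans (Real.exp_le_exp.2 ?_)
      have a1 := neg_abs_le (Real.log β₀)
      have a2 := neg_abs_le (Real.log β₁)
      have a3 := abs_nonneg (Real.log β₀)
      have a4 := abs_nonneg (Real.log β₁)
      nlinarith [sq_nonneg z.im, sq_nonneg (θ : ℝ)]) F
  have hHn : ‖H‖ ≤ 3 * Real.exp 1 := by
    rw [calderon_norm_eq]
    refine max_le ((zeroAtInfty_norm_le (by positivity)).2 fun τ => ?_)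
      ((zeroAtInfty_norm_le (by positivity)).2 fun τ => ?_)
    · obtain ⟨h1, h2⟩ := hden _ (leftPt τ).2
      have h3 := hG₀3 τ
      have e1 : ((leftPt τ : ℂ)).re = 0 := by simp [leftPt]
      have e2 : ((leftPt τ : ℂ)).im = τ := by simp [leftPt]
      rw [hH0, norm_smul, hφn, e1, e2, div_mul_eq_mul_div, div_le_iff₀ (by positivity)]
      have e3 : Real.exp ((0 ^ 2 - τ ^ 2 - (θ : ℝ) ^ 2) / 2 + Real.log β₀ * (0 - 1)
          - Real.log β₁ * 0) ≤ Real.exp (-τ ^ 2 / 2) / β₀ := by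
        rw [← Real.exp_log hβ₀, ← Real.exp_sub, Real.log_exp]
        refine Real.exp_le_exp.2 ?_
        nlinarith [sq_nonneg (θ : ℝ)]
      have h4 : ‖G₀ (leftPt τ)‖ ≤ ‖G₀ (leftPt τ)‖ * ‖G₁ (1 - leftPt τ)‖ :=
        le_mul_of_one_le_right (norm_nonneg _) h2
      have h5 : 1 ≤ Real.exp 1 := Real.one_le_exp zero_le_one
      calc _ ≤ Real.exp (-τ ^ 2 / 2) / β₀ * ‖F.1.2.1 τ‖ := by gcongr
        _ = Real.exp (-τ ^ 2 / 2) * ‖F.1.2.1 τ‖ / β₀ := by ring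
        _ ≤ 3 * β₀ * ‖G₀ (leftPt τ)‖ / β₀ := div_le_div_of_nonneg_right h3 hβ₀.le
        _ = 3 * 1 * ‖G₀ (leftPt τ)‖ := by field_simp
        _ ≤ _ := by gcongr
    · obtain ⟨h1, h2⟩ := hden _ (rightPt τ).2
      have h3 := hG₁3 (-τ)
      have e1 : ((rightPt τ : ℂ)).re = 1 := by simp [rightPt]
      have e2 : ((rightPt τ : ℂ)).im = τ := by simp [rightPt]
      have e4 : ((-τ : ℝ) : ℂ) * Complex.I = 1 - (rightPt τ : ℂ) := by simp [rightPt]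
      rw [e4, neg_neg, neg_sq] at h3
      rw [hH1, norm_smul, hφn, e1, e2, div_mul_eq_mul_div, div_le_iff₀ (by positivity)]
      have e3 : Real.exp ((1 ^ 2 - τ ^ 2 - (θ : ℝ) ^ 2) / 2 + Real.log β₀ * (1 - 1)
          - Real.log β₁ * 1) ≤ Real.exp 1 * (Real.exp (-τ ^ 2 / 2) / β₁) := by
        rw [← Real.exp_log hβ₁, ← Real.exp_sub, Real.log_exp, ← Real.exp_add]
        refine Real.exp_le_exp.2 ?_
        nlinarith [sq_nonneg (θ : ℝ)]
      have h4 : ‖G₁ (1 - rightPt τ)‖ ≤ ‖G₀ (rightPt τ)‖ * ‖G₁ (1 - rightPt τ)‖ :=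
        le_mul_of_one_le_left (norm_nonneg _) h1
      calc _ ≤ Real.exp 1 * (Real.exp (-τ ^ 2 / 2) / β₁) * ‖F.1.2.2 τ‖ := by gcongr
        _ = Real.exp 1 * (Real.exp (-τ ^ 2 / 2) * ‖F.1.2.2 τ‖ / β₁) := by ring
        _ ≤ Real.exp 1 * (3 * β₁ * ‖G₁ (1 - rightPt τ)‖ / β₁) := by gcongr
        _ = 3 * Real.exp 1 * ‖G₁ (1 - rightPt τ)‖ := by field_simp
        _ ≤ _ := by gcongr
  have hmk : interpMk i₀ i₁ θ H = φ θ • interpMk i₀ i₁ θ F := by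
    rw [← map_smul]
    exact interpMk_eq_of_eval_eq θ (hH (midPt θ))
  have hmid := hden _ (midPt θ).2
  have hg0 : ‖G₀ (θ : ℝ)‖ ≤ 1 + 1 / (θ : ℝ) := by simpa using hG₀2 ((θ : ℝ) : ℂ) (by simpa using hθ0)
  have hg1 : ‖G₁ (1 - (θ : ℝ))‖ ≤ 1 + 1 / (1 - (θ : ℝ)) := by
    simpa using hG₁2 (1 - ((θ : ℝ) : ℂ)) (by simpa using hθ1)
  have hg : 0 < ‖G₀ (θ : ℝ)‖ * ‖G₁ (1 - (θ : ℝ))‖ := by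
    have h1 : 1 ≤ ‖G₀ (θ : ℝ)‖ := hmid.1
    have h2 : 1 ≤ ‖G₁ (1 - (θ : ℝ))‖ := hmid.2
    positivity
  have hφθ : ‖φ (θ : ℝ)‖ = (β₀ ^ (1 - (θ : ℝ)) * β₁ ^ (θ : ℝ))⁻¹
      / (‖G₀ (θ : ℝ)‖ * ‖G₁ (1 - (θ : ℝ))‖) := by
    rw [hφn, Complex.ofReal_re, Complex.ofReal_im, Real.rpow_def_of_pos hβ₀,
      Real.rpow_def_of_pos hβ₁, ← Real.exp_add, ← Real.exp_neg]
    congr 2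
    ring
  have hmkn := (norm_interpMk_le θ H).trans hHn
  have hN : 0 < β₀ ^ (1 - (θ : ℝ)) * β₁ ^ (θ : ℝ) := by positivity
  rw [hmk, norm_smul] at hmkn
  have hmkn' := mul_le_mul_of_nonneg_left hmkn
    (by positivity : 0 ≤ (‖G₀ (θ : ℝ)‖ * ‖G₁ (1 - (θ : ℝ))‖) * (β₀ ^ (1 - (θ : ℝ)) * β₁ ^ (θ : ℝ)))
  have e : (‖G₀ (θ : ℝ)‖ * ‖G₁ (1 - (θ : ℝ))‖) * (β₀ ^ (1 - (θ : ℝ)) * β₁ ^ (θ : ℝ))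
      * (‖φ (θ : ℝ)‖ * ‖interpMk i₀ i₁ θ F‖) = ‖interpMk i₀ i₁ θ F‖ := by
    rw [hφθ]
    generalize ‖G₀ (θ : ℝ)‖ * ‖G₁ (1 - (θ : ℝ))‖ = g at hg ⊢
    generalize β₀ ^ (1 - (θ : ℝ)) * β₁ ^ (θ : ℝ) = N at hN ⊢
    field_simp
  rw [e] at hmkn'
  refine hmkn'.trans ?_
  have h1 : 0 < 1 - (θ : ℝ) := by linarith
  rw [boundaryConst]
  calc _ = 3 * Real.exp 1 * ‖G₀ (θ : ℝ)‖ * ‖G₁ (1 - (θ : ℝ))‖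
        * (β₀ ^ (1 - (θ : ℝ)) * β₁ ^ (θ : ℝ)) := by ring
    _ ≤ _ := by gcongr

/-- The norm of the interpolation space is bounded by Gaussian means of the boundary values. -/
theorem norm_interpMk_le_boundary_means (θ : Ioo (0 : ℝ) 1) (F : CalderonSpace i₀ i₁) :
    ‖interpMk i₀ i₁ θ F‖ ≤ boundaryConst θ *
      ((∫ t, ‖F.1.2.1 t‖ ∂(gaussianReal 0 1)) ^ (1 - (θ : ℝ))
        * (∫ t, ‖F.1.2.2 t‖ ∂(gaussianReal 0 1)) ^ (θ : ℝ)) := by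
  obtain ⟨hθ0, hθ1⟩ := θ.2
  set b₀ := ∫ t, ‖F.1.2.1 t‖ ∂(gaussianReal 0 1) with hb₀
  set b₁ := ∫ t, ‖F.1.2.2 t‖ ∂(gaussianReal 0 1) with hb₁
  have h0 : 0 ≤ b₀ := integral_nonneg fun t => norm_nonneg _
  have h1 : 0 ≤ b₁ := integral_nonneg fun t => norm_nonneg _
  -- A boundary mean may be zero, so both are enlarged by `δ > 0` and `δ` tends to zero.
  have hc : Continuous fun δ : ℝ => boundaryConst θ *
      ((b₀ + δ) ^ (1 - (θ : ℝ)) * (b₁ + δ) ^ (θ : ℝ)) := by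
    refine continuous_const.mul (Continuous.mul ?_ ?_)
    · exact (continuous_const.add continuous_id).rpow_const fun _ => Or.inr (by linarith)
    · exact (continuous_const.add continuous_id).rpow_const fun _ => Or.inr hθ0.le
  have ht := (hc.tendsto 0).mono_left (nhdsWithin_le_nhds (s := Ioi 0))
  simp only [add_zero] at ht
  refine ge_of_tendsto ht ?_
  filter_upwards [self_mem_nhdsWithin] with δ hδ
  have hδ : 0 < δ := hδ
  exact norm_interpMk_le_of_boundary_means θ F (by linarith) (by linarith) (by linarith)
    (by linarith)

end WeightedBoundaryEstimate

end

/-! ### The embedding of `[L^{r₀}(J; A₀), L^{r₁}(J; A₁)]_θ` in `L^r(J; [A₀, A₁]_θ)`. -/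

section
section InterpolationOfBochnerSpaces

open ProbabilityTheory

/-- The embedding of `L^r(J; A)` in `L^1(J; V)` given by an embedding of `A` in `V`. -/
def lpEmb (T : ℝ) (r : Exponent) {A V : Type*} [NormedAddCommGroup A] [NormedSpace ℂ A]
    [NormedAddCommGroup V] [NormedSpace ℂ V] (i : A →L[ℂ] V) : LrJ T r A →L[ℂ] Lp V 1 (volJ T) :=
  i.compLpL 1 (volJ T) ∘L inclL1 T r A

theorem lpEmb_injective (T : ℝ) (r : Exponent) {A V : Type*} [NormedAddCommGroup A]
    [NormedSpace ℂ A] [NormedAddCommGroup V] [NormedSpace ℂ V] {i : A →L[ℂ] V}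
    (hi : Function.Injective i) : Function.Injective (lpEmb T r i) :=
  (compLpL_injective hi).comp (inclL1_injective T r)

theorem lpEmb_coe {T : ℝ} {r : Exponent} {A V : Type*} [NormedAddCommGroup A]
    [NormedSpace ℂ A] [NormedAddCommGroup V] [NormedSpace ℂ V] (i : A →L[ℂ] V) (f : LrJ T r A) :
    lpEmb T r i f =ᵐ[volJ T] fun t => i (f t) := by
  filter_upwards [compLpL_coe i (inclL1 T r A f), inclL1_coe T r A f] with t h1 h2
  exact h1.trans (congrArg i h2)

/-- The mean value over a cell of the grid, as an operator on `L^r(J; Z)`. -/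
def cellMean (T : ℝ) (r : Exponent) (n k : ℕ) (Z : Type*) [NormedAddCommGroup Z] [NormedSpace ℂ Z] :
    LrJ T r Z →L[ℂ] Z :=
  cellAvg T n k Z ∘L inclL1 T r Z

/-- The averaging operator of the grid on `L^1(J; Z)`. -/
def gridProjOne {T : ℝ} (hT : 0 < T) (n : ℕ) (Z : Type*) [NormedAddCommGroup Z] [NormedSpace ℂ Z] :
    Lp Z 1 (volJ T) →ₗ[ℂ] Lp Z 1 (volJ T) where
  toFun f := (memLp_stepFun hT n 1 fun k => cellAvg T n k Z f).toLp _
  map_add' f g := by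
    simp only [map_add]
    rfl
  map_smul' c f := by
    simp only [map_smul]
    rfl

variable {A₀ A₁ V : Type*}
  [NormedAddCommGroup A₀] [NormedSpace ℂ A₀] [CompleteSpace A₀]
  [NormedAddCommGroup A₁] [NormedSpace ℂ A₁] [CompleteSpace A₁]
  [NormedAddCommGroup V] [NormedSpace ℂ V] [CompleteSpace V]
  {i₀ : A₀ →L[ℂ] V} {i₁ : A₁ →L[ℂ] V} {T : ℝ} {r r₀ r₁ : Exponent} {θ : Ioo (0 : ℝ) 1}

theorem apply_cellMean (i : A₀ →L[ℂ] V) (n k : ℕ) (f : LrJ T r A₀) :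
    i (cellMean T r n k A₀ f) = cellAvg T n k V (lpEmb T r i f) :=
  (cellAvg_compLpL i (inclL1 T r A₀ f)).symm

theorem lpEmb_stepLr (hT : 0 < T) (i : A₀ →L[ℂ] V) (n : ℕ) (x : ℕ → A₀) :
    lpEmb T r i (stepLr hT r n A₀ x) =ᵐ[volJ T] stepFun T n fun k => i (x k) := by
  filter_upwards [lpEmb_coe i (stepLr hT r n A₀ x), stepLr_coe hT r n x] with t h1 h2
  rw [h1, h2]
  rfl

theorem lpEmb_stepLr_eq_gridProjOne (hT : 0 < T) (i : A₀ →L[ℂ] V) (n : ℕ) {x : ℕ → A₀}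
    {f : Lp V 1 (volJ T)} (h : ∀ k, i (x k) = cellAvg T n k V f) :
    lpEmb T r i (stepLr hT r n A₀ x) = gridProjOne hT n V f := by
  refine Lp.ext ((lpEmb_stepLr hT i n x).trans ?_)
  simp only [h]
  exact (MemLp.coeFn_toLp (memLp_stepFun hT n 1 fun k => cellAvg T n k V f)).symm

theorem lpEmb_gridProj (hT : 0 < T) (i : A₀ →L[ℂ] V) (n : ℕ) (f : LrJ T r A₀) :
    lpEmb T r i (gridProj hT r n A₀ f) = gridProjOne hT n V (lpEmb T r i f) :=
  lpEmb_stepLr_eq_gridProjOne hT i n fun k => apply_cellMean i n k f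

theorem compatible_cellMean (i₀ : A₀ →L[ℂ] V) (i₁ : A₁ →L[ℂ] V) (T : ℝ) (r₀ r₁ : Exponent)
    (n k : ℕ) : Compatible (lpEmb T r₀ i₀) (lpEmb T r₁ i₁) i₀ i₁ (cellMean T r₀ n k A₀)
      (cellMean T r₁ n k A₁) :=
  Compatible.of_linearMap (cellAvg T n k V).toLinearMap (apply_cellMean i₀ n k)
    (apply_cellMean i₁ n k)

theorem compatible_gridProj (hT : 0 < T) (i₀ : A₀ →L[ℂ] V) (i₁ : A₁ →L[ℂ] V) (r₀ r₁ : Exponent)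
    (n : ℕ) : Compatible (lpEmb T r₀ i₀) (lpEmb T r₁ i₁) (lpEmb T r₀ i₀) (lpEmb T r₁ i₁)
      (gridProj hT r₀ n A₀) (gridProj hT r₁ n A₁) :=
  Compatible.of_linearMap (gridProjOne hT n V) (lpEmb_gridProj hT i₀ n) (lpEmb_gridProj hT i₁ n)

/-- Jensen's inequality moves the power inside the Gaussian mean; for each boundary parameter the
sum over the cells is then at most the `L^r` norm to the power `r`. -/
theorem sum_mean_rpow_le (hT : 0 < T) (n : ℕ) {f : C₀(ℝ, LrJ T r A₀)} (hf : ‖f‖ ≤ 1) :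
    ∑ k ∈ Finset.range (2 ^ n), mesh T n *
      (∫ t, ‖cellMean T r n k A₀ (f t)‖ ∂(gaussianReal 0 1)) ^ (r : ℝ) ≤ 1 := by
  have hr : (1 : ℝ) < r := r.2
  have hb : ∀ t, ‖f t‖ ≤ 1 := fun t => (norm_apply_le_of_zeroAtInfty f t).trans hf
  have hc : ∀ k, Continuous fun t => ‖cellMean T r n k A₀ (f t)‖ := fun k =>
    ((cellMean T r n k A₀).continuous.comp f.continuous).norm
  have hk : ∀ k t, ‖cellMean T r n k A₀ (f t)‖ ≤ ‖cellMean T r n k A₀‖ := fun k t =>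
    ((cellMean T r n k A₀).le_opNorm _).trans (mul_le_of_le_one_right (norm_nonneg _) (hb t))
  have hi : ∀ k, Integrable (fun t => ‖cellMean T r n k A₀ (f t)‖) (gaussianReal 0 1) := fun k =>
    Integrable.of_bound (hc k).aestronglyMeasurable ‖cellMean T r n k A₀‖
      (Eventually.of_forall fun t => by rw [norm_norm]; exact hk k t)
  have hir : ∀ k, Integrable (fun t => ‖cellMean T r n k A₀ (f t)‖ ^ (r : ℝ)) (gaussianReal 0 1) :=
    fun k => Integrable.of_bound
      ((hc k).rpow_const fun _ => Or.inr (by linarith)).aestronglyMeasurable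
      (‖cellMean T r n k A₀‖ ^ (r : ℝ)) (Eventually.of_forall fun t => by
        rw [Real.norm_of_nonneg (by positivity)]
        exact Real.rpow_le_rpow (norm_nonneg _) (hk k t) (by linarith))
  have hJ : ∀ k, (∫ t, ‖cellMean T r n k A₀ (f t)‖ ∂(gaussianReal 0 1)) ^ (r : ℝ)
      ≤ ∫ t, ‖cellMean T r n k A₀ (f t)‖ ^ (r : ℝ) ∂(gaussianReal 0 1) := fun k =>
    (convexOn_rpow hr.le).map_integral_le
      (continuousOn_id.rpow_const fun _ _ => Or.inr (by linarith)) isClosed_Ici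
      (Eventually.of_forall fun t => norm_nonneg _) (hi k) (hir k)
  calc _ ≤ ∑ k ∈ Finset.range (2 ^ n), ∫ t, mesh T n * ‖cellMean T r n k A₀ (f t)‖ ^ (r : ℝ)
        ∂(gaussianReal 0 1) := by
        refine Finset.sum_le_sum fun k _ => ?_
        rw [integral_const_mul]
        exact mul_le_mul_of_nonneg_left (hJ k) (mesh_pos hT n).le
    _ = ∫ t, ∑ k ∈ Finset.range (2 ^ n), mesh T n * ‖cellMean T r n k A₀ (f t)‖ ^ (r : ℝ)
        ∂(gaussianReal 0 1) := (integral_finsetSum _ fun k _ => (hir k).const_mul _).symm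
    _ ≤ ∫ t, (1 : ℝ) ∂(gaussianReal 0 1) := by
        refine integral_mono (integrable_finsetSum _ fun k _ => (hir k).const_mul _)
          (integrable_const _) fun t => ?_
        refine (sum_norm_cellAvg_rpow_le hT n (f t)).trans ?_
        exact Real.rpow_le_one (norm_nonneg _) (hb t) (by linarith)
    _ = 1 := by simp

theorem boundaryConst_nonneg (θ : Ioo (0 : ℝ) 1) : 0 ≤ boundaryConst θ := by
  obtain ⟨h0, h1⟩ := θ.2
  have h2 : 0 < 1 - (θ : ℝ) := by linarith
  unfold boundaryConst
  positivity

/-- The weighted inequality of geometric and arithmetic means, with weights `(1 - θ) * r / r₀` and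
`θ * r / r₁`; the relation between the exponents says precisely that they add up to one. -/
theorem geom_mean_rpow_le (hr : 1 / (r : ℝ) = (1 - (θ : ℝ)) / (r₀ : ℝ) + (θ : ℝ) / (r₁ : ℝ))
    {a b : ℝ} (ha : 0 ≤ a) (hb : 0 ≤ b) :
    (a ^ (1 - (θ : ℝ)) * b ^ (θ : ℝ)) ^ (r : ℝ) ≤ a ^ (r₀ : ℝ) + b ^ (r₁ : ℝ) := by
  obtain ⟨h0, h1⟩ := θ.2
  have hrp : (0 : ℝ) < r := zero_lt_one.trans r.2
  have hr0 : (0 : ℝ) < r₀ := zero_lt_one.trans r₀.2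
  have hr1 : (0 : ℝ) < r₁ := zero_lt_one.trans r₁.2
  have h2 : 0 < 1 - (θ : ℝ) := by linarith
  set p := (1 - (θ : ℝ)) * r / r₀ with hp
  set q := (θ : ℝ) * r / r₁ with hq
  have hp0 : 0 ≤ p := by positivity
  have hq0 : 0 ≤ q := by positivity
  have hpq : p + q = 1 := by
    have : p + q = r * ((1 - (θ : ℝ)) / (r₀ : ℝ) + (θ : ℝ) / (r₁ : ℝ)) := by rw [hp, hq]; ring
    rw [this, ← hr, mul_one_div_cancel hrp.ne']
  have h := Real.geom_mean_le_arith_mean2_weighted hp0 hq0 (Real.rpow_nonneg ha r₀)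
    (Real.rpow_nonneg hb r₁) hpq
  have e1 : (r₀ : ℝ) * p = (1 - (θ : ℝ)) * r := by rw [hp]; field_simp
  have e2 : (r₁ : ℝ) * q = (θ : ℝ) * r := by rw [hq]; field_simp
  rw [← Real.rpow_mul ha, ← Real.rpow_mul hb, e1, e2] at h
  rw [Real.mul_rpow (by positivity) (by positivity), ← Real.rpow_mul ha, ← Real.rpow_mul hb]
  refine h.trans (add_le_add ?_ ?_)
  · exact mul_le_of_le_one_left (by positivity) (by linarith)
  · exact mul_le_of_le_one_left (by positivity) (by linarith)

/-- On each cell, estimate the averaged value by the Gaussian boundary means of an extension `F`,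
then sum. Normalization of both boundary functions gives a total of `2`, and the choice of an
extension with norm at most twice that of `ξ` gives the other factor `2`. -/
theorem norm_stepLr_interpMap_le (hT : 0 < T)
    (hr : 1 / (r : ℝ) = (1 - (θ : ℝ)) / (r₀ : ℝ) + (θ : ℝ) / (r₁ : ℝ)) (n : ℕ)
    (ξ : Interp (lpEmb T r₀ i₀) (lpEmb T r₁ i₁) θ) :
    ‖stepLr hT r n (Interp i₀ i₁ θ) fun k => interpMap (compatible_cellMean i₀ i₁ T r₀ r₁ n k) θ ξ‖
      ≤ 4 * boundaryConst θ * ‖ξ‖ := by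
  have hrp : (1 : ℝ) < r := r.2
  have hC := boundaryConst_nonneg θ
  have key : ∀ F : CalderonSpace (lpEmb T r₀ i₀) (lpEmb T r₁ i₁), ‖F‖ ≤ 1 →
      ‖stepLr hT r n (Interp i₀ i₁ θ) fun k => interpMap (compatible_cellMean i₀ i₁ T r₀ r₁ n k) θ
        (interpMk _ _ θ F)‖ ≤ 2 * boundaryConst θ := by
    intro F hF
    rw [calderon_norm_eq] at hF
    have h0 := sum_mean_rpow_le hT n ((le_max_left _ _).trans hF)
    have h1 := sum_mean_rpow_le hT n ((le_max_right _ _).trans hF)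
    rw [← Real.rpow_le_rpow_iff (norm_nonneg _) (by positivity) (by linarith : (0 : ℝ) < r),
      norm_stepLr_rpow]
    calc _ ≤ ∑ k ∈ Finset.range (2 ^ n), mesh T n * (boundaryConst θ ^ (r : ℝ) *
          ((∫ t, ‖cellMean T r₀ n k A₀ (F.1.2.1 t)‖ ∂(gaussianReal 0 1)) ^ (r₀ : ℝ)
            + (∫ t, ‖cellMean T r₁ n k A₁ (F.1.2.2 t)‖ ∂(gaussianReal 0 1)) ^ (r₁ : ℝ))) := by
          refine Finset.sum_le_sum fun k _ => mul_le_mul_of_nonneg_left ?_ (mesh_pos hT n).le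
          have hk := norm_interpMk_le_boundary_means θ
            (calderonMap (compatible_cellMean i₀ i₁ T r₀ r₁ n k) F)
          refine (Real.rpow_le_rpow (norm_nonneg _) hk (by linarith)).trans ?_
          have n0 : 0 ≤ ∫ t, ‖cellMean T r₀ n k A₀ (F.1.2.1 t)‖ ∂(gaussianReal 0 1) :=
            integral_nonneg fun t => norm_nonneg _
          have n1 : 0 ≤ ∫ t, ‖cellMean T r₁ n k A₁ (F.1.2.2 t)‖ ∂(gaussianReal 0 1) :=
            integral_nonneg fun t => norm_nonneg _
          rw [Real.mul_rpow hC (by positivity)]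
          exact mul_le_mul_of_nonneg_left (geom_mean_rpow_le hr n0 n1) (by positivity)
      _ = boundaryConst θ ^ (r : ℝ) *
          (∑ k ∈ Finset.range (2 ^ n), mesh T n *
            (∫ t, ‖cellMean T r₀ n k A₀ (F.1.2.1 t)‖ ∂(gaussianReal 0 1)) ^ (r₀ : ℝ)
          + ∑ k ∈ Finset.range (2 ^ n), mesh T n *
            (∫ t, ‖cellMean T r₁ n k A₁ (F.1.2.2 t)‖ ∂(gaussianReal 0 1)) ^ (r₁ : ℝ)) := by
          rw [← Finset.sum_add_distrib, Finset.mul_sum]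
          refine Finset.sum_congr rfl fun k _ => by ring
      _ ≤ boundaryConst θ ^ (r : ℝ) * 2 := by gcongr; linarith
      _ ≤ boundaryConst θ ^ (r : ℝ) * 2 ^ (r : ℝ) := by
          gcongr
          exact Real.self_le_rpow_of_one_le (by norm_num) hrp.le
      _ = _ := by rw [Real.mul_rpow (by norm_num) hC, mul_comm]
  rcases (norm_nonneg ξ).eq_or_lt with hξ | hξ
  · have : ξ = 0 := norm_eq_zero.1 hξ.symm
    subst this
    have e : (fun k => interpMap (compatible_cellMean i₀ i₁ T r₀ r₁ n k) θ 0)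
        = (0 : ℕ → Interp i₀ i₁ θ) := funext fun k => map_zero _
    rw [e, map_zero, norm_zero]
    positivity
  · obtain ⟨F, hF, hFn⟩ := exists_interpMk_eq θ ξ
    set c : ℂ := ((2 * ‖ξ‖ : ℝ) : ℂ) with hc
    have hcn : ‖c‖ = 2 * ‖ξ‖ := by
      rw [hc, Complex.norm_real, Real.norm_of_nonneg (by positivity)]
    have hc0 : c ≠ 0 := by rw [← norm_pos_iff, hcn]; positivity
    have hG := key (c⁻¹ • F) (by
      rw [norm_smul, norm_inv, hcn, inv_mul_le_iff₀ (by positivity)]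
      linarith)
    have e : (fun k => interpMap (compatible_cellMean i₀ i₁ T r₀ r₁ n k) θ ξ)
        = c • fun k => interpMap (compatible_cellMean i₀ i₁ T r₀ r₁ n k) θ
          (interpMk _ _ θ (c⁻¹ • F)) := by
      funext k
      rw [Pi.smul_apply, map_smul, map_smul, smul_inv_smul₀ hc0, hF]
    rw [e, map_smul]
    refine (norm_smul_le c _).trans ?_
    exact (mul_le_mul hcn.le hG (norm_nonneg _) (by positivity)).trans_eq (by ring)

/-- `[L^{r₀}(J; A₀), L^{r₁}(J; A₁)]_θ` is contained in `L^r(J; [A₀, A₁]_θ)`. -/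
theorem exists_interp_to_Lr (hT : 0 < T)
    (hr : 1 / (r : ℝ) = (1 - (θ : ℝ)) / (r₀ : ℝ) + (θ : ℝ) / (r₁ : ℝ)) (i₀ : A₀ →L[ℂ] V)
    (i₁ : A₁ →L[ℂ] V) :
    ∃ Λ : Interp (lpEmb T r₀ i₀) (lpEmb T r₁ i₁) θ →L[ℂ] LrJ T r (Interp i₀ i₁ θ), ∀ ξ,
      lpEmb T r (interpToAmbient i₀ i₁ θ) (Λ ξ) = interpToAmbient _ _ θ ξ := by
  refine exists_lift (lpEmb_injective T r (interpToAmbient_injective i₀ i₁ θ))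
    (C := 4 * boundaryConst θ) fun ξ => ?_
  rcases (norm_nonneg ξ).eq_or_lt with hξ | hξ
  · have : ξ = 0 := norm_eq_zero.1 hξ.symm
    subst this
    exact ⟨0, 0, by simp, by simp, by simp⟩
  have ht := tendsto_interpMap (compatible_gridProj hT i₀ i₁ r₀ r₁)
    (fun n a => norm_gridProj_le hT r₀ n a) (fun a => tendsto_gridProj hT r₀ a)
    (fun n a => norm_gridProj_le hT r₁ n a) (fun a => tendsto_gridProj hT r₁ a) θ ξ
  obtain ⟨n, hn⟩ := Metric.tendsto_atTop.1 ht (‖ξ‖ / 2) (by positivity)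
  have hn := hn n le_rfl
  rw [dist_comm, dist_eq_norm] at hn
  refine ⟨_, _, ?_, norm_stepLr_interpMap_le hT hr n ξ, hn.le⟩
  rw [map_sub, interpToAmbient_interpMap _ θ (gridProjOne hT n V) (lpEmb_gridProj hT i₀ n)
    (lpEmb_gridProj hT i₁ n), lpEmb_stepLr_eq_gridProjOne hT _ n (f := interpToAmbient _ _ θ ξ)]
  · abel
  · intro k
    exact interpToAmbient_interpMap _ θ (cellAvg T n k V).toLinearMap (apply_cellMean i₀ n k)
      (apply_cellMean i₁ n k) ξ

end InterpolationOfBochnerSpaces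

end

/-! ### The embedding of `L^r(J; [A₀, A₁]_θ)` in `[L^{r₀}(J; A₀), L^{r₁}(J; A₁)]_θ`. -/

section
section StepFunctions

theorem stepFun_sum_single {Z : Type*} [AddCommGroup Z] {T : ℝ} (hT : 0 < T) {n : ℕ} (x : ℕ → Z)
    {t : ℝ} (ht : t ∈ Ioo 0 T) :
    stepFun T n (∑ k ∈ Finset.range (2 ^ n), Pi.single k (x k)) t = stepFun T n x t := by
  rw [stepFun, stepFun, Finset.sum_apply, Finset.sum_eq_single ⌊t / mesh T n⌋₊]
  · simp
  · intro j _ hj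
    rw [Pi.single_eq_of_ne hj.symm]
  · intro h
    exact absurd (Finset.mem_range.2 (floor_lt hT ht)) h

/-- The step functions of the grid as elements of `L^1(J; Z)`. -/
def stepOne {T : ℝ} (hT : 0 < T) (n : ℕ) (Z : Type*) [NormedAddCommGroup Z] [NormedSpace ℂ Z] :
    (ℕ → Z) →ₗ[ℂ] Lp Z 1 (volJ T) where
  toFun x := (memLp_stepFun hT n 1 x).toLp _
  map_add' _ _ := rfl
  map_smul' _ _ := rfl

theorem stepOne_coe {T : ℝ} (hT : 0 < T) (n : ℕ) {Z : Type*} [NormedAddCommGroup Z]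
    [NormedSpace ℂ Z] (x : ℕ → Z) : stepOne hT n Z x =ᵐ[volJ T] stepFun T n x :=
  MemLp.coeFn_toLp (memLp_stepFun hT n 1 x)

/-- The step function with value `z` on the `k`-th cell. -/
def cellStep {T : ℝ} (hT : 0 < T) (r : Exponent) (n k : ℕ) (Z : Type*) [NormedAddCommGroup Z]
    [NormedSpace ℂ Z] : Z →L[ℂ] LrJ T r Z :=
  LinearMap.mkContinuous (stepLr hT r n Z ∘ₗ LinearMap.single ℂ (fun _ : ℕ => Z) k)
    (mesh T n ^ (1 / (r : ℝ))) (fun x => by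
      have hr : (0 : ℝ) < r := zero_lt_one.trans r.2
      have hm := mesh_pos hT n
      rw [← Real.rpow_le_rpow_iff (norm_nonneg _) (by positivity) hr]
      change ‖stepLr hT r n Z (Pi.single k x)‖ ^ (r : ℝ) ≤ _
      rw [norm_stepLr_rpow, Real.mul_rpow (by positivity) (norm_nonneg _), ← Real.rpow_mul hm.le,
        one_div_mul_cancel hr.ne', Real.rpow_one]
      have e : ∀ j, mesh T n * ‖(Pi.single k x : ℕ → Z) j‖ ^ (r : ℝ)
          = if j = k then mesh T n * ‖x‖ ^ (r : ℝ) else 0 := by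
        intro j
        split_ifs with h
        · rw [h, Pi.single_eq_same]
        · rw [Pi.single_eq_of_ne h, norm_zero, Real.zero_rpow hr.ne', mul_zero]
      simp only [e, Finset.sum_ite_eq']
      split_ifs
      · exact le_rfl
      · positivity)

theorem cellStep_apply {T : ℝ} (hT : 0 < T) (r : Exponent) (n k : ℕ) {Z : Type*}
    [NormedAddCommGroup Z] [NormedSpace ℂ Z] (z : Z) :
    cellStep hT r n k Z z = stepLr hT r n Z (Pi.single k z) := rfl

theorem sum_cellStep {T : ℝ} (hT : 0 < T) (r : Exponent) (n : ℕ) {Z : Type*}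
    [NormedAddCommGroup Z] [NormedSpace ℂ Z] (x : ℕ → Z) :
    ∑ k ∈ Finset.range (2 ^ n), cellStep hT r n k Z (x k) = stepLr hT r n Z x := by
  simp only [cellStep_apply]
  rw [← map_sum]
  refine Lp.ext ?_
  filter_upwards [stepLr_coe hT r n x, stepLr_coe hT r n
    (∑ k ∈ Finset.range (2 ^ n), Pi.single k (x k)), ae_volJ_mem T] with t h1 h2 ht
  rw [h1, h2, stepFun_sum_single hT x ht]

variable {A₀ A₁ V : Type*}
  [NormedAddCommGroup A₀] [NormedSpace ℂ A₀] [CompleteSpace A₀]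
  [NormedAddCommGroup A₁] [NormedSpace ℂ A₁] [CompleteSpace A₁]
  [NormedAddCommGroup V] [NormedSpace ℂ V] [CompleteSpace V]
  {i₀ : A₀ →L[ℂ] V} {i₁ : A₁ →L[ℂ] V} {T : ℝ} {r r₀ r₁ : Exponent} {θ : Ioo (0 : ℝ) 1}

theorem lpEmb_stepLr_eq_stepOne (hT : 0 < T) (i : A₀ →L[ℂ] V) (n : ℕ) (x : ℕ → A₀) :
    lpEmb T r i (stepLr hT r n A₀ x) = stepOne hT n V fun k => i (x k) :=
  Lp.ext ((lpEmb_stepLr hT i n x).trans (stepOne_coe hT n _).symm)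

theorem lpEmb_cellStep (hT : 0 < T) (i : A₀ →L[ℂ] V) (n k : ℕ) (a : A₀) :
    lpEmb T r i (cellStep hT r n k A₀ a)
      = (stepOne hT n V ∘ₗ LinearMap.single ℂ (fun _ : ℕ => V) k) (i a) := by
  rw [cellStep_apply, lpEmb_stepLr_eq_stepOne]
  refine congrArg _ (funext fun j => ?_)
  rcases eq_or_ne j k with h | h
  · subst h; simp
  · simp [Pi.single_eq_of_ne h]

theorem compatible_cellStep (hT : 0 < T) (i₀ : A₀ →L[ℂ] V) (i₁ : A₁ →L[ℂ] V) (r₀ r₁ : Exponent)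
    (n k : ℕ) : Compatible i₀ i₁ (lpEmb T r₀ i₀) (lpEmb T r₁ i₁) (cellStep hT r₀ n k A₀)
      (cellStep hT r₁ n k A₁) :=
  Compatible.of_linearMap _ (lpEmb_cellStep hT i₀ n k) (lpEmb_cellStep hT i₁ n k)

/-- Multiply an extension of `x` by the complex power `c ^ (α * (z - θ))` with `c = ‖x‖ / M`: its
value at `θ` is one, and it redistributes the size between the two boundary lines. -/
theorem exists_calderon_scaled
    (hr : 1 / (r : ℝ) = (1 - (θ : ℝ)) / (r₀ : ℝ) + (θ : ℝ) / (r₁ : ℝ)) (x : Interp i₀ i₁ θ) {M : ℝ}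
    (hM : 0 < M) : ∃ H : CalderonSpace i₀ i₁, interpMk i₀ i₁ θ H = x ∧
      (∀ t, ‖H.1.2.1 t‖ ≤ 2 * M * (‖x‖ / M) ^ ((r : ℝ) / r₀)) ∧
      ∀ t, ‖H.1.2.2 t‖ ≤ 2 * M * (‖x‖ / M) ^ ((r : ℝ) / r₁) := by
  have hrp : (0 : ℝ) < r := zero_lt_one.trans r.2
  have hr0 : (0 : ℝ) < r₀ := zero_lt_one.trans r₀.2
  have hr1 : (0 : ℝ) < r₁ := zero_lt_one.trans r₁.2
  rcases (norm_nonneg x).eq_or_lt with hx | hx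
  · refine ⟨0, ?_, fun t => ?_, fun t => ?_⟩
    · rw [map_zero, norm_eq_zero.1 hx.symm]
    · refine (norm_zero (E := A₀)).trans_le (by positivity)
    · refine (norm_zero (E := A₁)).trans_le (by positivity)
  obtain ⟨F, hF, hFn⟩ := exists_interpMk_eq θ x
  rw [calderon_norm_eq] at hFn
  have hF0 := (le_max_left _ _).trans hFn
  have hF1 := (le_max_right _ _).trans hFn
  set c := ‖x‖ / M with hc
  have hc0 : 0 < c := by positivity
  -- Chosen so that `-α * θ = r / r₀ - 1` and `α * (1 - θ) = r / r₁ - 1`; both hold because of the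
  -- relation between the exponents.
  set α : ℝ := r * (1 / r₁ - 1 / r₀) with hα
  set l : ℝ := Real.log c * α with hl
  have hn : ∀ z : ℂ, ‖Complex.exp ((l : ℂ) * (z - (θ : ℝ)))‖ = Real.exp (l * (z.re - θ)) := by
    intro z
    rw [Complex.norm_exp, Complex.re_ofReal_mul, Complex.sub_re, Complex.ofReal_re]
  obtain ⟨H, hH, hH0, hH1⟩ := exists_calderon_smul (φ := fun z : ℂ =>
    Complex.exp ((l : ℂ) * (z - (θ : ℝ)))) (C := Real.exp |l|)
    (Differentiable.differentiableOn (by fun_prop)) (Continuous.continuousOn (by fun_prop))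
    (fun z hz => by
      have h1 : 0 ≤ z.re := hz.1
      have h2 : z.re ≤ 1 := hz.2
      obtain ⟨h3, h4⟩ := θ.2
      rw [hn]
      refine Real.exp_le_exp.2 ((le_abs_self _).trans ?_)
      rw [abs_mul]
      exact mul_le_of_le_one_right (abs_nonneg _) (abs_le.2 ⟨by linarith, by linarith⟩)) F
  have hr' : (r : ℝ) * ((1 - (θ : ℝ)) / (r₀ : ℝ) + (θ : ℝ) / (r₁ : ℝ)) = 1 := by
    rw [← hr, mul_one_div_cancel hrp.ne']
  have e0 : -(α * θ) = (r : ℝ) / r₀ - 1 := by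
    rw [hα]; linear_combination -hr'
  have e1 : α * (1 - θ) = (r : ℝ) / r₁ - 1 := by
    rw [hα]; linear_combination -hr'
  have hxM : ‖x‖ = M * c := by rw [hc]; field_simp
  refine ⟨H, ?_, fun t => ?_, fun t => ?_⟩
  · rw [← hF]
    refine interpMk_eq_of_eval_eq θ ?_
    rw [hH]
    simp [midPt]
  · have e2 : ((leftPt t : ℂ)).re = 0 := by simp [leftPt]
    have e3 : Real.exp (l * (0 - θ)) = c ^ ((r : ℝ) / r₀ - 1) := by
      rw [← e0, Real.rpow_def_of_pos hc0, hl]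
      congr 1; ring
    rw [hH0, norm_smul, hn, e2, e3]
    calc _ ≤ c ^ ((r : ℝ) / r₀ - 1) * (2 * ‖x‖) := by
          gcongr
          exact (norm_apply_le_of_zeroAtInfty _ _).trans hF0
      _ = 2 * M * (c ^ ((r : ℝ) / r₀ - 1) * c ^ (1 : ℝ)) := by rw [hxM, Real.rpow_one]; ring
      _ = _ := by rw [← Real.rpow_add hc0, sub_add_cancel]
  · have e2 : ((rightPt t : ℂ)).re = 1 := by simp [rightPt]
    have e3 : Real.exp (l * (1 - θ)) = c ^ ((r : ℝ) / r₁ - 1) := by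
      rw [← e1, Real.rpow_def_of_pos hc0, hl]
      congr 1; ring
    rw [hH1, norm_smul, hn, e2, e3]
    calc _ ≤ c ^ ((r : ℝ) / r₁ - 1) * (2 * ‖x‖) := by
          gcongr
          exact (norm_apply_le_of_zeroAtInfty _ _).trans hF1
      _ = 2 * M * (c ^ ((r : ℝ) / r₁ - 1) * c ^ (1 : ℝ)) := by rw [hxM, Real.rpow_one]; ring
      _ = _ := by rw [← Real.rpow_add hc0, sub_add_cancel]

/-- Raising the bound on `y` to the power `r₀` leaves exactly the power `r` of `‖x k‖`, so the sum
over the cells is the `L^r` norm of the original step function. -/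
theorem norm_stepLr_le_of_scaled (hT : 0 < T) (n : ℕ) {B : Type*} [NormedAddCommGroup B]
    [NormedSpace ℂ B] (x : ℕ → B) (y : ℕ → A₀) (hM : 0 < ‖stepLr hT r n B x‖)
    (hy : ∀ k, ‖y k‖ ≤ 2 * ‖stepLr hT r n B x‖ *
      (‖x k‖ / ‖stepLr hT r n B x‖) ^ ((r : ℝ) / r₀)) :
    ‖stepLr hT r₀ n A₀ y‖ ≤ 2 * ‖stepLr hT r n B x‖ := by
  have hrp : (0 : ℝ) < r := zero_lt_one.trans r.2
  have hr0 : (0 : ℝ) < r₀ := zero_lt_one.trans r₀.2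
  have hx := norm_stepLr_rpow hT r n x
  set M := ‖stepLr hT r n B x‖ with hMdef
  rw [← Real.rpow_le_rpow_iff (norm_nonneg _) (by positivity) hr0, norm_stepLr_rpow]
  have hm := mesh_pos hT n
  calc _ ≤ ∑ k ∈ Finset.range (2 ^ n), (2 * M) ^ (r₀ : ℝ) / M ^ (r : ℝ) *
        (mesh T n * ‖x k‖ ^ (r : ℝ)) := by
        refine Finset.sum_le_sum fun k _ => ?_
        have h1 := Real.rpow_le_rpow (norm_nonneg _) (hy k) hr0.le
        rw [Real.mul_rpow (by positivity) (by positivity), ← Real.rpow_mul (by positivity),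
          div_mul_cancel₀ _ hr0.ne', Real.div_rpow (norm_nonneg _) hM.le] at h1
        calc _ ≤ mesh T n * ((2 * M) ^ (r₀ : ℝ) * (‖x k‖ ^ (r : ℝ) / M ^ (r : ℝ))) := by gcongr
          _ = _ := by ring
    _ = (2 * M) ^ (r₀ : ℝ) / M ^ (r : ℝ) * M ^ (r : ℝ) := by rw [← Finset.mul_sum, ← hx]
    _ = (2 * M) ^ (r₀ : ℝ) := div_mul_cancel₀ _ (by positivity)

/-- Extend the value on each cell by `exists_calderon_scaled`, with `M` the `L^r` norm of the whole
step function, and add the extensions placed on their cells. -/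
theorem exists_interp_of_step (hT : 0 < T)
    (hr : 1 / (r : ℝ) = (1 - (θ : ℝ)) / (r₀ : ℝ) + (θ : ℝ) / (r₁ : ℝ)) (n : ℕ)
    (x : ℕ → Interp i₀ i₁ θ) : ∃ ξ : Interp (lpEmb T r₀ i₀) (lpEmb T r₁ i₁) θ,
      interpToAmbient _ _ θ ξ
        = lpEmb T r (interpToAmbient i₀ i₁ θ) (stepLr hT r n (Interp i₀ i₁ θ) x) ∧
      ‖ξ‖ ≤ 2 * ‖stepLr hT r n (Interp i₀ i₁ θ) x‖ := by
  rcases (norm_nonneg (stepLr hT r n (Interp i₀ i₁ θ) x)).eq_or_lt with h0 | hM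
  · refine ⟨0, ?_, ?_⟩
    · rw [norm_eq_zero.1 h0.symm, map_zero, map_zero]
    · rw [norm_zero, ← h0, mul_zero]
  choose H hHx hH0 hH1 using fun k => exists_calderon_scaled hr (x k) hM
  set G : CalderonSpace (lpEmb T r₀ i₀) (lpEmb T r₁ i₁) := ∑ k ∈ Finset.range (2 ^ n),
    calderonMap (compatible_cellStep hT i₀ i₁ r₀ r₁ n k) (H k) with hG
  have hl : ∀ t, G.1.2.1 t = stepLr hT r₀ n A₀ fun k => (H k).1.2.1 t := by
    intro t
    let L : CalderonSpace (lpEmb T r₀ i₀) (lpEmb T r₁ i₁) →ₗ[ℂ] LrJ T r₀ A₀ :=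
      { toFun := fun F => F.1.2.1 t, map_add' := fun _ _ => rfl, map_smul' := fun _ _ => rfl }
    rw [← sum_cellStep]
    exact map_sum L _ _
  have hr' : ∀ t, G.1.2.2 t = stepLr hT r₁ n A₁ fun k => (H k).1.2.2 t := by
    intro t
    let L : CalderonSpace (lpEmb T r₀ i₀) (lpEmb T r₁ i₁) →ₗ[ℂ] LrJ T r₁ A₁ :=
      { toFun := fun F => F.1.2.2 t, map_add' := fun _ _ => rfl, map_smul' := fun _ _ => rfl }
    rw [← sum_cellStep]
    exact map_sum L _ _
  refine ⟨interpMk _ _ θ G, ?_, (norm_interpMk_le θ G).trans ?_⟩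
  · rw [hG, map_sum, map_sum, ← sum_cellStep, map_sum]
    refine Finset.sum_congr rfl fun k _ => ?_
    rw [← interpMap_interpMk, hHx, interpToAmbient_interpMap _ θ _ (lpEmb_cellStep hT i₀ n k)
      (lpEmb_cellStep hT i₁ n k), lpEmb_cellStep]
  · rw [calderon_norm_eq]
    refine max_le ((zeroAtInfty_norm_le (by positivity)).2 fun t => ?_)
      ((zeroAtInfty_norm_le (by positivity)).2 fun t => ?_)
    · rw [hl]
      exact norm_stepLr_le_of_scaled hT n x _ hM fun k => hH0 k t
    · rw [hr']
      exact norm_stepLr_le_of_scaled hT n x _ hM fun k => hH1 k t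

/-- `L^r(J; [A₀, A₁]_θ)` is contained in `[L^{r₀}(J; A₀), L^{r₁}(J; A₁)]_θ`. -/
theorem exists_Lr_to_interp (hT : 0 < T)
    (hr : 1 / (r : ℝ) = (1 - (θ : ℝ)) / (r₀ : ℝ) + (θ : ℝ) / (r₁ : ℝ)) (i₀ : A₀ →L[ℂ] V)
    (i₁ : A₁ →L[ℂ] V) :
    ∃ Λ : LrJ T r (Interp i₀ i₁ θ) →L[ℂ] Interp (lpEmb T r₀ i₀) (lpEmb T r₁ i₁) θ, ∀ f,
      interpToAmbient _ _ θ (Λ f) = lpEmb T r (interpToAmbient i₀ i₁ θ) f := by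
  refine exists_lift (interpToAmbient_injective (lpEmb T r₀ i₀) (lpEmb T r₁ i₁) θ) (C := 2)
    fun f => ?_
  rcases (norm_nonneg f).eq_or_lt with hf | hf
  · have : f = 0 := norm_eq_zero.1 hf.symm
    subst this
    exact ⟨0, 0, by simp, by simp, by simp⟩
  obtain ⟨n, hn⟩ := Metric.tendsto_atTop.1 (tendsto_gridProj hT r f) (‖f‖ / 2) (by positivity)
  have hn := hn n le_rfl
  rw [dist_comm, dist_eq_norm] at hn
  obtain ⟨ξ, hξ, hξn⟩ := exists_interp_of_step (r₀ := r₀) (r₁ := r₁) hT hr n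
    fun k => cellAvg T n k (Interp i₀ i₁ θ) (inclL1 T r _ f)
  rw [← gridProj_apply] at hξ hξn
  refine ⟨ξ, f - gridProj hT r n _ f, ?_, hξn.trans ?_, hn.le⟩
  · rw [hξ, map_sub]
    abel
  · exact mul_le_mul_of_nonneg_left (norm_gridProj_le hT r n f) zero_le_two

end StepFunctions

end

/-! ### Maximal regularity spaces inside an ambient Bochner space. -/

section
section GeneralLemmas

variable {A₀ A₁ V B₀ B₁ W U : Type*}
  [NormedAddCommGroup A₀] [NormedSpace ℂ A₀] [NormedAddCommGroup A₁] [NormedSpace ℂ A₁]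
  [NormedAddCommGroup V] [NormedSpace ℂ V]
  [NormedAddCommGroup B₀] [NormedSpace ℂ B₀] [NormedAddCommGroup B₁] [NormedSpace ℂ B₁]
  [NormedAddCommGroup W] [NormedSpace ℂ W] [AddCommGroup U] [Module ℂ U]
  {i₀ : A₀ →L[ℂ] V} {i₁ : A₁ →L[ℂ] V} {j₀ : B₀ →L[ℂ] W} {j₁ : B₁ →L[ℂ] W}
  {S₀ : A₀ →L[ℂ] B₀} {S₁ : A₁ →L[ℂ] B₁}

theorem sumSpace_hom_ext {P Q : SumSpace i₀ i₁ →ₗ[ℂ] U}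
    (h₀ : ∀ a, P (sumInl i₀ i₁ a) = Q (sumInl i₀ i₁ a))
    (h₁ : ∀ a, P (sumInr i₀ i₁ a) = Q (sumInr i₀ i₁ a)) (x : SumSpace i₀ i₁) : P x = Q x := by
  obtain ⟨a, b, rfl⟩ := exists_sumMk_eq x
  rw [map_add, map_add, h₀, h₁]

theorem interpToAmbient_interpMap_eq (h : Compatible i₀ i₁ j₀ j₁ S₀ S₁) (θ : Ioo (0 : ℝ) 1)
    (x : Interp i₀ i₁ θ) : interpToAmbient j₀ j₁ θ (interpMap h θ x)
      = sumToAmbient j₀ j₁ (sumMap h (interpToSum i₀ i₁ θ x)) :=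
  congrArg (sumToAmbient j₀ j₁) (interpToSum_interpMap h θ x)

variable {D X : Type*} [NormedAddCommGroup D] [NormedSpace ℂ D]
  [NormedAddCommGroup X] [NormedSpace ℂ X] {T : ℝ} {r : Exponent}

theorem lpEmb_comp (k : V →L[ℂ] W) (i : A₀ →L[ℂ] V) (f : LrJ T r A₀) :
    lpEmb T r (k ∘L i) f = k.compLpL 1 (volJ T) (lpEmb T r i f) := by
  refine Lp.ext ?_
  filter_upwards [lpEmb_coe (k ∘L i) f, compLpL_coe k (lpEmb T r i f), lpEmb_coe i f] with t h1 h2 h3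
  rw [h1, h2, h3]
  rfl

theorem lpEmb_compLpL (k : V →L[ℂ] W) (i : A₀ →L[ℂ] V) (f : LrJ T r A₀) :
    lpEmb T r k (i.compLpL _ _ f) = lpEmb T r (k ∘L i) f := by
  refine Lp.ext ?_
  filter_upwards [lpEmb_coe (k ∘L i) f, lpEmb_coe k (i.compLpL _ _ f), compLpL_coe i f]
    with t h1 h2 h3
  rw [h1, h2, h3]
  rfl

/-- The primitive of the derivative automatically supplies the representative in `L^r(J; X)`, so the
condition can be checked in the ambient space. This is the form in which it survives interpolation.
-/
theorem mem_mrSubmodule_iff_lpEmb [CompleteSpace X] [CompleteSpace V] (hT : 0 < T)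
    (iD : D →L[ℂ] V) (iX : X →L[ℂ] V) (p : WithLp 1 (LrJ T r D × LrJ T r X)) :
    p ∈ mrSubmodule T r iD iX ↔ lpEmb T r iD p.fst = volterra T V (lpEmb T r iX p.snd) := by
  have e : ∀ w : LrJ T r X, inclL1 T r X w = volterra T X (inclL1 T r X p.snd) →
      inclL1 T r V (iX.compLpL _ _ w) = volterra T V (lpEmb T r iX p.snd) := by
    intro w hw
    rw [inclL1_compLpL, hw, ← volterra_compLpL]
    rfl
  have e' : lpEmb T r iD p.fst = inclL1 T r V (iD.compLpL _ _ p.fst) := (inclL1_compLpL _ _).symm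
  constructor
  · rintro ⟨w, hw, hp⟩
    rw [e', hw, e w ((isW0_iff_volterra hT _ _).1 hp)]
  · intro h
    obtain ⟨w, hw⟩ := exists_inclL1_eq_volterra r (inclL1 T r X p.snd)
    refine ⟨w, inclL1_injective T r ?_, (isW0_iff_volterra hT _ _).2 hw⟩
    rw [e w hw, ← h, e']

theorem MRSpace.lpEmb_fnL [CompleteSpace X] [CompleteSpace V] (hT : 0 < T) {iD : D →L[ℂ] V}
    {iX : X →L[ℂ] V} (u : MRSpace T r iD iX) :
    lpEmb T r iD (MRSpace.fnL T r iD iX u)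
      = volterra T V (lpEmb T r iX (MRSpace.derivL T r iD iX u)) :=
  (mem_mrSubmodule_iff_lpEmb hT iD iX _).1 u.2

theorem mrToL1_eq_lpEmb {iD : D →L[ℂ] V} {iX : X →L[ℂ] V} (k : D →L[ℂ] W) (u : MRSpace T r iD iX) :
    mrToL1 T r iD iX k u = lpEmb T r k (MRSpace.fnL T r iD iX u) :=
  inclL1_compLpL _ _

theorem mrToL1_injective [CompleteSpace X] [CompleteSpace V] (hT : 0 < T) (iD : D →L[ℂ] V)
    {iX : X →L[ℂ] V} {k : D →L[ℂ] W} (hX : Function.Injective iX) (hk : Function.Injective k) :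
    Function.Injective (mrToL1 T r iD iX k) := by
  refine (injective_iff_map_eq_zero _).2 fun u hu => ?_
  rw [mrToL1_eq_lpEmb] at hu
  have h1 : MRSpace.fnL T r iD iX u = 0 := lpEmb_injective T r hk (hu.trans (map_zero _).symm)
  have h2 := MRSpace.lpEmb_fnL hT u
  rw [h1, map_zero] at h2
  have h3 : MRSpace.derivL T r iD iX u = 0 := by
    refine lpEmb_injective T r hX (volterra_injective hT ?_)
    rw [← h2, map_zero, map_zero]
  exact Subtype.ext (WithLp.ofLp_injective 1 (Prod.ext h1 h3))

/-- The extension of the primitive relation from `X` to a larger space. -/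
theorem MR.toL1_eq_volterra [CompleteSpace X] [CompleteSpace W] (hT : 0 < T) {i : D →L[ℂ] X}
    (k : X →L[ℂ] W) (u : MR T r i) :
    MR.toL1 T r i k u = volterra T W (lpEmb T r k (MRSpace.derivL T r i _ u)) := by
  rw [MR.toL1, mrToL1_eq_lpEmb, lpEmb_comp]
  have h : lpEmb T r i (MRSpace.fnL T r i (ContinuousLinearMap.id ℂ X) u)
    = volterra T X (inclL1 T r X (MRSpace.derivL T r i _ u)) := MR.compLpL_fnL hT u
  rw [h, ← volterra_compLpL]
  rfl

end GeneralLemmas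

end

/-! ### From the interpolation space to the maximal regularity space. -/

section
theorem MRSpace.exists_lift_pair {Z D X V : Type*} [NormedAddCommGroup Z] [NormedSpace ℂ Z]
    [NormedAddCommGroup D] [NormedSpace ℂ D] [NormedAddCommGroup X] [NormedSpace ℂ X]
    [CompleteSpace X] [NormedAddCommGroup V] [NormedSpace ℂ V] [CompleteSpace V] {T : ℝ}
    (hT : 0 < T) {r : Exponent} {iD : D →L[ℂ] V} {iX : X →L[ℂ] V} (F : Z →L[ℂ] LrJ T r D)
    (G : Z →L[ℂ] LrJ T r X) (h : ∀ z, lpEmb T r iD (F z) = volterra T V (lpEmb T r iX (G z))) :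
    ∃ Φ : Z →L[ℂ] MRSpace T r iD iX, ∀ z, MRSpace.fnL T r iD iX (Φ z) = F z :=
  ⟨((WithLp.prodContinuousLinearEquiv 1 ℂ _ _).symm.toContinuousLinearMap ∘L
    (F.prod G)).codRestrict (mrSubmodule T r iD iX) fun z =>
      (mem_mrSubmodule_iff_lpEmb hT iD iX _).2 (h z), fun _ => rfl⟩

section CommonMaximalRegularity

variable {D X E Y : Type*}
  [NormedAddCommGroup D] [NormedSpace ℂ D] [CompleteSpace D]
  [NormedAddCommGroup X] [NormedSpace ℂ X] [CompleteSpace X]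
  [NormedAddCommGroup E] [NormedSpace ℂ E] [CompleteSpace E]
  [NormedAddCommGroup Y] [NormedSpace ℂ Y] [CompleteSpace Y]
  {T : ℝ} {iXY : X →L[ℂ] Y} {iDX : D →L[ℂ] X} {iEY : E →L[ℂ] Y} {r₀ r₁ r : Exponent}
  {θ : Ioo (0 : ℝ) 1}

/-- If `D` is contained in `E`, then the inclusion is continuous. -/
theorem exists_continuous_inclusion (iD : D →L[ℂ] Y) (hE : Function.Injective iEY)
    (h : ∀ d, ∃ e, iEY e = iD d) : ∃ J : D →L[ℂ] E, ∀ d, iEY (J d) = iD d := by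
  choose J hJ using h
  let L : D →ₗ[ℂ] E :=
    { toFun := J
      map_add' := fun a b => hE (by rw [map_add, hJ, hJ, hJ, map_add])
      map_smul' := fun c a => hE (by rw [RingHom.id_apply, map_smul, hJ, hJ, map_smul]) }
  refine ⟨⟨L, L.continuous_of_seq_closed_graph fun u x y hu hy => hE ?_⟩, hJ⟩
  have h1 : Tendsto (fun n => iEY (J (u n))) atTop (𝓝 (iEY y)) := (iEY.continuous.tendsto y).comp hy
  have h2 : Tendsto (fun n => iD (u n)) atTop (𝓝 (iD x)) := (iD.continuous.tendsto x).comp hu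
  simp only [hJ] at h1
  exact (tendsto_nhds_unique h1 h2).trans (hJ x).symm

variable (T iXY iDX iEY r₀ r₁) in
theorem compatible_fnL : Compatible (MR.toL1 T r₀ iDX iXY)
    (MR.toL1 T r₁ iEY (ContinuousLinearMap.id ℂ Y)) (lpEmb T r₀ (iXY ∘L iDX)) (lpEmb T r₁ iEY)
    (MRSpace.fnL T r₀ iDX _) (MRSpace.fnL T r₁ iEY _) :=
  Compatible.of_linearMap LinearMap.id (fun _ => (mrToL1_eq_lpEmb _ _).symm)
    fun _ => (mrToL1_eq_lpEmb _ _).symm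

theorem interpToAmbient_interpMap_fnL (ξ : Interp (MR.toL1 T r₀ iDX iXY)
    (MR.toL1 T r₁ iEY (ContinuousLinearMap.id ℂ Y)) θ) :
    interpToAmbient (lpEmb T r₀ (iXY ∘L iDX)) (lpEmb T r₁ iEY) θ
      (interpMap (compatible_fnL T iXY iDX iEY r₀ r₁) θ ξ) = interpToAmbient (MR.toL1 T r₀ iDX iXY)
        (MR.toL1 T r₁ iEY (ContinuousLinearMap.id ℂ Y)) θ ξ :=
  interpToAmbient_interpMap (compatible_fnL T iXY iDX iEY r₀ r₁) θ LinearMap.id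
    (fun _ => (mrToL1_eq_lpEmb _ _).symm) (fun _ => (mrToL1_eq_lpEmb _ _).symm) ξ

-- Differentiation does not act on all of `L¹(J; Y)`, so compatibility cannot come from an ambient
-- linear map; it follows from injectivity of the Volterra operator.
variable (iXY iDX iEY r₀ r₁) in
theorem compatible_derivL (hT : 0 < T) : Compatible (MR.toL1 T r₀ iDX iXY)
    (MR.toL1 T r₁ iEY (ContinuousLinearMap.id ℂ Y)) (lpEmb T r₀ iXY)
    (lpEmb T r₁ (ContinuousLinearMap.id ℂ Y))
    (MRSpace.derivL T r₀ iDX _) (MRSpace.derivL T r₁ iEY _) := by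
  intro u v huv
  refine volterra_injective hT ?_
  rw [map_add, ← MR.toL1_eq_volterra hT, ← MR.toL1_eq_volterra hT, huv, map_zero]

/-- Both sides are linear on the sum space and agree on each of the two summands, where the claim is
the primitive relation for a single maximal regularity space. -/
theorem volterra_interpMap_derivL (hT : 0 < T) (ξ : Interp (MR.toL1 T r₀ iDX iXY)
    (MR.toL1 T r₁ iEY (ContinuousLinearMap.id ℂ Y)) θ) :
    volterra T Y (interpToAmbient _ _ θ (interpMap (compatible_derivL iXY iDX iEY r₀ r₁ hT) θ ξ))
      = interpToAmbient _ _ θ ξ := by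
  rw [interpToAmbient_interpMap_eq]
  refine sumSpace_hom_ext (P := ((volterra T Y ∘L sumToAmbient _ _) ∘L
    sumMap (compatible_derivL iXY iDX iEY r₀ r₁ hT)).toLinearMap)
    (Q := (sumToAmbient _ _).toLinearMap) (fun u => ?_) (fun u => ?_) (interpToSum _ _ θ ξ)
  · change volterra T Y (sumToAmbient _ _ (sumMap _ (sumInl _ _ u))) = sumToAmbient _ _ (sumInl _ _ u)
    rw [sumMap_sumInl, sumToAmbient_sumInl, sumToAmbient_sumInl, MR.toL1_eq_volterra hT]
  · change volterra T Y (sumToAmbient _ _ (sumMap _ (sumInr _ _ u))) = sumToAmbient _ _ (sumInr _ _ u)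
    rw [sumMap_sumInr, sumToAmbient_sumInr, sumToAmbient_sumInr, MR.toL1_eq_volterra hT]

/-- The inclusion of the interpolation space of maximal regularity spaces in the maximal regularity
space of the interpolation spaces. -/
theorem exists_interp_MR_to_MR (hT : 0 < T)
    (hr : 1 / (r : ℝ) = (1 - (θ : ℝ)) / (r₀ : ℝ) + (θ : ℝ) / (r₁ : ℝ))
    (iXY : X →L[ℂ] Y) (iDX : D →L[ℂ] X) (iEY : E →L[ℂ] Y) :
    ∃ Φ : Interp (MR.toL1 T r₀ iDX iXY) (MR.toL1 T r₁ iEY (ContinuousLinearMap.id ℂ Y)) θ →L[ℂ]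
      MRSpace T r (interpToAmbient (iXY ∘L iDX) iEY θ)
        (interpToAmbient iXY (ContinuousLinearMap.id ℂ Y) θ), ∀ ξ,
      mrToL1 T r (interpToAmbient (iXY ∘L iDX) iEY θ)
        (interpToAmbient iXY (ContinuousLinearMap.id ℂ Y) θ)
        (interpToAmbient (iXY ∘L iDX) iEY θ) (Φ ξ) = interpToAmbient _ _ θ ξ := by
  obtain ⟨Λ, hΛ⟩ := exists_interp_to_Lr hT hr (iXY ∘L iDX) iEY
  obtain ⟨Λ', hΛ'⟩ := exists_interp_to_Lr hT hr iXY (ContinuousLinearMap.id ℂ Y)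
  obtain ⟨F, hF⟩ : ∃ F : Interp (MR.toL1 T r₀ iDX iXY) (MR.toL1 T r₁ iEY (ContinuousLinearMap.id ℂ Y)) θ
      →L[ℂ] LrJ T r (Interp (iXY ∘L iDX) iEY θ), ∀ ξ,
      lpEmb T r (interpToAmbient (iXY ∘L iDX) iEY θ) (F ξ) = interpToAmbient (MR.toL1 T r₀ iDX iXY)
        (MR.toL1 T r₁ iEY (ContinuousLinearMap.id ℂ Y)) θ ξ :=
    ⟨Λ ∘L interpMap (compatible_fnL T iXY iDX iEY r₀ r₁) θ, fun ξ =>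
      (hΛ _).trans (interpToAmbient_interpMap_fnL ξ)⟩
  obtain ⟨G, hG⟩ : ∃ G : Interp (MR.toL1 T r₀ iDX iXY) (MR.toL1 T r₁ iEY (ContinuousLinearMap.id ℂ Y)) θ
      →L[ℂ] LrJ T r (Interp iXY (ContinuousLinearMap.id ℂ Y) θ), ∀ ξ,
      volterra T Y (lpEmb T r (interpToAmbient iXY (ContinuousLinearMap.id ℂ Y) θ) (G ξ))
        = interpToAmbient (MR.toL1 T r₀ iDX iXY)
          (MR.toL1 T r₁ iEY (ContinuousLinearMap.id ℂ Y)) θ ξ :=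
    ⟨Λ' ∘L interpMap (compatible_derivL iXY iDX iEY r₀ r₁ hT) θ, fun ξ =>
      (congrArg (volterra T Y) (hΛ' _)).trans (volterra_interpMap_derivL hT ξ)⟩
  obtain ⟨Φ, hΦ⟩ := MRSpace.exists_lift_pair hT F G fun ξ => (hF ξ).trans (hG ξ).symm
  refine ⟨Φ, fun ξ => ?_⟩
  rw [mrToL1_eq_lpEmb, hΦ]
  exact hF ξ

end CommonMaximalRegularity

end

/-! ### From the maximal regularity space to the interpolation space. -/

section
section SolutionOperator

variable {D X E Y : Type*}
  [NormedAddCommGroup D] [NormedSpace ℂ D] [CompleteSpace D]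
  [NormedAddCommGroup X] [NormedSpace ℂ X] [CompleteSpace X]
  [NormedAddCommGroup E] [NormedSpace ℂ E] [CompleteSpace E]
  [NormedAddCommGroup Y] [NormedSpace ℂ Y] [CompleteSpace Y]
  {T : ℝ} {iXY : X →L[ℂ] Y} {iDX : D →L[ℂ] X} {iEY : E →L[ℂ] Y} {r₀ r₁ r : Exponent}
  {θ : Ioo (0 : ℝ) 1} {B : E →L[ℂ] Y} {BD : D →L[ℂ] X} {J : D →L[ℂ] E}

theorem HasMaxRegExp.eq_of_eq (hT : 0 < T) {s : Exponent} {i A : D →L[ℂ] X}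
    (h : HasMaxRegExp T s i A) {u u' : Lp D 1 (volJ T)} {v v' : Lp X 1 (volJ T)}
    (hu : i.compLpL 1 (volJ T) u = volterra T X v) (hu' : i.compLpL 1 (volJ T) u' = volterra T X v')
    (he : v + A.compLpL 1 (volJ T) u = v' + A.compLpL 1 (volJ T) u') : u = u' := by
  refine sub_eq_zero.1 (h.eq_zero hT (u := u - u') (v := v - v') ?_ ?_).1
  · rw [map_sub, map_sub, hu, hu']
  · rw [map_sub, sub_add_sub_comm, he, sub_self]

theorem MR.extend (hT : 0 < T) (hJ : ∀ d, iEY (J d) = iXY (iDX d)) (hB : ∀ d, iXY (BD d) = B (J d))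
    (u : MR T r iDX) :
    iEY.compLpL 1 (volJ T) (lpEmb T r J (MRSpace.fnL T r iDX _ u)) = MR.toL1 T r iDX iXY u ∧
    iEY.compLpL 1 (volJ T) (lpEmb T r J (MRSpace.fnL T r iDX _ u))
      = volterra T Y (lpEmb T r iXY (MRSpace.derivL T r iDX _ u)) ∧
    lpEmb T r iXY (MRSpace.derivL T r iDX _ u)
      + B.compLpL 1 (volJ T) (lpEmb T r J (MRSpace.fnL T r iDX _ u))
        = lpEmb T r iXY (parabolic T r iDX BD u) := by
  have h1 : iEY ∘L J = iXY ∘L iDX := ContinuousLinearMap.ext hJ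
  have h2 : iXY ∘L BD = B ∘L J := ContinuousLinearMap.ext hB
  have e : iEY.compLpL 1 (volJ T) (lpEmb T r J (MRSpace.fnL T r iDX _ u)) = MR.toL1 T r iDX iXY u := by
    rw [← lpEmb_comp, h1, MR.toL1, mrToL1_eq_lpEmb]
  refine ⟨e, e.trans (MR.toL1_eq_volterra hT _ _), ?_⟩
  rw [← lpEmb_comp, ← h2, ← lpEmb_compLpL, ← map_add]
  rfl

variable {SX : LrJ T r₀ X →L[ℂ] MR T r₀ iDX} {SY : LrJ T r₁ Y →L[ℂ] MR T r₁ iEY}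

/-- The solutions on `X` and on `Y` are added inside `L¹(J; E)`, so that both become solutions of
the single equation of `B` on `Y`, where uniqueness of integrable solutions is available. -/
theorem exists_extension_of_sum (hT : 0 < T) (hJ : ∀ d, iEY (J d) = iXY (iDX d))
    (hB : ∀ d, iXY (BD d) = B (J d)) (hSX : ∀ f, parabolic T r₀ iDX BD (SX f) = f)
    (hSY : ∀ f, parabolic T r₁ iEY B (SY f) = f) (f : LrJ T r₀ X) (g : LrJ T r₁ Y) :
    ∃ (u : Lp E 1 (volJ T)) (v : Lp Y 1 (volJ T)),
      iEY.compLpL 1 (volJ T) u = MR.toL1 T r₀ iDX iXY (SX f)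
        + MR.toL1 T r₁ iEY (ContinuousLinearMap.id ℂ Y) (SY g) ∧
      iEY.compLpL 1 (volJ T) u = volterra T Y v ∧
      v + B.compLpL 1 (volJ T) u = lpEmb T r₀ iXY f + lpEmb T r₁ (ContinuousLinearMap.id ℂ Y) g := by
  obtain ⟨h1, h2, h3⟩ := MR.extend hT hJ hB (SX f)
  obtain ⟨k1, k2, k3⟩ := MR.extend (iXY := ContinuousLinearMap.id ℂ Y) (iEY := iEY) (B := B)
    (J := ContinuousLinearMap.id ℂ E) hT (fun _ => rfl) (fun _ => rfl) (SY g)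
  refine ⟨lpEmb T r₀ J (MRSpace.fnL T r₀ iDX _ (SX f))
    + lpEmb T r₁ (ContinuousLinearMap.id ℂ E) (MRSpace.fnL T r₁ iEY _ (SY g)),
    lpEmb T r₀ iXY (MRSpace.derivL T r₀ iDX _ (SX f))
      + lpEmb T r₁ (ContinuousLinearMap.id ℂ Y) (MRSpace.derivL T r₁ iEY _ (SY g)), ?_, ?_, ?_⟩
  · rw [map_add, h1, k1]
  · rw [map_add, map_add, h2, k2]
  · rw [map_add, add_add_add_comm, h3, k3, hSX, hSY]

/-- If the two data cancel in `L¹(J; Y)`, the sum of the solutions is an integrable solution of the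
homogeneous equation on `Y`, hence zero. -/
theorem compatible_solution (hT : 0 < T) (hY : HasMaxRegExp T r₁ iEY B)
    (hJ : ∀ d, iEY (J d) = iXY (iDX d)) (hB : ∀ d, iXY (BD d) = B (J d))
    (hSX : ∀ f, parabolic T r₀ iDX BD (SX f) = f) (hSY : ∀ f, parabolic T r₁ iEY B (SY f) = f) :
    Compatible (lpEmb T r₀ iXY) (lpEmb T r₁ (ContinuousLinearMap.id ℂ Y)) (MR.toL1 T r₀ iDX iXY)
      (MR.toL1 T r₁ iEY (ContinuousLinearMap.id ℂ Y)) SX SY := by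
  intro f g hfg
  obtain ⟨u, v, h1, h2, h3⟩ := exists_extension_of_sum hT hJ hB hSX hSY f g
  rw [← h1, (hY.eq_zero hT h2 (h3.trans hfg)).1, map_zero]

theorem compatible_operator (hE : Function.Injective iEY) (hJ : ∀ d, iEY (J d) = iXY (iDX d))
    (hB : ∀ d, iXY (BD d) = B (J d)) :
    Compatible (iXY ∘L iDX) iEY iXY (ContinuousLinearMap.id ℂ Y) BD B := by
  intro d e hde
  have h0 : J d + e = 0 := hE (by rw [map_add, hJ, map_zero]; exact hde)
  change iXY (BD d) + B e = 0
  rw [hB, ← map_add, h0, map_zero]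

/-- Because `D` lies in `E`, the couple can be viewed with ambient space `E`, which embeds its
interpolation space in `E`. There `B` is defined and extends the interpolated operator, so the
equation in the interpolation spaces becomes an equation for `B` on `Y`. -/
theorem exists_interp_to_right (hE : Function.Injective iEY) (hJ : ∀ d, iEY (J d) = iXY (iDX d))
    (hB : ∀ d, iXY (BD d) = B (J d)) (θ : Ioo (0 : ℝ) 1) :
    ∃ jE : Interp (iXY ∘L iDX) iEY θ →L[ℂ] E,
      (∀ x, iEY (jE x) = interpToAmbient (iXY ∘L iDX) iEY θ x) ∧
      ∀ x, B (jE x) = interpToAmbient iXY (ContinuousLinearMap.id ℂ Y) θ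
        (interpMap (compatible_operator hE hJ hB) θ x) := by
  have hc : Compatible (iXY ∘L iDX) iEY J (ContinuousLinearMap.id ℂ E) (ContinuousLinearMap.id ℂ D)
      (ContinuousLinearMap.id ℂ E) := fun d e hde => hE (by
    change iEY (J d + e) = iEY 0
    rw [map_add, hJ, map_zero]
    exact hde)
  refine ⟨interpToAmbient J (ContinuousLinearMap.id ℂ E) θ ∘L interpMap hc θ, fun x => ?_, fun x => ?_⟩
  · rw [ContinuousLinearMap.comp_apply, interpToAmbient_interpMap_eq, interpToAmbient,
      ContinuousLinearMap.comp_apply]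
    obtain ⟨d, e, h⟩ := exists_sumMk_eq (interpToSum (iXY ∘L iDX) iEY θ x)
    rw [← h]
    simp only [map_add, sumMap_sumInl, sumMap_sumInr, sumToAmbient_sumInl, sumToAmbient_sumInr]
    exact congrArg (· + _) (hJ d)
  · rw [ContinuousLinearMap.comp_apply, interpToAmbient_interpMap_eq, interpToAmbient_interpMap_eq]
    obtain ⟨d, e, h⟩ := exists_sumMk_eq (interpToSum (iXY ∘L iDX) iEY θ x)
    rw [← h]
    simp only [map_add, sumMap_sumInl, sumMap_sumInr, sumToAmbient_sumInl, sumToAmbient_sumInr]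
    exact congrArg (· + _) (hB d).symm

/-- The inclusion of the maximal regularity space of the interpolation spaces in the interpolation
space of maximal regularity spaces. -/
theorem exists_MR_to_interp_MR (hT : 0 < T)
    (hr : 1 / (r : ℝ) = (1 - (θ : ℝ)) / (r₀ : ℝ) + (θ : ℝ) / (r₁ : ℝ))
    (hE : Function.Injective iEY) (hX : HasMaxRegExp T r₀ iDX BD) (hY : HasMaxRegExp T r₁ iEY B)
    (hJ : ∀ d, iEY (J d) = iXY (iDX d)) (hB : ∀ d, iXY (BD d) = B (J d)) :
    ∃ Ψ : MRSpace T r (interpToAmbient (iXY ∘L iDX) iEY θ)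
        (interpToAmbient iXY (ContinuousLinearMap.id ℂ Y) θ) →L[ℂ]
      Interp (MR.toL1 T r₀ iDX iXY) (MR.toL1 T r₁ iEY (ContinuousLinearMap.id ℂ Y)) θ, ∀ p,
      interpToAmbient (MR.toL1 T r₀ iDX iXY) (MR.toL1 T r₁ iEY (ContinuousLinearMap.id ℂ Y)) θ (Ψ p)
        = mrToL1 T r (interpToAmbient (iXY ∘L iDX) iEY θ)
          (interpToAmbient iXY (ContinuousLinearMap.id ℂ Y) θ)
          (interpToAmbient (iXY ∘L iDX) iEY θ) p := by
  obtain ⟨SX, hSX⟩ := hX.exists_solution_operator hT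
  obtain ⟨SY, hSY⟩ := hY.exists_solution_operator hT
  obtain ⟨Λ, hΛ⟩ := exists_Lr_to_interp (r := r) (r₀ := r₀) (r₁ := r₁) (θ := θ) hT hr iXY
    (ContinuousLinearMap.id ℂ Y)
  obtain ⟨jE, hjE, hjB⟩ := exists_interp_to_right hE hJ hB θ
  have hS := compatible_solution hT hY hJ hB hSX hSY
  set jX := interpToAmbient iXY (ContinuousLinearMap.id ℂ Y) θ with hjX
  set jD := interpToAmbient (iXY ∘L iDX) iEY θ with hjD
  set Bθ := interpMap (compatible_operator hE hJ hB) θ with hBθ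
  have e1 : iEY ∘L jE = jD := ContinuousLinearMap.ext hjE
  have e2 : B ∘L jE = jX ∘L Bθ := ContinuousLinearMap.ext hjB
  -- Form the right-hand side of the equation satisfied by `p`, regard it as an element of the
  -- interpolation space of the Bochner spaces, and apply the interpolated solution operator.
  refine ⟨interpMap hS θ ∘L Λ ∘L (MRSpace.derivL T r jD jX + Bθ.compLpL _ _ ∘L MRSpace.fnL T r jD jX),
    fun p => ?_⟩
  set F := (MRSpace.derivL T r jD jX + Bθ.compLpL _ _ ∘L MRSpace.fnL T r jD jX) p with hF
  change interpToAmbient _ _ θ (interpMap hS θ (Λ F)) = _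
  rw [interpToAmbient_interpMap_eq]
  have hΛF := hΛ F
  rw [interpToAmbient, ContinuousLinearMap.comp_apply] at hΛF
  obtain ⟨f, g, hfg⟩ := exists_sumMk_eq (interpToSum (lpEmb T r₀ iXY)
    (lpEmb T r₁ (ContinuousLinearMap.id ℂ Y)) θ (Λ F))
  rw [← hfg, map_add, sumToAmbient_sumInl, sumToAmbient_sumInr] at hΛF
  rw [← hfg, map_add, map_add, sumMap_sumInl, sumMap_sumInr, sumToAmbient_sumInl,
    sumToAmbient_sumInr]
  obtain ⟨u, v, h1, h2, h3⟩ := exists_extension_of_sum hT hJ hB hSX hSY f g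
  rw [hΛF] at h3
  have hp1 : iEY.compLpL 1 (volJ T) (lpEmb T r jE (MRSpace.fnL T r jD jX p))
      = lpEmb T r jD (MRSpace.fnL T r jD jX p) := by
    rw [← lpEmb_comp, e1]
  have hp2 := hp1.trans (MRSpace.lpEmb_fnL hT p)
  have hp3 : lpEmb T r jX (MRSpace.derivL T r jD jX p)
      + B.compLpL 1 (volJ T) (lpEmb T r jE (MRSpace.fnL T r jD jX p)) = lpEmb T r jX F := by
    rw [← lpEmb_comp, e2, ← lpEmb_compLpL, ← map_add]
    rfl
  -- The reconstructed function and `p` are both integrable solutions of the equation of `B` on `Y`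
  -- with the right-hand side `F`, so they coincide.
  rw [← h1, hY.eq_of_eq hT h2 hp2 (h3.trans hp3.symm), hp1, mrToL1_eq_lpEmb]

end SolutionOperator

end

end MaxReg

end

/-! ### The interpolation theorem for maximal regularity spaces. -/

open MaxReg in
theorem lemma3p2 {D X E Y : Type*}
    [NormedAddCommGroup D] [NormedSpace ℂ D] [CompleteSpace D]
    [NormedAddCommGroup X] [NormedSpace ℂ X] [CompleteSpace X]
    [NormedAddCommGroup E] [NormedSpace ℂ E] [CompleteSpace E]
    [NormedAddCommGroup Y] [NormedSpace ℂ Y] [CompleteSpace Y]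
    (T : ℝ) (hT : 0 < T)
    (iXY : X →L[ℂ] Y) (iDX : D →L[ℂ] X) (iEY : E →L[ℂ] Y)
    (h : IsCommonMaxRegPair T iXY iDX iEY)
    (r₀ r₁ r : Exponent) (θ : Set.Ioo (0 : ℝ) 1)
    (hr : 1 / (r : ℝ) = (1 - (θ : ℝ)) / (r₀ : ℝ) + (θ : ℝ) / (r₁ : ℝ)) :
    IsCouple (MR.toL1 T r₀ iDX iXY) (MR.toL1 T r₁ iEY (ContinuousLinearMap.id ℂ Y)) ∧
    SameSpace
      (A₀ := Interp (MR.toL1 T r₀ iDX iXY) (MR.toL1 T r₁ iEY (ContinuousLinearMap.id ℂ Y)) θ)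
      (A₁ := MRSpace T r
        (interpToAmbient (iXY ∘L iDX) iEY θ)
        (interpToAmbient iXY (ContinuousLinearMap.id ℂ Y) θ))
      (interpToAmbient (MR.toL1 T r₀ iDX iXY) (MR.toL1 T r₁ iEY (ContinuousLinearMap.id ℂ Y)) θ)
      (mrToL1 T r
        (interpToAmbient (iXY ∘L iDX) iEY θ)
        (interpToAmbient iXY (ContinuousLinearMap.id ℂ Y) θ)
        (interpToAmbient (iXY ∘L iDX) iEY θ)) := by
  obtain ⟨B, BD, hran, hBD, hY, hX⟩ := h.exists_operator
  -- The description of `D` as a part of the domain of `B` gives `D ⊆ E` as sets; the closed graph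
  -- theorem makes the inclusion bounded.
  obtain ⟨J, hJ⟩ := exists_continuous_inclusion (iXY ∘L iDX) h.inj_EY fun d => by
    have hd : (iXY ∘L iDX) d ∈ range (iXY ∘L iDX) := ⟨d, rfl⟩
    rw [hran] at hd
    obtain ⟨e, he, -⟩ := hd
    exact ⟨e, he⟩
  have hB : ∀ d, iXY (BD d) = B (J d) := fun d => hBD d (J d) (hJ d)
  obtain ⟨Φ, hΦ⟩ := exists_interp_MR_to_MR (r := r) (r₀ := r₀) (r₁ := r₁) (θ := θ) hT hr iXY iDX iEY
  obtain ⟨Ψ, hΨ⟩ := exists_MR_to_interp_MR (r := r) (θ := θ) hT hr h.inj_EY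
    (hX.hasMaxRegExp hT h.inj_DX r₀) (hY.hasMaxRegExp hT h.inj_EY r₁) hJ hB
  have hi := interpToAmbient_injective (MR.toL1 T r₀ iDX iXY)
    (MR.toL1 T r₁ iEY (ContinuousLinearMap.id ℂ Y)) θ
  have hk := mrToL1_injective (r := r) hT (interpToAmbient (iXY ∘L iDX) iEY θ)
    (interpToAmbient_injective iXY (ContinuousLinearMap.id ℂ Y) θ)
    (interpToAmbient_injective (iXY ∘L iDX) iEY θ)
  refine ⟨⟨mrToL1_injective hT _ Function.injective_id (h.inj_XY.comp h.inj_DX),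
    mrToL1_injective hT _ Function.injective_id h.inj_EY⟩, hi, hk,
    ContinuousLinearEquiv.equivOfInverse Φ Ψ (fun ξ => hi ?_) (fun p => hk ?_), hΦ⟩
  · rw [hΨ, hΦ]
  · rw [hΦ, hΨ]
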